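/- Let $\mathbb U=\{z=x+iy : y>0\}$, $d^2z=dx\,dy$, $\rho(z)=y^{-2}$, $dA=\rho\,d^2z$. Let $\Gamma\subset \mathrm{PSL}(2,\mathbb R)$ be a cofinite Fuchsian group (acting properly discontinuously on $\mathbb U$ with quotient $X=\Gamma\backslash\mathbb U$ of finite hyperbolic area), and let $F$ be a fundamental domain for $\Gamma$ in $\mathbb U$; $\int_X$ means integration over $F$. Let $\Omega_2(X)$ be the space of holomorphic $\phi:\mathbb U\to\mathbb C$ with $\phi(\gamma z)\gamma'(z)^2=\phi(z)$ for all $\gamma\in\Gamma$ and $\int_X|\phi|^2\rho^{-1}d^2z<\infty$, and let $\Omega_{-1,1}(X)=\{y^2\,\overline{\phi} : \phi\in\Omega_2(X)\}$ be the space of harmonic Beltrami differentials. Let $$G(z,w)=\sum_{\gamma\in\Gamma}\mathcal G(\gamma z,w),\qquad \mathcal G(z,w)=\frac{2u+1}{2\pi}\log\frac{u+1}{u}-\frac1\pi,\qquad u=\frac{|z-w|^2}{4\,\mathrm{Im}\,z\,\mathrm{Im}\,w},$$ be the kernel of $2(\Delta_0+2)^{-1}$ on $X$. Let $\tau_j\in\Gamma$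 be an elliptic generator of order $m_j\ge 2$ with fixed point $w_j\in\mathbb U$, i.e. $\tau_j$ generates the stabilizer of $w_j$ in $\Gamma$. For $\mu,\nu\in\Omega_{-1,1}(X)$ the elliptic Takhtajan–Zograf metric at $w_j$ is $$\langle\mu,\nu\rangle^{\mathrm{ell}}_{\mathrm{TZ},j}=2\int_X G(w_j,z)\,\mu(z)\overline{\nu(z)}\,dA(z).$$ Then, with all series and integrals absolutely convergent, $$\langle\mu,\nu\rangle^{\mathrm{ell}}_{\mathrm{TZ},j}=-\frac{24m_j}{m_j^2-1}\,\frac1{\pi^2}\sum_{\gamma\in\tilde\Gamma[\tau_j]}\int_X\int_{\mathbb U}\frac{\mu(z)\,\overline{\nu(w)}}{(z-\bar w)^2(\gamma z-\bar w)^2}\,\gamma'(z)\,d^2w\,d^2z,$$ where $\tilde\Gamma[\tau_j]=\{\alpha\tau_j^{\ell}\alpha^{-1} : \alpha\in\Gamma,\ 1\le\ell\le m_j-1\}$. -/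

import Mathlib

open MeasureTheory UpperHalfPlane
open scoped MatrixGroups ComplexConjugate

/-- `PSL(2, ℝ)` acts on the upper half-plane by Möbius transformations `z ↦ (a z + b) / (c z + d)`
(the restriction of Mathlib's action of `PGL(2, ℝ)`). -/
noncomputable instance pslAction : MulAction PSL(2, ℝ) ℍ :=
  MulAction.compHom ℍ
    (Matrix.ProjectiveSpecialLinearGroup.toPGL : PSL(2, ℝ) →* PGL(2, ℝ))

theorem psl_mk_smul (g : SL(2, ℝ)) (z : ℍ) : (QuotientGroup.mk g : PSL(2, ℝ)) • z = g • z := rfl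

/-- The complex derivative `γ'(z)` of the Möbius transformation `γ` at a point `z` of the upper
half-plane. -/
noncomputable def mobiusDeriv (γ : PSL(2, ℝ)) (z : ℍ) : ℂ :=
  deriv (fun ζ : ℂ ↦ ((γ • ofComplex ζ : ℍ) : ℂ)) (z : ℂ)

/-- Lebesgue measure `d²z = dx dy` on the upper half-plane. (The canonical measure `volume` on `ℍ`
is the hyperbolic area `dA = dx dy / y²`.) -/
noncomputable def lebesgueUHP : Measure ℍ := (volume : Measure ℂ).comap UpperHalfPlane.coe

/-- A cofinite Fuchsian group: a subgroup of `PSL(2, ℝ)` acting properly discontinuously on the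
upper half-plane, with a fundamental domain of finite hyperbolic area. -/
structure IsCofiniteFuchsian (Γ : Subgroup PSL(2, ℝ)) : Prop where
  discontinuous : ProperlyDiscontinuousSMul Γ ℍ
  finite_area : ∃ F : Set ℍ, IsFundamentalDomain Γ F volume ∧ volume F < ⊤

/-- The space `Ω₂(X)`, `X = Γ \ ℍ`, of integrable holomorphic quadratic differentials: holomorphic
functions `φ` on the upper half-plane with `φ(γ z) γ'(z)² = φ(z)` for `γ ∈ Γ` and
`∫_X |φ|² ρ⁻¹ d²z = ∫_X |φ|² y⁴ dA < ∞`. -/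
structure IsHolomorphicQuadraticDifferential (Γ : Subgroup PSL(2, ℝ)) (φ : ℍ → ℂ) : Prop where
  holomorphic : DifferentiableOn ℂ (fun ζ : ℂ ↦ φ (ofComplex ζ)) {ζ : ℂ | 0 < ζ.im}
  automorphic : ∀ γ ∈ Γ, ∀ z : ℍ, φ (γ • z) * mobiusDeriv γ z ^ 2 = φ z
  square_integrable : ∀ F : Set ℍ, IsFundamentalDomain Γ F volume →
    IntegrableOn (fun z : ℍ ↦ ‖φ z‖ ^ 2 * z.im ^ 4) F volume

/-- The space `Ω₋₁,₁(X)` of harmonic Beltrami differentials `μ(z) = y² conj (φ(z))`,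
`φ ∈ Ω₂(X)`. -/
def IsHarmonicBeltrami (Γ : Subgroup PSL(2, ℝ)) (μ : ℍ → ℂ) : Prop :=
  ∃ φ : ℍ → ℂ, IsHolomorphicQuadraticDifferential Γ φ ∧
    ∀ z : ℍ, μ z = (z.im : ℂ) ^ 2 * conj (φ z)

/-- `w` is an elliptic fixed point of `Γ` of order `m ≥ 2`, and `τ` is the associated elliptic
generator: an element of `Γ` of order `m` that generates the stabilizer of `w` in `Γ`. -/
structure IsEllipticGenerator (Γ : Subgroup PSL(2, ℝ)) (τ : PSL(2, ℝ)) (w : ℍ) (m : ℕ) :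
    Prop where
  mem : τ ∈ Γ
  fixes : τ • w = w
  order_eq : orderOf τ = m
  two_le : 2 ≤ m
  stabilizer : ∀ γ ∈ Γ, γ • w = w → γ ∈ Subgroup.zpowers τ

/-- The point-pair invariant `u(z, w) = |z - w|² / (4 Im z Im w)`. -/
noncomputable def pointPair (z w : ℍ) : ℝ :=
  ‖(z : ℂ) - (w : ℂ)‖ ^ 2 / (4 * z.im * w.im)

/-- The kernel of `2 (Δ₀ + 2)⁻¹` on the upper half-plane. -/
noncomputable def greenKernel (z w : ℍ) : ℝ :=
  (2 * pointPair z w + 1) / (2 * Real.pi) *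
    Real.log ((pointPair z w + 1) / pointPair z w) - 1 / Real.pi

/-- The kernel `G(z, w) = ∑_{γ ∈ Γ} greenKernel (γ z) w` of `2 (Δ₀ + 2)⁻¹` on `Γ \ ℍ`. -/
noncomputable def automorphicGreen (Γ : Subgroup PSL(2, ℝ)) (z w : ℍ) : ℝ :=
  ∑' γ : Γ, greenKernel (γ • z) w

/-- The elliptic Takhtajan-Zograf metric `2 ∫_X G(w, z) μ(z) conj (ν(z)) dA(z)` at the elliptic
fixed point `w`, the integral over `X` being taken over the fundamental domain `F`. -/
noncomputable def ellipticTZ (Γ : Subgroup PSL(2, ℝ)) (F : Set ℍ) (w : ℍ) (μ ν : ℍ → ℂ) : ℂ :=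
  2 * ∫ z in F, (automorphicGreen Γ w z : ℂ) * μ z * conj (ν z) ∂volume

/-- The set of the elements `α τ^ℓ α⁻¹`, `α ∈ Γ`, `1 ≤ ℓ ≤ m - 1`. -/
def conjugatePowers (Γ : Subgroup PSL(2, ℝ)) (τ : PSL(2, ℝ)) (m : ℕ) : Set PSL(2, ℝ) :=
  {γ | ∃ α ∈ Γ, ∃ ℓ : ℕ, 1 ≤ ℓ ∧ ℓ ≤ m - 1 ∧ γ = α * τ ^ ℓ * α⁻¹}

/-- The integrand `μ(z) conj (ν(w)) γ'(z) / ((z - conj w)² (γ z - conj w)²)`. -/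
noncomputable def ellipticIntegrand (μ ν : ℍ → ℂ) (γ : PSL(2, ℝ)) (z w : ℍ) : ℂ :=
  μ z * conj (ν w) /
      (((z : ℂ) - conj (w : ℂ)) ^ 2 * (((γ • z : ℍ) : ℂ) - conj (w : ℂ)) ^ 2) *
    mobiusDeriv γ z

/-!
Both sides of the formula unfold to integrals over the upper half-plane, become integrals over the
unit disc in the coordinate `(z - p) / (z - conj p)`, and are diagonal there in the Taylor
coefficients of the quadratic differentials.

Let `μ = y² conj φ` and `ν = y² conj ψ`, and let `Φ = ∑ aₙ ζⁿ` and `Ψ = ∑ bₙ ζⁿ` be the pullbacks of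
`φ` and `ψ` to the disc. On the left, the sum over `Γ` that defines the automorphic Green function
unfolds the integral over `X` to the integral of the free kernel against `μ conj ν`
(`integrableOn_and_ellipticTZ_eq`). As that kernel is radial in the disc coordinate, Parseval's
identity turns the integral into a multiple of `∑ conj aₙ bₙ / ((n + 1)² (n + 2) (n + 3)²)`
(`integral_greenWeight_moment`, `hasSum_integral_greenWeight`).

On the right, the integrand for `α γ α⁻¹` at `(α z, α w)` is the integrand for `γ` at `(z, w)`
(`hyperbolicIntegrand_conj`), so that the sum over `α ∈ Γ` unfolds too (`hasSum_integral_conj`).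
Each conjugate is represented by `m` pairs `(l, α)`: the exponent `l` is determined, and `α` is
determined up to the stabilizer of `p`, which has order `m` (`card_fiber_conjPow`). The remaining
integrals over two copies of the upper half-plane belong to the powers `τ ^ l`, which rotate the
disc by the powers of a primitive `m`-th root of unity `ε`. Their kernels
`1 / ((1 - ζ conj ω)² (1 - ε ^ l ζ conj ω)²)` act diagonally on Taylor coefficients
(`hasSum_twisted_projection`). As `Ψ` is invariant under the rotation, only the coefficients with
`m ∣ n + 2` occur, and for these the sum over `l` of the multipliers is
`-(n + 2) (m² - 1) / 6` (`sum_mul_twistCoeff`). Together with the moments of the Bergman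
weight `(1 - |ζ|²)²` this is the same diagonal form up to a constant (`disc_identity`).

Convergence rests on the bound `exists_orbit_sum_bound` for the orbit sums of `(1 + u)^(-3/2)`, which
is uniform on the upper half-plane. By unfolding, it shows that `Φ` and `Ψ` are square integrable for
the weight `(1 - |ζ|²)^(7/2)`. This suffices on both sides: the Green weight decays like
`(1 - |ζ|²)⁴`, and integrating the twisted kernel over one variable costs only a factor
`(1 - |ζ|²)^(-1/2)`, because `ε ^ l ≠ 1` keeps its two factors from being small together
(`norm_twistFactor_le`).
-/

/-! ### Parseval's identity on the unit disc -/

/-- The point of the plane with polar coordinates `(r, θ)`. -/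
noncomputable def polarPoint (r θ : ℝ) : ℂ := r * Complex.exp (θ * Complex.I)

theorem norm_polarPoint {r : ℝ} (hr : 0 ≤ r) (θ : ℝ) : ‖polarPoint r θ‖ = r := by
  simp [polarPoint, Complex.norm_exp_ofReal_mul_I, abs_of_nonneg hr]

theorem continuous_polarPoint : Continuous fun p : ℝ × ℝ ↦ polarPoint p.1 p.2 := by
  unfold polarPoint; fun_prop

theorem polarCoord_symm_eq_polarPoint (p : ℝ × ℝ) :
    Complex.polarCoord.symm p = polarPoint p.1 p.2 := by
  rw [Complex.polarCoord_symm_apply, polarPoint, Complex.exp_mul_I]; simp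

theorem polarTarget_inter_disc {p : ℝ × ℝ} (hp : p ∈ polarCoord.target) :
    Complex.polarCoord.symm p ∈ Metric.ball (0 : ℂ) 1 ↔
      p ∈ Set.Ioo (0 : ℝ) 1 ×ˢ Set.Ioo (-Real.pi) Real.pi := by
  rw [polarCoord_target] at hp
  obtain ⟨h1, h2⟩ := hp
  rw [polarCoord_symm_eq_polarPoint, mem_ball_zero_iff, norm_polarPoint (le_of_lt h1)]
  exact ⟨fun h ↦ ⟨⟨h1, h⟩, h2⟩, fun h ↦ h.1.2⟩

theorem integrableOn_polar_of_integrableOn_disc {g : ℂ → ℂ}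
    (hg : IntegrableOn g (Metric.ball 0 1)) :
    IntegrableOn (fun p : ℝ × ℝ ↦ (p.1 : ℂ) * g (polarPoint p.1 p.2))
      (Set.Ioo (0 : ℝ) 1 ×ˢ Set.Ioo (-Real.pi) Real.pi) := by
  have h1 : Integrable ((Metric.ball (0 : ℂ) 1).indicator g) :=
    (integrable_indicator_iff measurableSet_ball).2 hg
  set G := (Metric.ball (0 : ℂ) 1).indicator g
  have h2 : Integrable (fun p : ℝ × ℝ ↦ G (Complex.measurableEquivRealProd.symm p)) :=
    Complex.volume_preserving_equiv_real_prod.symm.integrable_comp_of_integrable h1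
  have h3 : IntegrableOn (fun p : ℝ × ℝ ↦ G (Complex.measurableEquivRealProd.symm p))
      (polarCoord.symm '' polarCoord.target) := h2.integrableOn
  rw [integrableOn_image_iff_integrableOn_abs_det_fderiv_smul volume
    polarCoord.open_target.measurableSet
    (fun p _ ↦ (hasFDerivAt_polarCoord_symm p).hasFDerivWithinAt) polarCoord.symm.injOn] at h3
  have h4 := h3.mono_set (show Set.Ioo (0 : ℝ) 1 ×ˢ Set.Ioo (-Real.pi) Real.pi ⊆
    polarCoord.target from fun x hx ↦ ⟨hx.1.1, hx.2⟩)
  refine h4.congr_fun ?_ (measurableSet_Ioo.prod measurableSet_Ioo)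
  rintro p ⟨hp1, hp2⟩
  have hp : p ∈ polarCoord.target := ⟨hp1.1, hp2⟩
  have hb := (polarTarget_inter_disc hp).2 ⟨hp1, hp2⟩
  simp only [det_fderivPolarCoordSymm, Complex.measurableEquivRealProd_symm_polarCoord_symm_apply]
  rw [abs_of_pos hp1.1]
  simp only [G]
  rw [Set.indicator_of_mem hb, polarCoord_symm_eq_polarPoint, Complex.real_smul]

theorem integral_disc_eq_polar {g : ℂ → ℂ} (hg : IntegrableOn g (Metric.ball 0 1)) :
    ∫ z in Metric.ball (0 : ℂ) 1, g z =
      ∫ r in Set.Ioo (0 : ℝ) 1, (r : ℂ) * ∫ θ in Set.Ioo (-Real.pi) Real.pi,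
        g (polarPoint r θ) := by
  have h0 := setIntegral_prod _ (integrableOn_polar_of_integrableOn_disc hg)
  simp only [integral_const_mul] at h0
  rw [← h0, ← Measure.volume_eq_prod]
  rw [← integral_indicator measurableSet_ball, ← Complex.integral_comp_polarCoord_symm,
    ← integral_indicator polarCoord.open_target.measurableSet,
    ← integral_indicator (measurableSet_Ioo.prod measurableSet_Ioo)]
  congr 1
  ext p
  by_cases hp : p ∈ polarCoord.target
  · rw [Set.indicator_of_mem hp]
    by_cases hb : Complex.polarCoord.symm p ∈ Metric.ball (0 : ℂ) 1
    · rw [Set.indicator_of_mem hb, Set.indicator_of_mem ((polarTarget_inter_disc hp).1 hb),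
        polarCoord_symm_eq_polarPoint, Complex.real_smul]
    · rw [Set.indicator_of_notMem hb, Set.indicator_of_notMem
        (fun h ↦ hb ((polarTarget_inter_disc hp).2 h)), smul_zero]
  · rw [Set.indicator_of_notMem hp, Set.indicator_of_notMem]
    rintro ⟨h1, h2⟩
    exact hp ⟨h1.1, h2⟩

theorem integral_circle_exp (k : ℤ) (hk : k ≠ 0) :
    ∫ θ in Set.Ioo (-Real.pi) Real.pi, Complex.exp (k * θ * Complex.I) = 0 := by
  rw [← integral_Ioc_eq_integral_Ioo, ← intervalIntegral.integral_of_le (by linarith [Real.pi_pos])]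
  have hc : (k : ℂ) * Complex.I ≠ 0 := mul_ne_zero (by exact_mod_cast hk) Complex.I_ne_zero
  have : (fun θ : ℝ ↦ Complex.exp (k * θ * Complex.I)) =
      fun θ : ℝ ↦ Complex.exp (k * Complex.I * θ) := by ext θ; ring_nf
  rw [this, integral_exp_mul_complex hc, div_eq_zero_iff]
  left
  rw [sub_eq_zero, Complex.exp_eq_exp_iff_exists_int]
  exact ⟨k, by push_cast; ring⟩

/-- Orthogonality of the monomials on the circle of radius `r`. -/
theorem integral_circle_monomial {r : ℝ} (m n : ℕ) :
    ∫ θ in Set.Ioo (-Real.pi) Real.pi, conj (polarPoint r θ ^ m) * polarPoint r θ ^ n =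
      if m = n then (2 * Real.pi * r ^ (2 * n) : ℂ) else 0 := by
  have key : ∀ θ : ℝ, conj (polarPoint r θ ^ m) * polarPoint r θ ^ n =
      (r : ℂ) ^ (m + n) * Complex.exp (((n - m : ℤ) : ℂ) * θ * Complex.I) := by
    intro θ
    simp only [polarPoint, mul_pow, map_mul, map_pow, Complex.conj_ofReal, ← Complex.exp_conj,
      Complex.conj_I]
    rw [← Complex.exp_nat_mul, ← Complex.exp_nat_mul]
    rw [show (r : ℂ) ^ m * Complex.exp (m * (θ * -Complex.I)) *
      (r ^ n * Complex.exp (n * (θ * Complex.I))) = r ^ (m + n) *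
      (Complex.exp (m * (θ * -Complex.I)) * Complex.exp (n * (θ * Complex.I))) by ring,
      ← Complex.exp_add]
    push_cast; ring_nf
  simp only [key, integral_const_mul]
  split_ifs with h
  · subst h
    simp [Real.pi_pos.le]
    ring
  · rw [integral_circle_exp _ (by omega), mul_zero]

/-- Parseval's identity on the circle of radius `r`. -/
theorem hasSum_circle_parseval {a b : ℕ → ℂ} {Φ Ψ : ℂ → ℂ}
    (hΦ : ∀ z ∈ Metric.ball (0 : ℂ) 1, HasSum (fun n ↦ a n * z ^ n) (Φ z))
    (hΨ : ∀ z ∈ Metric.ball (0 : ℂ) 1, HasSum (fun n ↦ b n * z ^ n) (Ψ z))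
    {r : ℝ} (hr : r ∈ Set.Ioo (0 : ℝ) 1) :
    HasSum (fun n ↦ conj (a n) * b n * (2 * Real.pi * r ^ (2 * n) : ℂ))
      (∫ θ in Set.Ioo (-Real.pi) Real.pi, conj (Φ (polarPoint r θ)) * Ψ (polarPoint r θ)) := by
  have hmem : ∀ θ, polarPoint r θ ∈ Metric.ball (0 : ℂ) 1 := fun θ ↦ by
    rw [mem_ball_zero_iff, norm_polarPoint hr.1.le]; exact hr.2
  have hn : ∀ {c : ℕ → ℂ} {X : ℂ → ℂ}, (∀ z ∈ Metric.ball (0 : ℂ) 1,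
      HasSum (fun n ↦ c n * z ^ n) (X z)) → Summable fun n ↦ ‖c n‖ * r ^ n := fun {c X} h ↦ by
    have := (h _ (hmem 0)).summable.norm
    simpa only [norm_mul, norm_pow, norm_polarPoint hr.1.le] using this
  have hsa := hn hΦ
  have hsb := hn hΨ
  have hprod := hsa.mul_of_nonneg hsb (fun n ↦ by have := hr.1; positivity)
    (fun n ↦ by have := hr.1; positivity)
  let F : ℕ × ℕ → ℝ → ℂ := fun q θ ↦
    conj (a q.1 * polarPoint r θ ^ q.1) * (b q.2 * polarPoint r θ ^ q.2)
  have hcont : ∀ q, Continuous (F q) := fun q ↦ by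
    have : Continuous fun θ ↦ polarPoint r θ :=
      continuous_polarPoint.comp (Continuous.prodMk_right r)
    have h2 := Complex.continuous_conj
    simp only [F]; fun_prop
  have hnorm : ∀ q θ, ‖F q θ‖ = ‖a q.1‖ * r ^ q.1 * (‖b q.2‖ * r ^ q.2) := fun q θ ↦ by
    simp only [F, norm_mul, norm_pow, norm_polarPoint hr.1.le, RCLike.norm_conj]
  have hF := hasSum_integral_of_summable_integral_norm
    (μ := volume.restrict (Set.Ioo (-Real.pi) Real.pi)) (F := F)
    (fun q ↦ ((hcont q).integrableOn_Icc (a := -Real.pi) (b := Real.pi)).mono_set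
      Set.Ioo_subset_Icc_self) (by
      simp only [hnorm, integral_const]
      exact hprod.const_smul _)
  have hlim : ∀ θ, ∑' q, F q θ = conj (Φ (polarPoint r θ)) * Ψ (polarPoint r θ) := fun θ ↦ by
    have h1 : HasSum (fun n ↦ conj (a n * polarPoint r θ ^ n)) (conj (Φ (polarPoint r θ))) :=
      (Complex.hasSum_conj' (f := fun n ↦ a n * polarPoint r θ ^ n)).2 (hΦ _ (hmem θ))
    have h2 : Summable fun q ↦ F q θ :=
      Summable.of_norm (hprod.congr fun q ↦ (hnorm q θ).symm)
    exact (h1.mul (hΨ _ (hmem θ)) h2).tsum_eq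
  simp only [hlim] at hF
  have hval : ∀ q, ∫ θ in Set.Ioo (-Real.pi) Real.pi, F q θ =
      conj (a q.1) * b q.2 * if q.1 = q.2 then (2 * Real.pi * r ^ (2 * q.2) : ℂ) else 0 := by
    intro q
    rw [← integral_circle_monomial, ← integral_const_mul]
    congr 1; ext θ; simp only [F, map_mul]; ring
  simp only [hval] at hF
  have hinj : Function.Injective fun n : ℕ ↦ (n, n) := fun x y h ↦ (Prod.ext_iff.1 h).1
  rw [← hinj.hasSum_iff] at hF
  · simpa [Function.comp_def] using hF
  · rintro ⟨x, y⟩ hxy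
    have : x ≠ y := fun h ↦ hxy ⟨x, by simp [h]⟩
    simp [this]

/-- Parseval's identity on the disc for a radial weight `W`: the monomials are orthogonal. -/
theorem hasSum_disc_parseval {W : ℝ → ℝ} {a b : ℕ → ℂ} {Φ Ψ : ℂ → ℂ}
    (hΦ : ∀ z ∈ Metric.ball (0 : ℂ) 1, HasSum (fun n ↦ a n * z ^ n) (Φ z))
    (hΨ : ∀ z ∈ Metric.ball (0 : ℂ) 1, HasSum (fun n ↦ b n * z ^ n) (Ψ z))
    (hW : ∀ n : ℕ, IntegrableOn (fun r ↦ W r * r ^ (2 * n + 1)) (Set.Ioo (0 : ℝ) 1))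
    (hint : IntegrableOn (fun z : ℂ ↦ (W ‖z‖ : ℂ) * (conj (Φ z) * Ψ z)) (Metric.ball 0 1))
    (hsum : Summable fun n ↦ ‖a n‖ * ‖b n‖ * ∫ r in Set.Ioo (0 : ℝ) 1, |W r| * r ^ (2 * n + 1)) :
    HasSum (fun n ↦ conj (a n) * b n *
        (2 * Real.pi * (∫ r in Set.Ioo (0 : ℝ) 1, W r * r ^ (2 * n + 1) : ℝ) : ℂ))
      (∫ z in Metric.ball (0 : ℂ) 1, (W ‖z‖ : ℂ) * (conj (Φ z) * Ψ z)) := by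
  rw [integral_disc_eq_polar hint]
  let F : ℕ → ℝ → ℂ := fun n r ↦
    conj (a n) * b n * (2 * Real.pi) * ((W r * r ^ (2 * n + 1) : ℝ) : ℂ)
  have h1 : ∀ n, IntegrableOn (F n) (Set.Ioo (0 : ℝ) 1) := fun n ↦ by
    have := (hW n).ofReal (𝕜 := ℂ)
    exact this.const_mul _
  have h2 : ∀ n, ∫ r in Set.Ioo (0 : ℝ) 1, ‖F n r‖ = 2 * Real.pi *
      (‖a n‖ * ‖b n‖ * ∫ r in Set.Ioo (0 : ℝ) 1, |W r| * r ^ (2 * n + 1)) := fun n ↦ by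
    rw [← mul_assoc, ← integral_const_mul]
    refine setIntegral_congr_fun measurableSet_Ioo fun r hr ↦ ?_
    have : (0 : ℝ) ≤ r ^ (2 * n + 1) := pow_nonneg hr.1.le _
    simp only [F, norm_mul, RCLike.norm_conj, Complex.norm_real, Complex.norm_ofNat,
      Real.norm_eq_abs, abs_of_pos Real.pi_pos, abs_of_nonneg this]
    ring
  have h3 := hasSum_integral_of_summable_integral_norm h1 (by
    simp only [h2]; exact hsum.mul_left _)
  have h4 : ∀ n, ∫ r in Set.Ioo (0 : ℝ) 1, F n r = conj (a n) * b n *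
        (2 * Real.pi * (∫ r in Set.Ioo (0 : ℝ) 1, W r * r ^ (2 * n + 1) : ℝ) : ℂ) := fun n ↦ by
    simp only [F]
    rw [integral_const_mul, integral_complex_ofReal]; ring
  simp only [h4] at h3
  suffices h : ∫ r in Set.Ioo (0 : ℝ) 1, (r : ℂ) * ∫ θ in Set.Ioo (-Real.pi) Real.pi,
      (W ‖polarPoint r θ‖ : ℂ) * (conj (Φ (polarPoint r θ)) * Ψ (polarPoint r θ)) =
      ∫ r in Set.Ioo (0 : ℝ) 1, ∑' n, F n r by rw [h]; exact h3
  refine setIntegral_congr_fun measurableSet_Ioo fun r hr ↦ ?_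
  simp only [norm_polarPoint hr.1.le, integral_const_mul]
  have h5 := (hasSum_circle_parseval hΦ hΨ hr).mul_left ((r : ℂ) * W r)
  rw [← mul_assoc, ← h5.tsum_eq]
  refine tsum_congr fun n ↦ ?_
  simp only [F]; push_cast; ring

/-- Bessel's inequality on the disc for a nonnegative radial weight `W`. -/
theorem summable_disc_bessel {W : ℝ → ℝ} {a : ℕ → ℂ} {Φ : ℂ → ℂ}
    (hΦ : ∀ z ∈ Metric.ball (0 : ℂ) 1, HasSum (fun n ↦ a n * z ^ n) (Φ z))
    (hW : ∀ n : ℕ, IntegrableOn (fun r ↦ W r * r ^ (2 * n + 1)) (Set.Ioo (0 : ℝ) 1))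
    (hW0 : ∀ r ∈ Set.Ioo (0 : ℝ) 1, 0 ≤ W r)
    (hint : IntegrableOn (fun z : ℂ ↦ W ‖z‖ * ‖Φ z‖ ^ 2) (Metric.ball 0 1)) :
    Summable fun n ↦ ‖a n‖ ^ 2 * ∫ r in Set.Ioo (0 : ℝ) 1, W r * r ^ (2 * n + 1) := by
  have hint' : IntegrableOn (fun z : ℂ ↦ (W ‖z‖ : ℂ) * (conj (Φ z) * Φ z)) (Metric.ball 0 1) := by
    refine IntegrableOn.congr_fun (hint.ofReal (𝕜 := ℂ)) (fun z _ ↦ ?_) measurableSet_ball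
    simp [Complex.conj_mul']
  have h1 := integrableOn_polar_of_integrableOn_disc hint'
  rw [IntegrableOn, Measure.volume_eq_prod, ← Measure.prod_restrict] at h1
  have h2 := h1.integral_prod_left
  refine summable_of_sum_le (c := ‖∫ z in Metric.ball (0 : ℂ) 1, (W ‖z‖ : ℂ) * (conj (Φ z) * Φ z)‖)
    (fun n ↦ mul_nonneg (by positivity) (setIntegral_nonneg measurableSet_Ioo fun r hr ↦
      mul_nonneg (hW0 r hr) (pow_nonneg hr.1.le _))) fun s ↦ ?_
  have hcirc : ∀ r ∈ Set.Ioo (0 : ℝ) 1, ∃ S : ℝ, (∑ n ∈ s, ‖a n‖ ^ 2 * r ^ (2 * n) ≤ S) ∧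
      (∫ θ in Set.Ioo (-Real.pi) Real.pi, (r : ℂ) * ((W ‖polarPoint r θ‖ : ℂ) *
        (conj (Φ (polarPoint r θ)) * Φ (polarPoint r θ)))) = ((r * W r * S : ℝ) : ℂ) := by
    intro r hr
    have h5 := hasSum_circle_parseval hΦ hΦ hr
    have h6 : HasSum (fun n ↦ ((2 * Real.pi * (‖a n‖ ^ 2 * r ^ (2 * n)) : ℝ) : ℂ))
      (∫ θ in Set.Ioo (-Real.pi) Real.pi, conj (Φ (polarPoint r θ)) * Φ (polarPoint r θ)) := by
      convert h5 using 2 with n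
      rw [Complex.conj_mul']; push_cast; ring
    have h7 := (Complex.hasSum_re h6)
    refine ⟨∑' n, 2 * Real.pi * (‖a n‖ ^ 2 * r ^ (2 * n)), ?_, ?_⟩
    rotate_left
    · simp only [norm_polarPoint hr.1.le, integral_const_mul]
      rw [← h6.tsum_eq, ← Complex.ofReal_tsum, ← mul_assoc]
      push_cast; rfl
    · simp only [Complex.ofReal_re] at h7
      refine le_trans ?_ (h7.summable.sum_le_tsum s fun n _ ↦ ?_)
      · refine Finset.sum_le_sum fun n _ ↦ ?_
        have : 0 ≤ ‖a n‖ ^ 2 * r ^ (2 * n) := mul_nonneg (by positivity) (pow_nonneg hr.1.le _)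
        nlinarith [Real.pi_gt_three]
      · have := pow_nonneg hr.1.le (2 * n)
        have := Real.pi_pos
        positivity
  rw [integral_disc_eq_polar hint']
  simp only [← integral_const_mul]
  have hre : ∀ x : ℂ, x.re ≤ ‖x‖ := Complex.re_le_norm
  refine le_trans ?_ (hre _)
  have h8 := integral_re (𝕜 := ℂ) h2
  simp only [RCLike.re_to_complex] at h8
  rw [← h8]
  rw [← integral_finsetSum _ fun n _ ↦ (hW n).const_mul _]
  refine setIntegral_mono_on (integrable_finsetSum _ fun n _ ↦ (hW n).const_mul _)
    h2.re measurableSet_Ioo fun r hr ↦ ?_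
  obtain ⟨S, hS, hS'⟩ := hcirc r hr
  rw [hS']
  simp only [Complex.ofReal_re]
  calc _ = r * W r * ∑ n ∈ s, ‖a n‖ ^ 2 * r ^ (2 * n) := by
        rw [Finset.mul_sum]; exact Finset.sum_congr rfl fun n _ ↦ by ring
    _ ≤ _ := mul_le_mul_of_nonneg_left hS (mul_nonneg hr.1.le (hW0 r hr))

/-! ### The resolvent kernel as a radial weight -/

/-- The kernel of `2 (Δ₀ + 2)⁻¹` as a function of the point-pair invariant. -/
noncomputable def greenProfile (u : ℝ) : ℝ :=
  (2 * u + 1) / (2 * Real.pi) * Real.log ((u + 1) / u) - 1 / Real.pi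

theorem measurable_greenProfile : Measurable greenProfile := by
  unfold greenProfile; fun_prop

theorem greenProfile_nonneg {u : ℝ} (hu : 0 < u) : 0 ≤ greenProfile u := by
  have h := Real.hasSum_log_one_add_inv hu
  have h1 : 2 / (2 * u + 1) ≤ Real.log (1 + u⁻¹) := by
    have := h.summable.sum_le_tsum {0} fun k _ ↦ by positivity
    rw [h.tsum_eq] at this
    simpa [div_eq_mul_inv] using this
  rw [div_le_iff₀ (by positivity)] at h1
  have h2 : (u + 1) / u = 1 + u⁻¹ := by field_simp
  rw [greenProfile, h2, sub_nonneg, div_mul_eq_mul_div, div_le_div_iff₀ Real.pi_pos (by positivity)]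
  nlinarith [Real.pi_pos]

/-- The kernel decays quadratically in the point-pair invariant: compare the series of
`log (1 + u⁻¹)` in powers of `(2 u + 1)⁻¹` with a geometric series. -/
theorem greenProfile_le {u : ℝ} (hu : 0 < u) :
    greenProfile u ≤ 1 / (12 * Real.pi * (u * (u + 1))) := by
  have h := Real.hasSum_log_one_add_inv hu
  set x : ℝ := 1 / (2 * u + 1) with hx
  have hx0 : 0 < x := by positivity
  have hx1 : x < 1 := by rw [hx, div_lt_one (by positivity)]; linarith
  have hx2 : x ^ 2 < 1 := by nlinarith
  have hg := (hasSum_geometric_of_lt_one (sq_nonneg x) hx2).mul_left (2 / 3 * x ^ 3)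
  have h0 := (hasSum_nat_add_iff' 1).2 h
  have h1 := hasSum_le (fun k ↦ ?_) h0 hg
  · simp only [Finset.range_one, Finset.sum_singleton] at h1
    have h2 : (u + 1) / u = 1 + u⁻¹ := by field_simp
    have h3 : Real.log (1 + u⁻¹) ≤ 2 * x + 2 / 3 * x ^ 3 * (1 - x ^ 2)⁻¹ := by
      norm_num at h1; linarith
    have h4 : (2 * u + 1) / (2 * Real.pi) * Real.log (1 + u⁻¹) ≤ (2 * u + 1) / (2 * Real.pi) *
        (2 * x + 2 / 3 * x ^ 3 * (1 - x ^ 2)⁻¹) :=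
      mul_le_mul_of_nonneg_left h3 (by have := Real.pi_pos; positivity)
    rw [greenProfile, h2]
    refine (sub_le_sub_right h4 _).trans (le_of_eq ?_)
    have h5 : 1 - x ^ 2 = 4 * u * (u + 1) / (2 * u + 1) ^ 2 := by rw [hx]; field_simp; ring
    have := Real.pi_pos
    rw [h5, hx]; field_simp; ring
  · have : (1 : ℝ) / (2 * ((k + 1 : ℕ) : ℝ) + 1) ≤ 1 / 3 :=
      one_div_le_one_div_of_le (by norm_num) (by push_cast; linarith [k.cast_nonneg (α := ℝ)])
    calc 2 * (1 / (2 * ((k + 1 : ℕ) : ℝ) + 1)) * x ^ (2 * (k + 1) + 1)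
        ≤ 2 * (1 / 3) * x ^ (2 * (k + 1) + 1) := by gcongr
      _ = 2 / 3 * x ^ 3 * (x ^ 2) ^ k := by ring

/-- The weight `(1 - r²)² 𝒢` on the unit disc, where `𝒢` is the kernel of `2 (Δ₀ + 2)⁻¹` between
the origin and a point at Euclidean distance `r`. -/
noncomputable def greenWeight (r : ℝ) : ℝ :=
  (1 - r ^ 2) ^ 2 * greenProfile (r ^ 2 / (1 - r ^ 2))

theorem measurable_greenWeight : Measurable greenWeight := by
  have := measurable_greenProfile
  unfold greenWeight; fun_prop

theorem one_sub_sq_pos {r : ℝ} (hr : r ∈ Set.Ioo (0 : ℝ) 1) : 0 < 1 - r ^ 2 := by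
  nlinarith [hr.1, hr.2]

theorem greenWeight_eq {r : ℝ} (hr : r ∈ Set.Ioo (0 : ℝ) 1) :
    greenWeight r = (-(1 - r ^ 4) * Real.log r - (1 - r ^ 2) ^ 2) / Real.pi := by
  have h1 := one_sub_sq_pos hr
  have h0 := hr.1
  have h2 : (r ^ 2 / (1 - r ^ 2) + 1) / (r ^ 2 / (1 - r ^ 2)) = (r ^ 2)⁻¹ := by
    field_simp; ring
  rw [greenWeight, greenProfile, h2, Real.log_inv, Real.log_pow]
  have := Real.pi_pos
  field_simp
  push_cast; ring

theorem greenWeight_nonneg {r : ℝ} (hr : r ∈ Set.Ioo (0 : ℝ) 1) : 0 ≤ greenWeight r :=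
  mul_nonneg (sq_nonneg _) (greenProfile_nonneg (div_pos (pow_pos hr.1 2) (one_sub_sq_pos hr)))

theorem greenWeight_le {r : ℝ} (hr : r ∈ Set.Ioo (0 : ℝ) 1) (h : 1 / 2 ≤ r) :
    greenWeight r ≤ (1 - r ^ 2) ^ 4 := by
  have h1 := one_sub_sq_pos hr
  have h0 := hr.1
  have h2 := greenProfile_le (div_pos (pow_pos hr.1 2) h1)
  have h3 : r ^ 2 / (1 - r ^ 2) * (r ^ 2 / (1 - r ^ 2) + 1) = r ^ 2 / (1 - r ^ 2) ^ 2 := by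
    field_simp; ring
  rw [h3] at h2
  have h4 : 1 / (12 * Real.pi * (r ^ 2 / (1 - r ^ 2) ^ 2)) ≤ (1 - r ^ 2) ^ 2 := by
    rw [div_le_iff₀ (by have := Real.pi_pos; positivity)]
    have : (1 - r ^ 2) ^ 2 * (12 * Real.pi * (r ^ 2 / (1 - r ^ 2) ^ 2)) = 12 * Real.pi * r ^ 2 := by
      field_simp
    rw [this]
    nlinarith [Real.pi_gt_three]
  calc greenWeight r ≤ (1 - r ^ 2) ^ 2 * (1 - r ^ 2) ^ 2 :=
        mul_le_mul_of_nonneg_left (h2.trans h4) (sq_nonneg _)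
    _ = _ := by ring

theorem continuous_pow_mul_log (k : ℕ) : Continuous fun r : ℝ ↦ r ^ (k + 1) * Real.log r := by
  have : (fun r : ℝ ↦ r ^ (k + 1) * Real.log r) = fun r ↦ r ^ k * (r * Real.log r) := by
    ext r; ring
  rw [this]
  exact (continuous_pow k).mul Real.continuous_mul_log

theorem integral_pow_mul_log (k : ℕ) :
    ∫ r in (0 : ℝ)..1, r ^ (k + 1) * Real.log r = -1 / ((k : ℝ) + 2) ^ 2 := by
  have hk : (k : ℝ) + 2 ≠ 0 := by positivity
  rw [intervalIntegral.integral_eq_sub_of_hasDerivAt_of_le zero_le_one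
    (f := fun r ↦ r ^ (k + 2) * Real.log r / (k + 2) - r ^ (k + 2) / (k + 2) ^ 2)]
  · simp; ring
  · exact (((continuous_pow_mul_log (k + 1)).div_const _).sub
      ((continuous_pow _).div_const _)).continuousOn
  · intro r hr
    have h1 := (((hasDerivAt_pow (k + 2) r).mul (Real.hasDerivAt_log hr.1.ne')).div_const
      ((k : ℝ) + 2)).sub ((hasDerivAt_pow (k + 2) r).div_const (((k : ℝ) + 2) ^ 2))
    refine h1.congr_deriv ?_
    have := hr.1.ne'
    simp only [Nat.add_one_sub_one]
    push_cast
    rw [show r ^ (k + 2) = r ^ (k + 1) * r by ring]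
    field_simp
    ring
  · exact (continuous_pow_mul_log k).intervalIntegrable _ _

theorem integral_Ioo_eq_interval (f : ℝ → ℝ) :
    ∫ r in Set.Ioo (0 : ℝ) 1, f r = ∫ r in (0 : ℝ)..1, f r := by
  rw [intervalIntegral.integral_of_le zero_le_one, integral_Ioc_eq_integral_Ioo]

theorem integrableOn_Ioo_of_continuous {f : ℝ → ℝ} (hf : Continuous f) :
    IntegrableOn f (Set.Ioo (0 : ℝ) 1) :=
  hf.integrableOn_Icc.mono_set Set.Ioo_subset_Icc_self

/-- The moments of the Bergman weight. -/
theorem integral_sq_weight_moment (n : ℕ) :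
    ∫ r in Set.Ioo (0 : ℝ) 1, (1 - r ^ 2) ^ 2 * r ^ (2 * n + 1) =
      1 / (((n : ℝ) + 1) * (n + 2) * (n + 3)) := by
  have : ∀ r : ℝ, (1 - r ^ 2) ^ 2 * r ^ (2 * n + 1) =
      r ^ (2 * n + 1) - 2 * r ^ (2 * n + 3) + r ^ (2 * n + 5) := fun r ↦ by ring
  simp only [this]
  rw [integral_Ioo_eq_interval, intervalIntegral.integral_add, intervalIntegral.integral_sub,
    intervalIntegral.integral_const_mul]
  · simp only [integral_pow]
    push_cast
    simp
    field_simp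
    ring
  all_goals exact Continuous.intervalIntegrable (by fun_prop) _ _

theorem greenWeight_mul_pow (n : ℕ) {r : ℝ} (hr : r ∈ Set.Ioo (0 : ℝ) 1) :
    greenWeight r * r ^ (2 * n + 1) =
      (-(r ^ (2 * n + 1) * Real.log r) + r ^ (2 * n + 5) * Real.log r -
        (1 - r ^ 2) ^ 2 * r ^ (2 * n + 1)) / Real.pi := by
  rw [greenWeight_eq hr]; ring

theorem integrableOn_greenWeight_mul_pow (n : ℕ) :
    IntegrableOn (fun r ↦ greenWeight r * r ^ (2 * n + 1)) (Set.Ioo (0 : ℝ) 1) := by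
  refine IntegrableOn.congr_fun (integrableOn_Ioo_of_continuous ?_)
    (fun r hr ↦ (greenWeight_mul_pow n hr).symm) measurableSet_Ioo
  have h1 := continuous_pow_mul_log (2 * n)
  have h2 := continuous_pow_mul_log (2 * n + 4)
  have h3 : Continuous fun r : ℝ ↦ (1 - r ^ 2) ^ 2 * r ^ (2 * n + 1) := by fun_prop
  exact ((h1.neg.add h2).sub h3).div_const _

/-- The moments of the Green weight. They differ from the squares of those of `(1 - r²)²` by the
factor `n + 2`, up to a constant, and that factor is what the sum over the rotations produces. -/
theorem integral_greenWeight_moment (n : ℕ) :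
    ∫ r in Set.Ioo (0 : ℝ) 1, greenWeight r * r ^ (2 * n + 1) =
      1 / (Real.pi * ((n + 1) ^ 2 * (n + 2) * (n + 3) ^ 2)) := by
  rw [setIntegral_congr_fun measurableSet_Ioo fun r hr ↦ greenWeight_mul_pow n hr]
  have h1 := continuous_pow_mul_log (2 * n)
  have h2 := continuous_pow_mul_log (2 * n + 4)
  have h3 : Continuous fun r : ℝ ↦ (1 - r ^ 2) ^ 2 * r ^ (2 * n + 1) := by fun_prop
  rw [integral_div, integral_sub, integral_add, integral_neg, integral_sq_weight_moment,
    integral_Ioo_eq_interval, integral_Ioo_eq_interval, integral_pow_mul_log,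
    integral_pow_mul_log (2 * n + 4)]
  · have := Real.pi_pos
    push_cast
    have e1 : (2 * (n : ℝ) + 2) = 2 * (n + 1) := by ring
    have e2 : (2 * (n : ℝ) + 4 + 2) = 2 * (n + 3) := by ring
    rw [e1, e2]
    field_simp
    ring
  · exact integrableOn_Ioo_of_continuous h1.neg
  · exact integrableOn_Ioo_of_continuous h2
  · exact integrableOn_Ioo_of_continuous (h1.neg.add h2)
  · exact integrableOn_Ioo_of_continuous h3

theorem integrableOn_disc_greenWeight :
    IntegrableOn (fun z : ℂ ↦ greenWeight ‖z‖) (Metric.ball 0 1) := by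
  rw [integrableOn_fun_norm_addHaar]
  refine IntegrableOn.congr_fun (integrableOn_greenWeight_mul_pow 0) (fun r _ ↦ ?_)
    measurableSet_Ioo
  simp [mul_comm]

/-! ### Power series of the twisted kernel and sums over roots of unity -/

/-- The Taylor coefficients of `1 / ((1 - x)² (1 - ε x)²)`. -/
noncomputable def twistCoeff (ε : ℂ) (n : ℕ) : ℂ :=
  ∑ k ∈ Finset.range (n + 1), ((k : ℂ) + 1) * ε ^ k * (((n - k : ℕ) : ℂ) + 1)

theorem hasSum_inv_one_sub_sq {x : ℂ} (hx : ‖x‖ < 1) :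
    HasSum (fun n : ℕ ↦ ((n : ℂ) + 1) * x ^ n) (1 / (1 - x) ^ 2) := by
  simpa using hasSum_choose_mul_geometric_of_norm_lt_one 1 hx

theorem twistCoeff_mul_pow (ε x : ℂ) (n : ℕ) : twistCoeff ε n * x ^ n =
    ∑ k ∈ Finset.range (n + 1), (((k : ℂ) + 1) * (ε * x) ^ k) *
      ((((n - k : ℕ) : ℂ) + 1) * x ^ (n - k)) := by
  rw [twistCoeff, Finset.sum_mul]
  refine Finset.sum_congr rfl fun k hk ↦ ?_
  have : x ^ n = x ^ k * x ^ (n - k) := by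
    rw [← pow_add]; congr 1; have := Finset.mem_range.1 hk; omega
  rw [this, mul_pow]; ring

theorem summable_norm_twistCoeff {ε x : ℂ} (hε : ‖ε‖ = 1) (hx : ‖x‖ < 1) :
    Summable fun n ↦ ‖twistCoeff ε n * x ^ n‖ := by
  simp only [twistCoeff_mul_pow]
  refine summable_norm_sum_mul_range_of_summable_norm
    (f := fun k : ℕ ↦ ((k : ℂ) + 1) * (ε * x) ^ k) (g := fun k : ℕ ↦ ((k : ℂ) + 1) * x ^ k) ?_ ?_
  · exact (hasSum_inv_one_sub_sq (by rwa [norm_mul, hε, one_mul])).summable.norm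
  · exact (hasSum_inv_one_sub_sq hx).summable.norm

theorem hasSum_twistCoeff {ε x : ℂ} (hε : ‖ε‖ = 1) (hx : ‖x‖ < 1) :
    HasSum (fun n ↦ twistCoeff ε n * x ^ n) (1 / ((1 - x) ^ 2 * (1 - ε * x) ^ 2)) := by
  have hεx : ‖ε * x‖ < 1 := by rwa [norm_mul, hε, one_mul]
  have h := tsum_mul_tsum_eq_tsum_sum_range_of_summable_norm
    (hasSum_inv_one_sub_sq hεx).summable.norm (hasSum_inv_one_sub_sq hx).summable.norm
  simp only [← twistCoeff_mul_pow] at h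
  rw [(hasSum_inv_one_sub_sq hεx).tsum_eq, (hasSum_inv_one_sub_sq hx).tsum_eq,
    one_div_mul_one_div, mul_comm ((1 - ε * x) ^ 2)] at h
  rw [h]
  exact (summable_norm_twistCoeff hε hx).of_norm.hasSum

theorem mul_twistCoeff (ε : ℂ) (n : ℕ) :
    ε * twistCoeff ε n = ∑ k ∈ Finset.range (n + 2), (k : ℂ) * ((n : ℂ) + 2 - k) * ε ^ k := by
  rw [Finset.sum_range_succ', twistCoeff, Finset.mul_sum]
  simp only [Nat.cast_zero, zero_mul, add_zero]
  refine Finset.sum_congr rfl fun k hk ↦ ?_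
  have : k ≤ n := by have := Finset.mem_range.1 hk; omega
  rw [Nat.cast_sub this]
  push_cast; ring

theorem sum_range_multiples (m M : ℕ) (hm : 0 < m) (f : ℕ → ℂ) :
    ∑ k ∈ Finset.range (m * M), (if m ∣ k then f k else 0) = ∑ j ∈ Finset.range M, f (m * j) := by
  induction M with
  | zero => simp
  | succ M ih =>
    rw [Nat.mul_succ, Finset.sum_range_add, ih, Finset.sum_range_succ]
    congr 1
    rw [Finset.sum_eq_single_of_mem 0 (Finset.mem_range.2 hm)]
    · simp
    · intro i hi hi0
      rw [if_neg]
      rw [Nat.dvd_add_right (dvd_mul_right _ _)]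
      exact Nat.not_dvd_of_pos_of_lt (Nat.pos_of_ne_zero hi0) (Finset.mem_range.1 hi)

theorem sum_range_mul_sub (N : ℕ) (c : ℂ) :
    ∑ k ∈ Finset.range N, (k : ℂ) * (c - k) =
      (N : ℂ) * (N - 1) / 2 * c - (N : ℂ) * (N - 1) * (2 * N - 1) / 6 := by
  induction N with
  | zero => simp
  | succ N ih => rw [Finset.sum_range_succ, ih]; push_cast; ring

/-- For a primitive `m`-th root of unity `ε`, the sum of the `n`-th Taylor coefficients of the
kernels twisted by the nontrivial powers of `ε`. Only the `n` with `m ∣ n + 2` occur in the Taylor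
expansion of an invariant quadratic differential. -/
theorem sum_mul_twistCoeff {m : ℕ} (hm : 2 ≤ m) {ε : ℂ} (hε : IsPrimitiveRoot ε m) {n : ℕ}
    (hn : m ∣ n + 2) :
    ∑ l ∈ Finset.Icc 1 (m - 1), ε ^ l * twistCoeff (ε ^ l) n =
      -((n : ℂ) + 2) * ((m : ℂ) ^ 2 - 1) / 6 := by
  obtain ⟨M, hM⟩ := hn
  have hset : Finset.Icc 1 (m - 1) = (Finset.range m).erase 0 := by
    ext x; simp only [Finset.mem_Icc, Finset.mem_erase, Finset.mem_range]; omega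
  have hgeom : ∀ k : ℕ, ∑ l ∈ Finset.range m, (ε ^ l) ^ k = if m ∣ k then (m : ℂ) else 0 := by
    intro k
    have h1 : ∀ l, (ε ^ l) ^ k = (ε ^ k) ^ l := fun l ↦ by rw [← pow_mul, ← pow_mul, mul_comm]
    simp only [h1]
    split_ifs with h
    · rw [(hε.pow_eq_one_iff_dvd k).2 h]; simp
    · have hne : ε ^ k ≠ 1 := fun h' ↦ h ((hε.pow_eq_one_iff_dvd k).1 h')
      rw [geom_sum_eq hne, ← pow_mul, mul_comm, pow_mul, hε.pow_eq_one]; simp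
  have hM' : (n : ℂ) + 2 = m * M := by exact_mod_cast hM
  have hall : ∑ l ∈ Finset.range m, ε ^ l * twistCoeff (ε ^ l) n =
      ∑ k ∈ Finset.range (m * M), if m ∣ k then (m : ℂ) * (k * ((m : ℂ) * M - k)) else 0 := by
    simp only [mul_twistCoeff]
    rw [Finset.sum_comm, hM, hM']
    refine Finset.sum_congr rfl fun k _ ↦ ?_
    rw [← Finset.mul_sum, hgeom]
    split_ifs <;> ring
  have h0 : ε ^ 0 * twistCoeff (ε ^ 0) n =
      ∑ k ∈ Finset.range (m * M), (k : ℂ) * ((m : ℂ) * M - k) := by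
    rw [mul_twistCoeff, hM, hM']
    simp
  -- complete the sum by the term `l = 0`, so that orthogonality of the powers of `ε` applies
  rw [hset, Finset.sum_erase_eq_sub (Finset.mem_range.2 (by omega))]
  rw [hall, h0, sum_range_multiples m M (by omega), sum_range_mul_sub]
  have h3 : ∀ j : ℕ, (m : ℂ) * (((m * j : ℕ) : ℂ) * ((m : ℂ) * M - ((m * j : ℕ) : ℂ))) =
      (m : ℂ) ^ 3 * ((j : ℂ) * (M - j)) := fun j ↦ by push_cast; ring
  simp only [h3]
  rw [← Finset.mul_sum, sum_range_mul_sub, hM']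
  push_cast; ring

/-! ### Weighted integrability on the disc -/

/-- The weight `(1 - |z|²)^(7/2)`. Invariant quadratic differentials that are square integrable on
the quotient are square integrable on the disc with respect to it. -/
noncomputable def discWeight (z : ℂ) : ℝ := (1 - ‖z‖ ^ 2) ^ 3 * √(1 - ‖z‖ ^ 2)

theorem one_sub_norm_sq_pos {z : ℂ} (hz : z ∈ Metric.ball (0 : ℂ) 1) : 0 < 1 - ‖z‖ ^ 2 := by
  have h := mem_ball_zero_iff.1 hz
  nlinarith [norm_nonneg z]

theorem pow_four_le_discWeight {z : ℂ} (hz : z ∈ Metric.ball (0 : ℂ) 1) :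
    (1 - ‖z‖ ^ 2) ^ 4 ≤ discWeight z := by
  have h0 := one_sub_norm_sq_pos hz
  have h1 : 1 - ‖z‖ ^ 2 ≤ √(1 - ‖z‖ ^ 2) := Real.le_sqrt_of_sq_le (by nlinarith [sq_nonneg ‖z‖])
  calc (1 - ‖z‖ ^ 2) ^ 4 = (1 - ‖z‖ ^ 2) ^ 3 * (1 - ‖z‖ ^ 2) := by ring
    _ ≤ _ := mul_le_mul_of_nonneg_left h1 (by positivity)

theorem aestronglyMeasurable_disc {E : Type*} [NormedAddCommGroup E] {f : ℂ → E}
    (hf : ContinuousOn f (Metric.ball 0 1)) :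
    AEStronglyMeasurable f (volume.restrict (Metric.ball (0 : ℂ) 1)) :=
  hf.aestronglyMeasurable measurableSet_ball

theorem integrableOn_greenWeight_mul_norm_sq {Φ : ℂ → ℂ} (hΦ : ContinuousOn Φ (Metric.ball 0 1))
    (hint : IntegrableOn (fun z ↦ discWeight z * ‖Φ z‖ ^ 2) (Metric.ball 0 1)) :
    IntegrableOn (fun z : ℂ ↦ greenWeight ‖z‖ * ‖Φ z‖ ^ 2) (Metric.ball 0 1) := by
  obtain ⟨M, hM⟩ := (isCompact_closedBall (0 : ℂ) (1 / 2)).exists_bound_of_continuousOn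
    (hΦ.mono (Metric.closedBall_subset_ball (by norm_num)))
  have hg : Integrable (fun z : ℂ ↦ |greenWeight ‖z‖| * M ^ 2 + discWeight z * ‖Φ z‖ ^ 2)
      (volume.restrict (Metric.ball 0 1)) :=
    (integrableOn_disc_greenWeight.abs.mul_const _).add hint
  refine Integrable.mono' hg ?_ ?_
  · exact (measurable_greenWeight.comp measurable_norm).aestronglyMeasurable.mul
      ((aestronglyMeasurable_disc hΦ).norm.pow 2)
  · refine (ae_restrict_iff' measurableSet_ball).2 (Filter.Eventually.of_forall fun z hz ↦ ?_)
    rw [Real.norm_eq_abs, abs_mul, abs_of_nonneg (sq_nonneg ‖Φ z‖)]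
    have hd : 0 ≤ discWeight z := le_trans (by positivity) (pow_four_le_discWeight hz)
    rcases le_total ‖z‖ (1 / 2) with h | h
    · have h1 : ‖Φ z‖ ^ 2 ≤ M ^ 2 :=
        pow_le_pow_left₀ (norm_nonneg _) (hM z (mem_closedBall_zero_iff.2 h)) 2
      have h2 := mul_le_mul_of_nonneg_left h1 (abs_nonneg (greenWeight ‖z‖))
      have : 0 ≤ discWeight z * ‖Φ z‖ ^ 2 := by positivity
      linarith
    · have hz1 : ‖z‖ ∈ Set.Ioo (0 : ℝ) 1 := ⟨by linarith, mem_ball_zero_iff.1 hz⟩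
      rw [abs_of_nonneg (greenWeight_nonneg hz1)]
      have h1 := (greenWeight_le hz1 h).trans (pow_four_le_discWeight hz)
      have h2 := mul_le_mul_of_nonneg_right h1 (sq_nonneg ‖Φ z‖)
      have : 0 ≤ greenWeight ‖z‖ * M ^ 2 := mul_nonneg (greenWeight_nonneg hz1) (sq_nonneg _)
      linarith

theorem integrableOn_greenWeight_mul {Φ Ψ : ℂ → ℂ} (hΦ : ContinuousOn Φ (Metric.ball 0 1))
    (hΨ : ContinuousOn Ψ (Metric.ball 0 1))
    (hΦi : IntegrableOn (fun z ↦ discWeight z * ‖Φ z‖ ^ 2) (Metric.ball 0 1))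
    (hΨi : IntegrableOn (fun z ↦ discWeight z * ‖Ψ z‖ ^ 2) (Metric.ball 0 1)) :
    IntegrableOn (fun z : ℂ ↦ (greenWeight ‖z‖ : ℂ) * (conj (Φ z) * Ψ z)) (Metric.ball 0 1) := by
  have h1 := (integrableOn_greenWeight_mul_norm_sq hΦ hΦi).abs.add
    (integrableOn_greenWeight_mul_norm_sq hΨ hΨi).abs
  refine Integrable.mono' h1 ?_ ?_
  · refine (Complex.measurable_ofReal.comp
      (measurable_greenWeight.comp measurable_norm)).aestronglyMeasurable.mul ?_
    exact (Complex.continuous_conj.comp_aestronglyMeasurable (aestronglyMeasurable_disc hΦ)).mul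
      (aestronglyMeasurable_disc hΨ)
  · refine Filter.Eventually.of_forall fun z ↦ ?_
    simp only [norm_mul, RCLike.norm_conj, Complex.norm_real, Real.norm_eq_abs, Pi.add_apply,
      abs_mul, abs_of_nonneg (sq_nonneg ‖Φ z‖), abs_of_nonneg (sq_nonneg ‖Ψ z‖)]
    rw [← mul_add]
    refine mul_le_mul_of_nonneg_left ?_ (abs_nonneg _)
    nlinarith [sq_nonneg (‖Φ z‖ - ‖Ψ z‖), sq_nonneg ‖Φ z‖, sq_nonneg ‖Ψ z‖]

/-- The reciprocal of `π` times the `n`-th moment of the Green weight. -/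
noncomputable def momentDenom (n : ℕ) : ℝ := (n + 1) ^ 2 * (n + 2) * (n + 3) ^ 2

theorem momentDenom_pos (n : ℕ) : 0 < momentDenom n := by unfold momentDenom; positivity

theorem summable_coeff_sq {Φ : ℂ → ℂ} {a : ℕ → ℂ}
    (ha : ∀ z ∈ Metric.ball (0 : ℂ) 1, HasSum (fun n ↦ a n * z ^ n) (Φ z))
    (hΦ : ContinuousOn Φ (Metric.ball 0 1))
    (hint : IntegrableOn (fun z ↦ discWeight z * ‖Φ z‖ ^ 2) (Metric.ball 0 1)) :
    Summable fun n ↦ ‖a n‖ ^ 2 / momentDenom n := by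
  have h := (summable_disc_bessel ha integrableOn_greenWeight_mul_pow
    (fun r hr ↦ greenWeight_nonneg hr)
    (integrableOn_greenWeight_mul_norm_sq hΦ hint)).mul_right Real.pi
  refine h.congr fun n ↦ ?_
  rw [integral_greenWeight_moment, momentDenom]
  have := Real.pi_pos
  field_simp

theorem summable_coeff_mul {Φ Ψ : ℂ → ℂ} {a b : ℕ → ℂ}
    (ha : ∀ z ∈ Metric.ball (0 : ℂ) 1, HasSum (fun n ↦ a n * z ^ n) (Φ z))
    (hb : ∀ z ∈ Metric.ball (0 : ℂ) 1, HasSum (fun n ↦ b n * z ^ n) (Ψ z))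
    (hΦ : ContinuousOn Φ (Metric.ball 0 1)) (hΨ : ContinuousOn Ψ (Metric.ball 0 1))
    (hΦi : IntegrableOn (fun z ↦ discWeight z * ‖Φ z‖ ^ 2) (Metric.ball 0 1))
    (hΨi : IntegrableOn (fun z ↦ discWeight z * ‖Ψ z‖ ^ 2) (Metric.ball 0 1)) :
    Summable fun n ↦ ‖a n‖ * ‖b n‖ / momentDenom n := by
  refine Summable.of_nonneg_of_le (fun n ↦ ?_) (fun n ↦ ?_)
    ((summable_coeff_sq ha hΦ hΦi).add (summable_coeff_sq hb hΨ hΨi))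
  · have := momentDenom_pos n; positivity
  · rw [← add_div]
    refine div_le_div_of_nonneg_right ?_ (momentDenom_pos n).le
    nlinarith [sq_nonneg (‖a n‖ - ‖b n‖), sq_nonneg ‖a n‖, sq_nonneg ‖b n‖]

theorem hasSum_integral_greenWeight {Φ Ψ : ℂ → ℂ} {a b : ℕ → ℂ}
    (ha : ∀ z ∈ Metric.ball (0 : ℂ) 1, HasSum (fun n ↦ a n * z ^ n) (Φ z))
    (hb : ∀ z ∈ Metric.ball (0 : ℂ) 1, HasSum (fun n ↦ b n * z ^ n) (Ψ z))
    (hΦ : ContinuousOn Φ (Metric.ball 0 1)) (hΨ : ContinuousOn Ψ (Metric.ball 0 1))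
    (hΦi : IntegrableOn (fun z ↦ discWeight z * ‖Φ z‖ ^ 2) (Metric.ball 0 1))
    (hΨi : IntegrableOn (fun z ↦ discWeight z * ‖Ψ z‖ ^ 2) (Metric.ball 0 1)) :
    HasSum (fun n ↦ 2 * (conj (a n) * b n / momentDenom n))
      (∫ z in Metric.ball (0 : ℂ) 1, (greenWeight ‖z‖ : ℂ) * (conj (Φ z) * Ψ z)) := by
  have h := hasSum_disc_parseval ha hb integrableOn_greenWeight_mul_pow
    (integrableOn_greenWeight_mul hΦ hΨ hΦi hΨi) (by
      refine ((summable_coeff_mul ha hb hΦ hΨ hΦi hΨi).mul_right Real.pi⁻¹).congr fun n ↦ ?_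
      have : ∫ r in Set.Ioo (0 : ℝ) 1, |greenWeight r| * r ^ (2 * n + 1) =
          ∫ r in Set.Ioo (0 : ℝ) 1, greenWeight r * r ^ (2 * n + 1) :=
        setIntegral_congr_fun measurableSet_Ioo fun r hr ↦ by
          rw [abs_of_nonneg (greenWeight_nonneg hr)]
      rw [this, integral_greenWeight_moment, momentDenom]
      have := Real.pi_pos
      field_simp)
  convert h using 2 with n
  rw [integral_greenWeight_moment, momentDenom]
  have := Real.pi_pos.ne'
  push_cast
  field_simp

/-! ### The twisted reproducing kernel -/

theorem continuousOn_weighted_sq {Ψ : ℂ → ℂ} (hΨ : ContinuousOn Ψ (Metric.ball 0 1)) :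
    ContinuousOn (fun z : ℂ ↦ (((1 - ‖z‖ ^ 2) ^ 2 : ℝ) : ℂ) * Ψ z) (Metric.ball 0 1) := by
  refine ContinuousOn.mul (Continuous.continuousOn ?_) hΨ
  exact Complex.continuous_ofReal.comp (by fun_prop)

theorem integrableOn_sq_weight {Ψ : ℂ → ℂ} (hΨ : ContinuousOn Ψ (Metric.ball 0 1))
    (hΨi : IntegrableOn (fun z ↦ discWeight z * ‖Ψ z‖ ^ 2) (Metric.ball 0 1)) :
    IntegrableOn (fun z : ℂ ↦ (((1 - ‖z‖ ^ 2) ^ 2 : ℝ) : ℂ) * Ψ z) (Metric.ball 0 1) := by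
  have h1 : IntegrableOn (fun _ : ℂ ↦ (1 : ℝ)) (Metric.ball 0 1) :=
    integrableOn_const (measure_ball_lt_top.ne)
  refine Integrable.mono' (h1.add hΨi) (aestronglyMeasurable_disc (continuousOn_weighted_sq hΨ)) ?_
  refine (ae_restrict_iff' measurableSet_ball).2 (Filter.Eventually.of_forall fun z hz ↦ ?_)
  have h0 := one_sub_norm_sq_pos hz
  have h2 := pow_four_le_discWeight hz
  rw [norm_mul, Complex.norm_real, Real.norm_eq_abs, abs_of_nonneg (sq_nonneg _)]
  have h3 := mul_le_mul_of_nonneg_right h2 (sq_nonneg ‖Ψ z‖)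
  simp only [Pi.add_apply]
  nlinarith [sq_nonneg ((1 - ‖z‖ ^ 2) ^ 2 * ‖Ψ z‖ - 1)]

theorem one_sub_ne_zero_of_norm_lt {x : ℂ} (hx : ‖x‖ < 1) : 1 - x ≠ 0 := by
  intro h
  rw [sub_eq_zero] at h
  rw [← h, norm_one] at hx
  exact lt_irrefl _ hx

theorem norm_mul_conj_lt {z w : ℂ} (hz : z ∈ Metric.ball (0 : ℂ) 1)
    (hw : w ∈ Metric.ball (0 : ℂ) 1) : ‖z * conj w‖ < 1 := by
  rw [norm_mul, RCLike.norm_conj]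
  have h1 := mem_ball_zero_iff.1 hz
  have h2 := mem_ball_zero_iff.1 hw
  nlinarith [norm_nonneg z, norm_nonneg w]

theorem norm_twist_mul_conj_lt {ε : ℂ} (hε : ‖ε‖ = 1) {z w : ℂ} (hz : z ∈ Metric.ball (0 : ℂ) 1)
    (hw : w ∈ Metric.ball (0 : ℂ) 1) : ‖ε * z * conj w‖ < 1 := by
  rw [mul_assoc, norm_mul, hε, one_mul]; exact norm_mul_conj_lt hz hw

theorem one_sub_norm_le_norm_one_sub {z c w : ℂ} (hc : ‖c‖ = ‖z‖)
    (hw : w ∈ Metric.ball (0 : ℂ) 1) : 1 - ‖z‖ ≤ ‖1 - c * conj w‖ := by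
  have h1 : ‖c * conj w‖ ≤ ‖z‖ := by
    rw [norm_mul, RCLike.norm_conj, hc]
    exact mul_le_of_le_one_right (norm_nonneg _) (mem_ball_zero_iff.1 hw).le
  have h2 := norm_sub_norm_le (1 : ℂ) (c * conj w)
  rw [norm_one] at h2; linarith

/-- The factor `1 / ((1 - z w̄)² (1 - ε z w̄)²)`. -/
noncomputable def twistFactor (ε z w : ℂ) : ℂ :=
  1 / ((1 - z * conj w) ^ 2 * (1 - ε * z * conj w) ^ 2)

theorem measurable_twistFactor (ε : ℂ) :
    Measurable fun q : ℂ × ℂ ↦ twistFactor ε q.1 q.2 := by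
  have hc : Measurable fun q : ℂ × ℂ ↦ conj q.2 :=
    Complex.continuous_conj.measurable.comp measurable_snd
  unfold twistFactor
  fun_prop

/-- The value of `∫_D (1 - |w|²)² |w|^(2 n) d²w`. -/
noncomputable def bergmanMoment (n : ℕ) : ℝ := 2 * Real.pi / ((n + 1) * (n + 2) * (n + 3))

theorem bergmanMoment_pos (n : ℕ) : 0 < bergmanMoment n := by
  have := Real.pi_pos
  unfold bergmanMoment; positivity

theorem bergmanMoment_sq (n : ℕ) :
    bergmanMoment n ^ 2 * (n + 2) = 4 * Real.pi ^ 2 / momentDenom n := by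
  unfold bergmanMoment momentDenom
  field_simp; ring

theorem integral_sq_weight_moment_eq (n : ℕ) :
    2 * Real.pi * ∫ r in Set.Ioo (0 : ℝ) 1, (1 - r ^ 2) ^ 2 * r ^ (2 * n + 1) =
      bergmanMoment n := by
  rw [integral_sq_weight_moment, bergmanMoment]; ring

/-- The Taylor coefficients have polynomial growth; the cubic denominator of `bergmanMoment` absorbs
it. -/
theorem exists_bound_coeff {Ψ : ℂ → ℂ} {b : ℕ → ℂ}
    (hb : ∀ z ∈ Metric.ball (0 : ℂ) 1, HasSum (fun n ↦ b n * z ^ n) (Ψ z))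
    (hΨ : ContinuousOn Ψ (Metric.ball 0 1))
    (hΨi : IntegrableOn (fun z ↦ discWeight z * ‖Ψ z‖ ^ 2) (Metric.ball 0 1)) :
    ∃ C, ∀ n, ‖b n‖ * bergmanMoment n ≤ C := by
  have hs := summable_coeff_sq hb hΨ hΨi
  refine ⟨1 + 4 * Real.pi ^ 2 * ∑' n, ‖b n‖ ^ 2 / momentDenom n, fun n ↦ ?_⟩
  have h1 := hs.le_tsum n fun k _ ↦ by have := momentDenom_pos k; positivity
  have h2 : (‖b n‖ * bergmanMoment n) ^ 2 ≤ 4 * Real.pi ^ 2 * (‖b n‖ ^ 2 / momentDenom n) := by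
    have := bergmanMoment_sq n
    have h3 : bergmanMoment n ^ 2 ≤ 4 * Real.pi ^ 2 / momentDenom n := by
      rw [← this]; nlinarith [sq_nonneg (bergmanMoment n), n.cast_nonneg (α := ℝ)]
    calc (‖b n‖ * bergmanMoment n) ^ 2 = ‖b n‖ ^ 2 * bergmanMoment n ^ 2 := by ring
      _ ≤ ‖b n‖ ^ 2 * (4 * Real.pi ^ 2 / momentDenom n) :=
        mul_le_mul_of_nonneg_left h3 (sq_nonneg _)
      _ = _ := by ring
  have h4 := mul_le_mul_of_nonneg_left h1 (show 0 ≤ 4 * Real.pi ^ 2 by positivity)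
  nlinarith [sq_nonneg (‖b n‖ * bergmanMoment n - 1)]

/-- Expansion of the twisted Bergman projection of `Ψ`. -/
theorem hasSum_twisted_projection {ε : ℂ} (hε : ‖ε‖ = 1) {Ψ : ℂ → ℂ} {b : ℕ → ℂ}
    (hb : ∀ z ∈ Metric.ball (0 : ℂ) 1, HasSum (fun n ↦ b n * z ^ n) (Ψ z))
    (hΨ : ContinuousOn Ψ (Metric.ball 0 1))
    (hΨi : IntegrableOn (fun z ↦ discWeight z * ‖Ψ z‖ ^ 2) (Metric.ball 0 1))
    {z : ℂ} (hz : z ∈ Metric.ball (0 : ℂ) 1) :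
    HasSum (fun n ↦ twistCoeff ε n * b n * bergmanMoment n * z ^ n)
      (∫ w in Metric.ball (0 : ℂ) 1, (((1 - ‖w‖ ^ 2) ^ 2 : ℝ) : ℂ) *
        (twistFactor ε z w * Ψ w)) := by
  have hz1 := mem_ball_zero_iff.1 hz
  have hk : ∀ w ∈ Metric.ball (0 : ℂ) 1,
      HasSum (fun n ↦ conj (twistCoeff ε n * z ^ n) * w ^ n) (conj (twistFactor ε z w)) := by
    intro w hw
    have h := hasSum_twistCoeff hε (norm_mul_conj_lt hz hw)
    rw [← mul_assoc] at h
    change HasSum _ (twistFactor ε z w) at h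
    have h2 := (Complex.hasSum_conj' (f := fun n ↦ twistCoeff ε n * (z * conj w) ^ n)).2 h
    convert h2 using 2 with n
    simp only [map_mul, map_pow, mul_pow, Complex.conj_conj]; ring
  -- for fixed `z` in the open disc the factor is bounded in `w`
  have hint : IntegrableOn (fun w : ℂ ↦ (((1 - ‖w‖ ^ 2) ^ 2 : ℝ) : ℂ) *
      (conj (conj (twistFactor ε z w)) * Ψ w)) (Metric.ball 0 1) := by
    simp only [Complex.conj_conj]
    have h1 := (integrableOn_sq_weight hΨ hΨi).bdd_mul (f := fun w ↦ twistFactor ε z w)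
      (c := 1 / ((1 - ‖z‖) ^ 2 * (1 - ‖z‖) ^ 2)) ?_ ?_
    · refine h1.congr (Filter.Eventually.of_forall fun w ↦ ?_)
      simp only; ring
    · exact ((measurable_twistFactor ε).comp measurable_prodMk_left).aestronglyMeasurable
    · refine (ae_restrict_iff' measurableSet_ball).2 (Filter.Eventually.of_forall fun w hw ↦ ?_)
      have h0 : 0 < 1 - ‖z‖ := by linarith
      have h2 := one_sub_norm_le_norm_one_sub (z := z) rfl hw
      have h3 := one_sub_norm_le_norm_one_sub (z := z) (c := ε * z) (by rw [norm_mul, hε, one_mul]) hw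
      rw [twistFactor, norm_div, norm_one, norm_mul, norm_pow, norm_pow]
      gcongr
  obtain ⟨C, hC⟩ := exists_bound_coeff hb hΨ hΨi
  have h := hasSum_disc_parseval (W := fun r ↦ (1 - r ^ 2) ^ 2) hk hb
    (fun n ↦ integrableOn_Ioo_of_continuous (by fun_prop)) hint (by
      refine Summable.of_nonneg_of_le (fun n ↦ ?_) (fun n ↦ ?_)
        ((summable_norm_twistCoeff hε hz1).mul_right C)
      · refine mul_nonneg (by positivity) (setIntegral_nonneg measurableSet_Ioo fun r hr ↦ ?_)
        exact mul_nonneg (abs_nonneg _) (pow_nonneg hr.1.le _)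
      · simp only [abs_sq, RCLike.norm_conj]
        rw [mul_assoc]
        refine mul_le_mul_of_nonneg_left (le_trans ?_ (hC n)) (norm_nonneg _)
        refine mul_le_mul_of_nonneg_left ?_ (norm_nonneg _)
        rw [← integral_sq_weight_moment_eq]
        refine le_mul_of_one_le_left (setIntegral_nonneg measurableSet_Ioo fun r hr ↦ ?_)
          (show (1 : ℝ) ≤ 2 * Real.pi by linarith [Real.pi_gt_three])
        exact mul_nonneg (sq_nonneg _) (pow_nonneg hr.1.le _))
  simp only [Complex.conj_conj] at h
  convert h using 2 with n
  rw [← integral_sq_weight_moment_eq]; push_cast; ring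

/-! ### Absolute convergence of the double integral on the disc -/

theorem HasSum.congr_terms {f g : ℕ → ℂ} {s : ℂ} (h : HasSum f s) (hfg : ∀ n, f n = g n) :
    HasSum g s :=
  (funext hfg : f = g) ▸ h

theorem tsum_pow_div_le {t : ℝ} (h0 : 0 ≤ t) (h1 : t < 1) :
    Summable (fun n : ℕ ↦ t ^ n / ((n : ℝ) + 1)) ∧
      ∑' n : ℕ, t ^ n / ((n : ℝ) + 1) ≤ 3 / √(1 - t) := by
  have hs := Real.hasSum_pow_div_log_of_abs_lt_one (x := t) (by rwa [abs_of_nonneg h0])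
  have hsum : Summable (fun n : ℕ ↦ t ^ n / ((n : ℝ) + 1)) := by
    refine Summable.of_nonneg_of_le (fun n ↦ by positivity) (fun n ↦ ?_)
      (summable_geometric_of_lt_one h0 h1)
    exact div_le_self (by positivity) (by linarith [n.cast_nonneg (α := ℝ)])
  refine ⟨hsum, ?_⟩
  rw [hsum.tsum_eq_zero_add]
  have h2 : ∑' n : ℕ, t ^ (n + 1) / (((n + 1 : ℕ) : ℝ) + 1) ≤ -Real.log (1 - t) := by
    rw [← hs.tsum_eq]
    refine Summable.tsum_le_tsum (fun n ↦ ?_) ((summable_nat_add_iff 1).2 hsum) hs.summable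
    push_cast
    exact div_le_div_of_nonneg_left (by positivity) (by positivity) (by linarith)
  have hpos : 0 < 1 - t := by linarith
  have hsq : 0 < √(1 - t) := Real.sqrt_pos.2 hpos
  have h3 : -Real.log (1 - t) ≤ 2 * (1 / √(1 - t)) := by
    have := Real.log_le_sub_one_of_pos (x := 1 / √(1 - t)) (by positivity)
    rw [one_div, Real.log_inv, Real.log_sqrt hpos.le] at this
    rw [one_div]; linarith
  have h4 : (1 : ℝ) ≤ 1 / √(1 - t) := by
    rw [le_div_iff₀ hsq, one_mul]
    exact Real.sqrt_le_one.2 (by linarith)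
  have h5 : 3 / √(1 - t) = 3 * (1 / √(1 - t)) := by ring
  rw [h5]
  simp only [pow_zero, Nat.cast_zero, zero_add, div_one]
  linarith

theorem measurable_inv_norm_one_sub_sq (z : ℂ) :
    Measurable fun w : ℂ ↦ 1 / ‖1 - z * conj w‖ ^ 2 := by
  have := Complex.continuous_conj.measurable
  fun_prop

theorem integrableOn_inv_norm_one_sub_sq {z : ℂ} (hz : z ∈ Metric.ball (0 : ℂ) 1) :
    IntegrableOn (fun w : ℂ ↦ 1 / ‖1 - z * conj w‖ ^ 2) (Metric.ball 0 1) := by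
  have h0 : 0 < 1 - ‖z‖ := by linarith [mem_ball_zero_iff.1 hz]
  refine Measure.integrableOn_of_bounded (M := 1 / (1 - ‖z‖) ^ 2) measure_ball_lt_top.ne
    (measurable_inv_norm_one_sub_sq z).aestronglyMeasurable ?_
  refine (ae_restrict_iff' measurableSet_ball).2 (Filter.Eventually.of_forall fun w hw ↦ ?_)
  have := one_sub_norm_le_norm_one_sub (z := z) rfl hw
  rw [Real.norm_eq_abs, abs_of_nonneg (by positivity)]
  gcongr

/-- The logarithmically divergent integral of `|1 - z w̄|⁻²` over `w`, bounded by a power. -/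
theorem integral_inv_norm_one_sub_sq_le {z : ℂ} (hz : z ∈ Metric.ball (0 : ℂ) 1) :
    ∫ w in Metric.ball (0 : ℂ) 1, 1 / ‖1 - z * conj w‖ ^ 2 ≤
      3 * Real.pi / √(1 - ‖z‖ ^ 2) := by
  have hk : ∀ w ∈ Metric.ball (0 : ℂ) 1,
      HasSum (fun n ↦ conj z ^ n * w ^ n) (1 / (1 - conj z * w)) := by
    intro w hw
    have h1 : ‖conj z * w‖ < 1 := by
      have := norm_mul_conj_lt hw hz
      rwa [mul_comm] at this
    have := hasSum_geometric_of_norm_lt_one h1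
    simpa only [mul_pow, one_div] using this
  have heq : ∀ w : ℂ, (1 / ‖1 - z * conj w‖ ^ 2 : ℝ) =
      ((1 : ℝ) : ℂ) * (conj (1 / (1 - conj z * w)) * (1 / (1 - conj z * w))) := by
    intro w
    rw [Complex.conj_mul', norm_div, norm_one]
    have : ‖1 - conj z * w‖ = ‖1 - z * conj w‖ := by
      rw [← RCLike.norm_conj]; simp
    rw [this]; push_cast; simp
  have ht1 : ‖z‖ ^ 2 < 1 := by linarith [one_sub_norm_sq_pos hz]
  obtain ⟨hs, hle⟩ := tsum_pow_div_le (sq_nonneg ‖z‖) ht1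
  have hmom : ∀ n : ℕ, ∫ r in Set.Ioo (0 : ℝ) 1, (1 : ℝ) * r ^ (2 * n + 1) =
      1 / (2 * ((n : ℝ) + 1)) := by
    intro n
    simp only [one_mul]
    rw [integral_Ioo_eq_interval, integral_pow]
    simp only [one_pow, ne_eq, Nat.add_eq_zero_iff, one_ne_zero, and_false, not_false_eq_true,
      zero_pow, sub_zero]
    push_cast
    congr 1; ring
  have h := hasSum_disc_parseval (W := fun _ ↦ 1) hk hk
    (fun n ↦ integrableOn_Ioo_of_continuous (by fun_prop)) (by
      simp only [← heq]
      exact (integrableOn_inv_norm_one_sub_sq hz).ofReal) (by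
      refine (hs.mul_right (1 / 2)).congr fun n ↦ ?_
      simp only [abs_one, hmom, norm_pow, RCLike.norm_conj, ← pow_mul]
      rw [← pow_add, ← two_mul]; field_simp)
  simp only [← heq, integral_complex_ofReal] at h
  have h2 : HasSum (fun n : ℕ ↦ Real.pi * ((‖z‖ ^ 2) ^ n / ((n : ℝ) + 1)))
      (∫ w in Metric.ball (0 : ℂ) 1, 1 / ‖1 - z * conj w‖ ^ 2) := by
    rw [← Complex.hasSum_ofReal]
    convert h using 2 with n
    rw [hmom, Complex.conj_mul', norm_pow, RCLike.norm_conj]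
    push_cast
    have : (n : ℂ) + 1 ≠ 0 := by exact_mod_cast n.succ_ne_zero
    field_simp; ring
  rw [← h2.tsum_eq, tsum_mul_left]
  calc _ ≤ Real.pi * (3 / √(1 - ‖z‖ ^ 2)) := mul_le_mul_of_nonneg_left hle Real.pi_pos.le
    _ = _ := by ring

theorem norm_twistFactor (ε z w : ℂ) :
    ‖twistFactor ε z w‖ = 1 / (‖1 - z * conj w‖ ^ 2 * ‖1 - ε * z * conj w‖ ^ 2) := by
  rw [twistFactor, norm_div, norm_one, norm_mul, norm_pow, norm_pow]

/-- As `ε ≠ 1`, the two factors of the denominator cannot be small at the same time. -/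
theorem norm_twistFactor_le {ε : ℂ} (hε : ‖ε‖ = 1) (hε1 : ε ≠ 1) {z w : ℂ}
    (hz : z ∈ Metric.ball (0 : ℂ) 1) (hw : w ∈ Metric.ball (0 : ℂ) 1) :
    ‖twistFactor ε z w‖ ≤ 4 / ‖ε - 1‖ ^ 2 *
      (1 / ‖1 - z * conj w‖ ^ 2 + 1 / ‖1 - ε * z * conj w‖ ^ 2) := by
  have hA : 0 < ‖1 - z * conj w‖ :=
    norm_pos_iff.2 (one_sub_ne_zero_of_norm_lt (norm_mul_conj_lt hz hw))
  have hB : 0 < ‖1 - ε * z * conj w‖ :=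
    norm_pos_iff.2 (one_sub_ne_zero_of_norm_lt (norm_twist_mul_conj_lt hε hz hw))
  have hd : 0 < ‖ε - 1‖ := norm_pos_iff.2 (sub_ne_zero.2 hε1)
  have hsum : ‖ε - 1‖ ≤ ‖1 - z * conj w‖ + ‖1 - ε * z * conj w‖ := by
    have : ε - 1 = ε * (1 - z * conj w) - (1 - ε * z * conj w) := by ring
    rw [this]
    refine (norm_sub_le _ _).trans ?_
    rw [norm_mul, hε, one_mul]
  rw [norm_twistFactor]
  set A := ‖1 - z * conj w‖
  set B := ‖1 - ε * z * conj w‖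
  set d := ‖ε - 1‖
  have hAB : d ^ 2 ≤ 4 * (A ^ 2 + B ^ 2) := by nlinarith [sq_nonneg (A - B)]
  have : 4 / d ^ 2 * (1 / A ^ 2 + 1 / B ^ 2) = (4 * (A ^ 2 + B ^ 2) / d ^ 2) * (1 / (A ^ 2 * B ^ 2)) := by
    field_simp; ring
  rw [this]
  refine le_mul_of_one_le_left (by positivity) ?_
  rwa [one_le_div (by positivity)]

theorem integrableOn_norm_twistFactor {ε : ℂ} (hε : ‖ε‖ = 1) (hε1 : ε ≠ 1) {z : ℂ}
    (hz : z ∈ Metric.ball (0 : ℂ) 1) :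
    IntegrableOn (fun w ↦ ‖twistFactor ε z w‖) (Metric.ball 0 1) ∧
    ∫ w in Metric.ball (0 : ℂ) 1, ‖twistFactor ε z w‖ ≤
      24 * Real.pi / ‖ε - 1‖ ^ 2 / √(1 - ‖z‖ ^ 2) := by
  have hεz : ε * z ∈ Metric.ball (0 : ℂ) 1 := by
    rw [mem_ball_zero_iff, norm_mul, hε, one_mul]; exact mem_ball_zero_iff.1 hz
  have h1 := integrableOn_inv_norm_one_sub_sq hz
  have h2 := integrableOn_inv_norm_one_sub_sq hεz
  have hb : Integrable (fun w ↦ 4 / ‖ε - 1‖ ^ 2 *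
      (1 / ‖1 - z * conj w‖ ^ 2 + 1 / ‖1 - ε * z * conj w‖ ^ 2))
      (volume.restrict (Metric.ball 0 1)) := (h1.add h2).const_mul _
  have hi : IntegrableOn (fun w ↦ ‖twistFactor ε z w‖) (Metric.ball 0 1) := by
    refine Integrable.mono' hb
      ((measurable_twistFactor ε).comp measurable_prodMk_left).norm.aestronglyMeasurable ?_
    refine (ae_restrict_iff' measurableSet_ball).2 (Filter.Eventually.of_forall fun w hw ↦ ?_)
    rw [norm_norm]; exact norm_twistFactor_le hε hε1 hz hw
  refine ⟨hi, ?_⟩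
  refine (setIntegral_mono_on hi hb measurableSet_ball
    fun w hw ↦ norm_twistFactor_le hε hε1 hz hw).trans ?_
  rw [integral_const_mul, integral_add h1 h2]
  have h3 := integral_inv_norm_one_sub_sq_le hz
  have h4 := integral_inv_norm_one_sub_sq_le hεz
  rw [norm_mul, hε, one_mul] at h4
  calc _ ≤ 4 / ‖ε - 1‖ ^ 2 * (3 * Real.pi / √(1 - ‖z‖ ^ 2) + 3 * Real.pi / √(1 - ‖z‖ ^ 2)) :=
        mul_le_mul_of_nonneg_left (add_le_add h3 h4) (by positivity)
    _ = _ := by ring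

/-- Lebesgue measure on the unit disc. -/
noncomputable abbrev discVolume : Measure ℂ := volume.restrict (Metric.ball (0 : ℂ) 1)

theorem ae_disc_prod {p : ℂ × ℂ → Prop}
    (h : ∀ z ∈ Metric.ball (0 : ℂ) 1, ∀ w ∈ Metric.ball (0 : ℂ) 1, p (z, w)) :
    ∀ᵐ q ∂(discVolume.prod discVolume), p q := by
  rw [discVolume, Measure.prod_restrict]
  exact (ae_restrict_iff' (measurableSet_ball.prod measurableSet_ball)).2
    (Filter.Eventually.of_forall fun q hq ↦ h q.1 hq.1 q.2 hq.2)

/-- The integral over `w` costs a factor `(1 - |z|²)^(-1/2)`, which turns the weight `(1 - |z|²)⁴`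
into `discWeight`. -/
theorem integrable_sq_mul_twistFactor {ε : ℂ} (hε : ‖ε‖ = 1) (hε1 : ε ≠ 1) {Φ : ℂ → ℂ}
    (hΦ : ContinuousOn Φ (Metric.ball 0 1))
    (hΦi : IntegrableOn (fun z ↦ discWeight z * ‖Φ z‖ ^ 2) (Metric.ball 0 1)) :
    Integrable (fun q : ℂ × ℂ ↦ (1 - ‖q.1‖ ^ 2) ^ 4 * ‖Φ q.1‖ ^ 2 * ‖twistFactor ε q.1 q.2‖)
      (discVolume.prod discVolume) := by
  have hmeas : AEStronglyMeasurable
      (fun q : ℂ × ℂ ↦ (1 - ‖q.1‖ ^ 2) ^ 4 * ‖Φ q.1‖ ^ 2 * ‖twistFactor ε q.1 q.2‖)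
      (discVolume.prod discVolume) := by
    refine AEStronglyMeasurable.mul ?_ (measurable_twistFactor ε).norm.aestronglyMeasurable
    have h1 : AEStronglyMeasurable (fun z : ℂ ↦ (1 - ‖z‖ ^ 2) ^ 4 * ‖Φ z‖ ^ 2) discVolume :=
      (Continuous.aestronglyMeasurable (by fun_prop)).mul ((aestronglyMeasurable_disc hΦ).norm.pow 2)
    exact h1.comp_fst
  rw [integrable_prod_iff hmeas]
  constructor
  · refine (ae_restrict_iff' measurableSet_ball).2 (Filter.Eventually.of_forall fun z hz ↦ ?_)
    exact Integrable.const_mul (integrableOn_norm_twistFactor hε hε1 hz).1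
      ((1 - ‖z‖ ^ 2) ^ 4 * ‖Φ z‖ ^ 2)
  · refine Integrable.mono' (hΦi.const_mul (24 * Real.pi / ‖ε - 1‖ ^ 2))
      hmeas.norm.integral_prod_right' ?_
    refine (ae_restrict_iff' measurableSet_ball).2 (Filter.Eventually.of_forall fun z hz ↦ ?_)
    have h0 := one_sub_norm_sq_pos hz
    have hn : ∀ w, ‖(1 - ‖z‖ ^ 2) ^ 4 * ‖Φ z‖ ^ 2 * ‖twistFactor ε z w‖‖ =
        (1 - ‖z‖ ^ 2) ^ 4 * ‖Φ z‖ ^ 2 * ‖twistFactor ε z w‖ := fun w ↦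
      Real.norm_of_nonneg (by positivity)
    simp only [hn]
    rw [integral_const_mul, Real.norm_of_nonneg (mul_nonneg (by positivity)
      (integral_nonneg fun _ ↦ norm_nonneg _))]
    refine (mul_le_mul_of_nonneg_left (integrableOn_norm_twistFactor hε hε1 hz).2
      (by positivity)).trans (le_of_eq ?_)
    have hs : 0 < √(1 - ‖z‖ ^ 2) := Real.sqrt_pos.2 h0
    have h5 : (1 - ‖z‖ ^ 2) ^ 4 = discWeight z * √(1 - ‖z‖ ^ 2) := by
      rw [discWeight, mul_assoc, Real.mul_self_sqrt h0.le]; ring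
    rw [h5]; field_simp

/-- The integrand of the double integral in the disc coordinate. -/
noncomputable def discIntegrand (Φ Ψ : ℂ → ℂ) (ε z w : ℂ) : ℂ :=
  (((1 - ‖z‖ ^ 2) ^ 2 : ℝ) : ℂ) * (((1 - ‖w‖ ^ 2) ^ 2 : ℝ) : ℂ) / 16 *
    (conj (Φ z) * Ψ w * ε * twistFactor ε z w)

/-- Absolute convergence of the double integral: bound the product of the two differentials by the
sum of their squares, and use the symmetry of the kernel in `z` and `w`. -/
theorem integrable_discIntegrand {ε : ℂ} (hε : ‖ε‖ = 1) (hε1 : ε ≠ 1) {Φ Ψ : ℂ → ℂ}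
    (hΦ : ContinuousOn Φ (Metric.ball 0 1)) (hΨ : ContinuousOn Ψ (Metric.ball 0 1))
    (hΦi : IntegrableOn (fun z ↦ discWeight z * ‖Φ z‖ ^ 2) (Metric.ball 0 1))
    (hΨi : IntegrableOn (fun z ↦ discWeight z * ‖Ψ z‖ ^ 2) (Metric.ball 0 1)) :
    Integrable (fun q : ℂ × ℂ ↦ discIntegrand Φ Ψ ε q.1 q.2) (discVolume.prod discVolume) := by
  have hε' : ‖conj ε‖ = 1 := by rwa [RCLike.norm_conj]
  have hε1' : conj ε ≠ 1 := fun h ↦ hε1 (by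
    have := congrArg conj h; rwa [Complex.conj_conj, map_one] at this)
  have h1 := integrable_sq_mul_twistFactor hε hε1 hΦ hΦi
  have h2 := (integrable_sq_mul_twistFactor hε' hε1' hΨ hΨi).swap
  refine Integrable.mono' (h1.add h2) ?_ ?_
  · have e1 : AEStronglyMeasurable (fun q : ℂ × ℂ ↦ Φ q.1) (discVolume.prod discVolume) :=
      (aestronglyMeasurable_disc hΦ).comp_fst
    have e2 : AEStronglyMeasurable (fun q : ℂ × ℂ ↦ Ψ q.2) (discVolume.prod discVolume) :=
      (aestronglyMeasurable_disc hΨ).comp_snd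
    refine AEStronglyMeasurable.mul ?_ ((((Complex.continuous_conj.comp_aestronglyMeasurable
      e1).mul e2).mul_const ε).mul (measurable_twistFactor ε).aestronglyMeasurable)
    refine Continuous.aestronglyMeasurable ?_
    have := Complex.continuous_ofReal
    fun_prop
  · refine ae_disc_prod fun z hz w hw ↦ ?_
    have hsym : ‖twistFactor (conj ε) w z‖ = ‖twistFactor ε z w‖ := by
      rw [norm_twistFactor, norm_twistFactor]
      have e1 : ‖1 - w * conj z‖ = ‖1 - z * conj w‖ := by
        rw [← RCLike.norm_conj]; simp [mul_comm]
      have e2 : ‖1 - conj ε * w * conj z‖ = ‖1 - ε * z * conj w‖ := by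
        rw [← RCLike.norm_conj]; simp only [map_sub, map_one, map_mul, Complex.conj_conj]; ring_nf
      rw [e1, e2]
    have hz0 := one_sub_norm_sq_pos hz
    have hw0 := one_sub_norm_sq_pos hw
    simp only [discIntegrand, Pi.add_apply, Function.comp_apply, Prod.swap_prod_mk, hsym]
    rw [← add_mul]
    simp only [norm_mul, norm_div, Complex.norm_real, RCLike.norm_conj, hε, Real.norm_eq_abs,
      abs_sq, mul_one, Complex.norm_ofNat]
    rw [← mul_assoc]
    refine mul_le_mul_of_nonneg_right ?_ (norm_nonneg _)
    nlinarith [sq_nonneg ((1 - ‖z‖ ^ 2) ^ 2 * ‖Φ z‖ - (1 - ‖w‖ ^ 2) ^ 2 * ‖Ψ w‖),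
      sq_nonneg ((1 - ‖z‖ ^ 2) ^ 2 * ‖Φ z‖), sq_nonneg ((1 - ‖w‖ ^ 2) ^ 2 * ‖Ψ w‖)]

/-! ### The integral identity on the disc -/

/-- A function on the disc that transforms like a quadratic differential under the rotation by `ε`
has Taylor coefficients supported on the `n` with `ε ^ (n + 2) = 1`. -/
theorem coeff_eq_zero_of_invariant {ε : ℂ} (hε : ‖ε‖ = 1) {Ψ : ℂ → ℂ} {b : ℕ → ℂ}
    (hb : ∀ z ∈ Metric.ball (0 : ℂ) 1, HasSum (fun n ↦ b n * z ^ n) (Ψ z))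
    (hinv : ∀ z ∈ Metric.ball (0 : ℂ) 1, Ψ (ε * z) * ε ^ 2 = Ψ z) {n : ℕ}
    (hn : ε ^ (n + 2) ≠ 1) : b n = 0 := by
  have hb2 : ∀ z ∈ Metric.ball (0 : ℂ) 1,
      HasSum (fun k ↦ (b k * (1 - ε ^ (k + 2))) * z ^ k) 0 := by
    intro z hz
    have hεz : ε * z ∈ Metric.ball (0 : ℂ) 1 := by
      rw [mem_ball_zero_iff, norm_mul, hε, one_mul]; exact mem_ball_zero_iff.1 hz
    have h := (hb z hz).sub ((hb _ hεz).mul_right (ε ^ 2))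
    rw [hinv z hz, sub_self] at h
    refine h.congr_terms fun k ↦ ?_
    rw [mul_pow]; ring
  have h1 : ∀ z ∈ Metric.ball (0 : ℂ) 1, HasSum (fun k ↦ (if k = n then 1 else 0 : ℂ) * z ^ k)
      (z ^ n) := by
    intro z _
    have := hasSum_ite_eq n (z ^ n)
    convert this using 2 with k
    split_ifs with h <;> simp [h]
  -- pairing with the monomial `z ^ n` on a circle extracts the `n`-th coefficient
  have hr : (1 / 2 : ℝ) ∈ Set.Ioo (0 : ℝ) 1 := by norm_num
  have h2 := hasSum_circle_parseval h1 (Ψ := fun _ ↦ 0) hb2 hr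
  simp only [mul_zero, integral_zero] at h2
  have h3 := h2.unique (hasSum_single n fun k hk ↦ by simp [hk])
  have h4 : (1 : ℂ) - ε ^ (n + 2) ≠ 0 := sub_ne_zero.2 (Ne.symm hn)
  simpa [h4, Real.pi_ne_zero] using h3.symm

/-- The double integrals over the nontrivial rotations add up to the pairing against the Green
weight. Both sides are diagonal in the Taylor coefficients, so that only the multipliers have to agree. -/
theorem disc_identity {m : ℕ} (hm : 2 ≤ m) {ε : ℂ} (hε : IsPrimitiveRoot ε m) {Φ Ψ : ℂ → ℂ}
    (hΦ : DifferentiableOn ℂ Φ (Metric.ball 0 1)) (hΨ : DifferentiableOn ℂ Ψ (Metric.ball 0 1))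
    (hΦi : IntegrableOn (fun z ↦ discWeight z * ‖Φ z‖ ^ 2) (Metric.ball 0 1))
    (hΨi : IntegrableOn (fun z ↦ discWeight z * ‖Ψ z‖ ^ 2) (Metric.ball 0 1))
    (hinv : ∀ z ∈ Metric.ball (0 : ℂ) 1, Ψ (ε * z) * ε ^ 2 = Ψ z) :
    ∑ l ∈ Finset.Icc 1 (m - 1), ∫ z in Metric.ball (0 : ℂ) 1, ∫ w in Metric.ball (0 : ℂ) 1,
        discIntegrand Φ Ψ (ε ^ l) z w =
      -(((m : ℂ) ^ 2 - 1) * (Real.pi : ℂ) ^ 2 / 48) *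
        ∫ z in Metric.ball (0 : ℂ) 1, (greenWeight ‖z‖ : ℂ) * (conj (Φ z) * Ψ z) := by
  have hεn : ‖ε‖ = 1 := hε.norm'_eq_one (by omega)
  have hεl : ∀ l, ‖ε ^ l‖ = 1 := fun l ↦ by rw [norm_pow, hεn, one_pow]
  have hεl1 : ∀ l ∈ Finset.Icc 1 (m - 1), ε ^ l ≠ 1 := fun l hl ↦ by
    rw [Finset.mem_Icc] at hl
    exact hε.pow_ne_one_of_pos_of_lt (by omega) (by omega)
  obtain ⟨a, ha⟩ : ∃ a : ℕ → ℂ, ∀ z ∈ Metric.ball (0 : ℂ) 1,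
      HasSum (fun n ↦ a n * z ^ n) (Φ z) := ⟨_, fun z hz ↦
    (Complex.hasSum_taylorSeries_on_ball hΦ hz).congr_terms fun n ↦ by
      rw [sub_zero, smul_eq_mul, smul_eq_mul, mul_left_comm, mul_comm]⟩
  obtain ⟨b, hb⟩ : ∃ b : ℕ → ℂ, ∀ z ∈ Metric.ball (0 : ℂ) 1,
      HasSum (fun n ↦ b n * z ^ n) (Ψ z) := ⟨_, fun z hz ↦
    (Complex.hasSum_taylorSeries_on_ball hΨ hz).congr_terms fun n ↦ by
      rw [sub_zero, smul_eq_mul, smul_eq_mul, mul_left_comm, mul_comm]⟩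
  have hΦc := hΦ.continuousOn
  have hΨc := hΨ.continuousOn
  -- the Taylor coefficients of the sum of the twisted projections of `Ψ`
  let d : ℕ → ℂ := fun n ↦ -(((m : ℂ) ^ 2 - 1) / 6) * ((n + 2) * bergmanMoment n * b n)
  have hd : ∀ n, ∑ l ∈ Finset.Icc 1 (m - 1), ε ^ l * (twistCoeff (ε ^ l) n * b n *
      bergmanMoment n) = d n := by
    intro n
    by_cases hn : ε ^ (n + 2) = 1
    · have := sum_mul_twistCoeff hm hε ((hε.pow_eq_one_iff_dvd _).1 hn)
      have e : ∀ l ∈ Finset.Icc 1 (m - 1), ε ^ l * (twistCoeff (ε ^ l) n * b n *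
        bergmanMoment n) = (ε ^ l * twistCoeff (ε ^ l) n) * (b n * bergmanMoment n) :=
        fun l _ ↦ by ring
      rw [Finset.sum_congr rfl e, ← Finset.sum_mul, this]
      simp only [d]; ring
    · simp [d, coeff_eq_zero_of_invariant hεn hb hinv hn]
  let H : ℂ → ℂ := fun z ↦ ∑ l ∈ Finset.Icc 1 (m - 1), ε ^ l *
    ∫ w in Metric.ball (0 : ℂ) 1, (((1 - ‖w‖ ^ 2) ^ 2 : ℝ) : ℂ) * (twistFactor (ε ^ l) z w * Ψ w)
  have hH : ∀ z ∈ Metric.ball (0 : ℂ) 1, HasSum (fun n ↦ d n * z ^ n) (H z) := by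
    intro z hz
    have h := hasSum_sum (s := Finset.Icc 1 (m - 1)) fun l _ ↦
      (hasSum_twisted_projection (hεl l) hb hΨc hΨi hz).mul_left (ε ^ l)
    refine h.congr_terms fun n ↦ ?_
    rw [← hd, Finset.sum_mul]
    exact Finset.sum_congr rfl fun l _ ↦ by ring
  have hint : ∀ l ∈ Finset.Icc 1 (m - 1), Integrable (fun q : ℂ × ℂ ↦
      discIntegrand Φ Ψ (ε ^ l) q.1 q.2) (discVolume.prod discVolume) := fun l hl ↦
    integrable_discIntegrand (hεl l) (hεl1 l hl) hΦc hΨc hΦi hΨi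
  have hpt : ∀ z, ∑ l ∈ Finset.Icc 1 (m - 1), ∫ w in Metric.ball (0 : ℂ) 1,
      discIntegrand Φ Ψ (ε ^ l) z w =
      1 / 16 * ((((1 - ‖z‖ ^ 2) ^ 2 : ℝ) : ℂ) * (conj (Φ z) * H z)) := by
    intro z
    simp only [H, Finset.mul_sum]
    refine Finset.sum_congr rfl fun l _ ↦ ?_
    have : ∀ w, discIntegrand Φ Ψ (ε ^ l) z w =
        (1 / 16 * ((((1 - ‖z‖ ^ 2) ^ 2 : ℝ) : ℂ) * (conj (Φ z) * ε ^ l))) *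
        ((((1 - ‖w‖ ^ 2) ^ 2 : ℝ) : ℂ) * (twistFactor (ε ^ l) z w * Ψ w)) := fun w ↦ by
      simp only [discIntegrand]; ring
    simp only [this]
    rw [integral_const_mul]; ring
  rw [← integral_finsetSum _ fun l hl ↦ (hint l hl).integral_prod_left]
  simp only [hpt]
  have hHint : IntegrableOn (fun z : ℂ ↦ (((1 - ‖z‖ ^ 2) ^ 2 : ℝ) : ℂ) * (conj (Φ z) * H z))
      (Metric.ball 0 1) := by
    have h := (integrable_finsetSum (Finset.Icc 1 (m - 1)) fun l hl ↦
      (hint l hl).integral_prod_left).const_mul 16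
    refine h.congr (Filter.Eventually.of_forall fun z ↦ ?_)
    simp only [hpt]; ring
  have hmom : ∀ n : ℕ, 2 * Real.pi * (∫ r in Set.Ioo (0 : ℝ) 1,
      (1 - r ^ 2) ^ 2 * r ^ (2 * n + 1)) = bergmanMoment n := integral_sq_weight_moment_eq
  have h := hasSum_disc_parseval (W := fun r ↦ (1 - r ^ 2) ^ 2) ha hH
    (fun n ↦ integrableOn_Ioo_of_continuous (by fun_prop)) hHint (by
      refine ((summable_coeff_mul ha hb hΦc hΨc hΦi hΨi).mul_left
        (‖((m : ℂ) ^ 2 - 1) / 6‖ * (2 * Real.pi))).congr fun n ↦ ?_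
      simp only [abs_sq]
      have e2 : (n : ℝ) + 2 = ‖(n : ℂ) + 2‖ := by
        rw [show (n : ℂ) + 2 = ((n + 2 : ℕ) : ℂ) by push_cast; ring, Complex.norm_natCast]
        push_cast; ring
      simp only [d, norm_mul, norm_neg, ← e2, Complex.norm_real, Real.norm_eq_abs,
        abs_of_pos (bergmanMoment_pos n)]
      rw [integral_sq_weight_moment, bergmanMoment, momentDenom]
      field_simp)
  have h' := hasSum_integral_greenWeight ha hb hΦc hΨc hΦi hΨi
  rw [integral_const_mul, ← h.tsum_eq, ← h'.tsum_eq, ← tsum_mul_left, ← tsum_mul_left]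
  refine tsum_congr fun n ↦ ?_
  have e1 := bergmanMoment_sq n
  have e3 : ((bergmanMoment n : ℝ) : ℂ) ^ 2 * (n + 2) = 4 * Real.pi ^ 2 / (momentDenom n : ℂ) := by
    exact_mod_cast e1
  have e4 : (2 * Real.pi * (∫ r in Set.Ioo (0 : ℝ) 1, (1 - r ^ 2) ^ 2 * r ^ (2 * n + 1) : ℝ) : ℂ) =
      bergmanMoment n := by rw [← hmom]; push_cast; ring
  rw [e4]
  simp only [d]
  calc _ = -(((m : ℂ) ^ 2 - 1) / 96) * (conj (a n) * b n) *
        ((bergmanMoment n : ℂ) ^ 2 * (n + 2)) := by ring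
    _ = _ := by rw [e3]; ring

/-! ### Möbius transformations and their derivatives -/

/-- The denominator `c z + d` of the Möbius transformation of a matrix. -/
noncomputable def automorphyDenom (g : SL(2, ℝ)) (z : ℂ) : ℂ := (g 1 0 : ℂ) * z + (g 1 1 : ℂ)

theorem automorphyDenom_ne_zero (g : SL(2, ℝ)) (z : ℍ) : automorphyDenom g z ≠ 0 := by
  intro h
  have him := congrArg Complex.im h
  have hre := congrArg Complex.re h
  have hdet := g.det_coe
  rw [Matrix.det_fin_two] at hdet
  simp only [automorphyDenom, Complex.add_im, Complex.mul_im, Complex.ofReal_re, Complex.ofReal_im,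
    zero_mul, add_zero, Complex.zero_im, mul_eq_zero, coe_im] at him
  rcases him with h0 | h0
  · simp only [automorphyDenom, h0, Complex.ofReal_zero, zero_mul, zero_add, Complex.ofReal_re,
      Complex.zero_re] at hre
    rw [h0, hre] at hdet; simp at hdet
  · exact z.im_ne_zero h0

theorem automorphyDenom_conj (g : SL(2, ℝ)) (z : ℂ) :
    automorphyDenom g (conj z) = conj (automorphyDenom g z) := by
  simp [automorphyDenom]

theorem automorphyDenom_conj_ne_zero (g : SL(2, ℝ)) (z : ℍ) :
    automorphyDenom g (conj (z : ℂ)) ≠ 0 := by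
  rw [automorphyDenom_conj]
  exact (map_ne_zero _).2 (automorphyDenom_ne_zero g z)

theorem coe_psl_smul (g : SL(2, ℝ)) (z : ℍ) :
    (((QuotientGroup.mk g : PSL(2, ℝ)) • z : ℍ) : ℂ) =
      ((g 0 0 : ℂ) * z + (g 0 1 : ℂ)) / automorphyDenom g z := by
  rw [psl_mk_smul, coe_specialLinearGroup_apply]
  simp [automorphyDenom]

theorem det_coe_complex (g : SL(2, ℝ)) :
    (g 0 0 : ℂ) * (g 1 1 : ℂ) - (g 0 1 : ℂ) * (g 1 0 : ℂ) = 1 := by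
  have hdet := g.det_coe
  rw [Matrix.det_fin_two] at hdet
  exact_mod_cast hdet

theorem mobiusDeriv_mk (g : SL(2, ℝ)) (z : ℍ) :
    mobiusDeriv (QuotientGroup.mk g) z = 1 / automorphyDenom g z ^ 2 := by
  have hev : (fun ζ : ℂ ↦ (((QuotientGroup.mk g : PSL(2, ℝ)) • ofComplex ζ : ℍ) : ℂ)) =ᶠ[nhds (z : ℂ)]
      fun ζ ↦ ((g 0 0 : ℂ) * ζ + (g 0 1 : ℂ)) / ((g 1 0 : ℂ) * ζ + (g 1 1 : ℂ)) := by
    filter_upwards [isOpen_upperHalfPlaneSet.mem_nhds z.coe_im_pos] with ζ hζ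
    rw [coe_psl_smul, ofComplex_apply_of_im_pos hζ]; rfl
  rw [mobiusDeriv, hev.deriv_eq]
  have hne := automorphyDenom_ne_zero g z
  have h1 : HasDerivAt (fun ζ : ℂ ↦ (g 0 0 : ℂ) * ζ + (g 0 1 : ℂ)) (g 0 0 : ℂ) (z : ℂ) := by
    simpa using ((hasDerivAt_id (z : ℂ)).const_mul (g 0 0 : ℂ)).add_const (g 0 1 : ℂ)
  have h2 : HasDerivAt (fun ζ : ℂ ↦ (g 1 0 : ℂ) * ζ + (g 1 1 : ℂ)) (g 1 0 : ℂ) (z : ℂ) := by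
    simpa using ((hasDerivAt_id (z : ℂ)).const_mul (g 1 0 : ℂ)).add_const (g 1 1 : ℂ)
  refine (h1.div h2 hne).deriv.trans ?_
  have hd := det_coe_complex g
  change _ / automorphyDenom g z ^ 2 = _
  congr 1
  linear_combination hd

theorem mobiusDeriv_ne_zero (γ : PSL(2, ℝ)) (z : ℍ) : mobiusDeriv γ z ≠ 0 := by
  obtain ⟨g, rfl⟩ := QuotientGroup.mk_surjective γ
  rw [mobiusDeriv_mk]
  exact div_ne_zero one_ne_zero (pow_ne_zero 2 (automorphyDenom_ne_zero g z))

theorem continuous_mobiusDeriv (γ : PSL(2, ℝ)) : Continuous (mobiusDeriv γ) := by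
  obtain ⟨g, rfl⟩ := QuotientGroup.mk_surjective γ
  simp only [funext (mobiusDeriv_mk g)]
  refine Continuous.div continuous_const ?_ fun z ↦ pow_ne_zero 2 (automorphyDenom_ne_zero g z)
  unfold automorphyDenom
  have := continuous_coe
  fun_prop

instance : ContinuousConstSMul PSL(2, ℝ) ℍ where
  continuous_const_smul γ := by
    obtain ⟨g, rfl⟩ := QuotientGroup.mk_surjective γ
    exact continuous_const_smul (g : GL (Fin 2) ℝ)

instance : SMulInvariantMeasure PSL(2, ℝ) ℍ volume where
  measure_preimage_smul γ s hs := by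
    obtain ⟨g, rfl⟩ := QuotientGroup.mk_surjective γ
    exact SMulInvariantMeasure.measure_preimage_smul (μ := (volume : Measure ℍ))
      (g : GL (Fin 2) ℝ) hs

/-- The polarized form of the transformation law of the imaginary part. -/
theorem smul_sub_smul_conj_sq (γ : PSL(2, ℝ)) (z w : ℍ) :
    (((γ • z : ℍ) : ℂ) - conj ((γ • w : ℍ) : ℂ)) ^ 2 =
      ((z : ℂ) - conj (w : ℂ)) ^ 2 * mobiusDeriv γ z * conj (mobiusDeriv γ w) := by
  obtain ⟨g, rfl⟩ := QuotientGroup.mk_surjective γ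
  have hz := automorphyDenom_ne_zero g z
  have hw := automorphyDenom_conj_ne_zero g w
  rw [mobiusDeriv_mk, mobiusDeriv_mk, coe_psl_smul, coe_psl_smul]
  simp only [map_div₀, map_add, map_mul, Complex.conj_ofReal, map_one, map_pow,
    ← automorphyDenom_conj]
  have h : ((g 0 0 : ℂ) * z + g 0 1) / automorphyDenom g z -
      ((g 0 0 : ℂ) * conj (w : ℂ) + g 0 1) / automorphyDenom g (conj (w : ℂ)) =
      (z - conj (w : ℂ)) / (automorphyDenom g z * automorphyDenom g (conj (w : ℂ))) := by
    rw [div_sub_div _ _ hz hw]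
    congr 1
    simp only [automorphyDenom]
    linear_combination (z - conj (w : ℂ)) * det_coe_complex g
  rw [h]; field_simp

theorem smul_sub_smul_sq (γ : PSL(2, ℝ)) (z w : ℍ) :
    (((γ • z : ℍ) : ℂ) - ((γ • w : ℍ) : ℂ)) ^ 2 =
      ((z : ℂ) - (w : ℂ)) ^ 2 * mobiusDeriv γ z * mobiusDeriv γ w := by
  obtain ⟨g, rfl⟩ := QuotientGroup.mk_surjective γ
  have hz := automorphyDenom_ne_zero g z
  have hw := automorphyDenom_ne_zero g w
  rw [mobiusDeriv_mk, mobiusDeriv_mk, coe_psl_smul, coe_psl_smul]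
  have h : ((g 0 0 : ℂ) * z + g 0 1) / automorphyDenom g z -
      ((g 0 0 : ℂ) * (w : ℂ) + g 0 1) / automorphyDenom g w =
      (z - (w : ℂ)) / (automorphyDenom g z * automorphyDenom g w) := by
    rw [div_sub_div _ _ hz hw]
    congr 1
    simp only [automorphyDenom]
    linear_combination (z - (w : ℂ)) * det_coe_complex g
  rw [h]; field_simp

theorem sub_conj_self (z : ℍ) : (z : ℂ) - conj (z : ℂ) = 2 * z.im * Complex.I := by
  rw [Complex.sub_conj]; push_cast; rfl

theorem norm_sub_conj_self (z : ℍ) : ‖(z : ℂ) - conj (z : ℂ)‖ = 2 * z.im := by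
  rw [sub_conj_self]
  simp [abs_of_pos z.im_pos]

theorem im_psl_smul (γ : PSL(2, ℝ)) (z : ℍ) : (γ • z).im = z.im * ‖mobiusDeriv γ z‖ := by
  have h := congrArg norm (smul_sub_smul_conj_sq γ z z)
  simp only [norm_mul, norm_pow, norm_sub_conj_self, RCLike.norm_conj] at h
  have h2 : (γ • z).im ^ 2 = (z.im * ‖mobiusDeriv γ z‖) ^ 2 := by nlinarith
  exact (pow_left_inj₀ (γ • z).im_pos.le
    (mul_nonneg z.im_pos.le (norm_nonneg _)) two_ne_zero).1 h2

theorem pointPair_smul (γ : PSL(2, ℝ)) (z w : ℍ) :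
    pointPair (γ • z) (γ • w) = pointPair z w := by
  have h := congrArg norm (smul_sub_smul_sq γ z w)
  simp only [norm_mul, norm_pow] at h
  rw [pointPair, pointPair, h, im_psl_smul, im_psl_smul]
  have h1 := norm_ne_zero_iff.2 (mobiusDeriv_ne_zero γ z)
  have h2 := norm_ne_zero_iff.2 (mobiusDeriv_ne_zero γ w)
  have := z.im_pos
  have := w.im_pos
  field_simp

theorem pointPair_comm (z w : ℍ) : pointPair z w = pointPair w z := by
  rw [pointPair, pointPair, norm_sub_rev]; ring

theorem pointPair_nonneg (z w : ℍ) : 0 ≤ pointPair z w :=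
  div_nonneg (sq_nonneg _) (by have := z.im_pos; have := w.im_pos; positivity)

theorem sub_conj_ne_zero (z w : ℍ) : (z : ℂ) - conj (w : ℂ) ≠ 0 := by
  intro h
  have := congrArg Complex.im h
  simp only [Complex.sub_im, Complex.conj_im, coe_im, Complex.zero_im] at this
  linarith [z.im_pos, w.im_pos]

theorem mobiusDeriv_mul (α β : PSL(2, ℝ)) (z : ℍ) :
    mobiusDeriv (α * β) z = mobiusDeriv α (β • z) * mobiusDeriv β z := by
  obtain ⟨g, rfl⟩ := QuotientGroup.mk_surjective α
  obtain ⟨h, rfl⟩ := QuotientGroup.mk_surjective β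
  rw [← QuotientGroup.mk_mul, mobiusDeriv_mk, mobiusDeriv_mk, mobiusDeriv_mk, div_mul_div_comm,
    one_mul, ← mul_pow]
  congr 2
  have hz := automorphyDenom_ne_zero h z
  have : automorphyDenom g (((QuotientGroup.mk h : PSL(2, ℝ)) • z : ℍ) : ℂ) =
      ((g 1 0 : ℂ) * ((h 0 0 : ℂ) * z + h 0 1) + g 1 1 * automorphyDenom h z) /
        automorphyDenom h z := by
    rw [coe_psl_smul]
    nth_rewrite 1 [automorphyDenom]
    field_simp
  rw [this, div_mul_cancel₀ _ hz]
  simp only [automorphyDenom, Matrix.SpecialLinearGroup.coe_mul, Matrix.mul_apply, Fin.sum_univ_two]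
  push_cast; ring

theorem mobiusDeriv_one (z : ℍ) : mobiusDeriv 1 z = 1 := by
  have h := mobiusDeriv_mul 1 1 z
  rw [mul_one, one_smul] at h
  exact (mul_eq_right₀ (mobiusDeriv_ne_zero 1 z)).1 h.symm

theorem mobiusDeriv_pow_of_fixes {γ : PSL(2, ℝ)} {p : ℍ} (h : γ • p = p) (l : ℕ) :
    γ ^ l • p = p ∧ mobiusDeriv (γ ^ l) p = mobiusDeriv γ p ^ l := by
  induction l with
  | zero => simp [mobiusDeriv_one]
  | succ l ih => rw [pow_succ', mul_smul, ih.1, mobiusDeriv_mul, ih.1, ih.2, pow_succ']; simp [h]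

/-- A Möbius transformation fixing `p` acts as the rotation by its derivative at `p` in the
coordinate `(z - p) / (z - conj p)`. -/
theorem smul_sub_fixed {γ : PSL(2, ℝ)} {p : ℍ} (h : γ • p = p) (z : ℍ) :
    (((γ • z : ℍ) : ℂ) - p) * ((z : ℂ) - conj (p : ℂ)) =
      mobiusDeriv γ p * (((z : ℂ) - p) * (((γ • z : ℍ) : ℂ) - conj (p : ℂ))) := by
  obtain ⟨g, rfl⟩ := QuotientGroup.mk_surjective γ
  have hz := automorphyDenom_ne_zero g z
  have hp := automorphyDenom_ne_zero g p
  have hp' := automorphyDenom_conj_ne_zero g p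
  have e1 := coe_psl_smul g p
  rw [h] at e1
  have hnorm : automorphyDenom g p * automorphyDenom g (conj (p : ℂ)) = 1 := by
    have him := im_psl_smul (QuotientGroup.mk g) p
    rw [h, mobiusDeriv_mk, norm_div, norm_one, norm_pow] at him
    have h1 : ‖automorphyDenom g p‖ ^ 2 = 1 := by
      have := p.im_pos
      have h3 : 0 < ‖automorphyDenom g p‖ := norm_pos_iff.2 hp
      field_simp at him
      linarith
    rw [automorphyDenom_conj, Complex.mul_conj']
    exact_mod_cast h1
  have e2 : conj (p : ℂ) = ((g 0 0 : ℂ) * conj (p : ℂ) + (g 0 1 : ℂ)) /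
      automorphyDenom g (conj (p : ℂ)) := by
    conv_lhs => rw [e1]
    simp [automorphyDenom_conj]
  have f1 : (((QuotientGroup.mk g : PSL(2, ℝ)) • z : ℍ) : ℂ) - p =
      (z - p) / (automorphyDenom g z * automorphyDenom g p) := by
    have e : (((QuotientGroup.mk g : PSL(2, ℝ)) • z : ℍ) : ℂ) - p =
        ((g 0 0 : ℂ) * z + (g 0 1 : ℂ)) / automorphyDenom g z -
          ((g 0 0 : ℂ) * p + (g 0 1 : ℂ)) / automorphyDenom g p := by rw [coe_psl_smul, ← e1]
    rw [e, div_sub_div _ _ hz hp]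
    congr 1
    simp only [automorphyDenom]
    linear_combination ((z : ℂ) - p) * det_coe_complex g
  have f2 : (((QuotientGroup.mk g : PSL(2, ℝ)) • z : ℍ) : ℂ) - conj (p : ℂ) =
      (z - conj (p : ℂ)) / (automorphyDenom g z * automorphyDenom g (conj (p : ℂ))) := by
    have e : (((QuotientGroup.mk g : PSL(2, ℝ)) • z : ℍ) : ℂ) - conj (p : ℂ) =
        ((g 0 0 : ℂ) * z + (g 0 1 : ℂ)) / automorphyDenom g z -
          ((g 0 0 : ℂ) * conj (p : ℂ) + (g 0 1 : ℂ)) / automorphyDenom g (conj (p : ℂ)) := by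
      rw [coe_psl_smul, ← e2]
    rw [e, div_sub_div _ _ hz hp']
    congr 1
    simp only [automorphyDenom]
    linear_combination ((z : ℂ) - conj (p : ℂ)) * det_coe_complex g
  rw [f1, f2, mobiusDeriv_mk]
  have : automorphyDenom g (conj (p : ℂ)) = 1 / automorphyDenom g p := by
    rw [eq_div_iff hp, mul_comm]; exact hnorm
  rw [this]
  field_simp

/-- An element of the stabilizer of a point is determined by its multiplier. -/
theorem eq_one_of_fixes_of_mobiusDeriv_eq_one {γ : PSL(2, ℝ)} {p : ℍ} (h : γ • p = p)
    (h1 : mobiusDeriv γ p = 1) : γ = 1 := by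
  obtain ⟨g, rfl⟩ := QuotientGroup.mk_surjective γ
  rw [mobiusDeriv_mk] at h1
  have hp := automorphyDenom_ne_zero g p
  have h2 : automorphyDenom g p ^ 2 = 1 := by
    field_simp at h1; exact h1.symm
  have e1 := coe_psl_smul g p
  rw [h] at e1
  have hdet := g.det_coe
  rw [Matrix.det_fin_two] at hdet
  have key : ∀ s : ℝ, s ^ 2 = 1 → automorphyDenom g p = (s : ℂ) →
      (QuotientGroup.mk g : PSL(2, ℝ)) = 1 := by
    intro s hs hd
    have him := congrArg Complex.im hd
    simp only [automorphyDenom, Complex.add_im, Complex.mul_im, Complex.ofReal_re,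
      Complex.ofReal_im, zero_mul, add_zero, mul_eq_zero, coe_im, p.im_ne_zero, or_false] at him
    have hre := congrArg Complex.re hd
    simp only [automorphyDenom, him, Complex.ofReal_zero, zero_mul, zero_add,
      Complex.ofReal_re] at hre
    have ha : g 0 0 = s := by
      rw [him, hre] at hdet
      have : g 0 0 * s * s = s := by linear_combination s * hdet
      linear_combination this - g 0 0 * hs
    have hb : g 0 1 = 0 := by
      rw [hd, ha] at e1
      have hs0 : (s : ℂ) ≠ 0 := by rintro h0; rw [Complex.ofReal_eq_zero] at h0; simp [h0] at hs
      field_simp at e1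
      have : (g 0 1 : ℂ) = 0 := by linear_combination -e1
      exact_mod_cast this
    rw [QuotientGroup.eq_one_iff, Matrix.SpecialLinearGroup.mem_center_iff]
    refine ⟨s, by simpa using hs, ?_⟩
    ext i j
    fin_cases i <;> fin_cases j <;> simp [ha, hb, him, hre]
  rcases mul_self_eq_one_iff.1 ((sq _).symm.trans h2) with h3 | h3
  · exact key 1 (by norm_num) (by simpa using h3)
  · exact key (-1) (by norm_num) (by simpa using h3)

/-! ### The disc coordinate centred at a point of the upper half-plane -/

/-- The inverse `ζ ↦ (p - conj p * ζ) / (1 - ζ)` of the coordinate `(z - p) / (z - conj p)`. -/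
noncomputable def cayley (p : ℍ) (ζ : ℂ) : ℂ := (p - conj (p : ℂ) * ζ) / (1 - ζ)

/-- The derivative of `cayley p`. -/
noncomputable def cayleyDeriv (p : ℍ) (ζ : ℂ) : ℂ := 2 * p.im * Complex.I / (1 - ζ) ^ 2

/-- The parametrization of the upper half-plane by the unit disc that sends `0` to `p`; the values
outside of the unit disc are irrelevant. -/
noncomputable def discChart (p : ℍ) (ζ : ℂ) : ℍ := ofComplex (cayley p ζ)

theorem one_sub_ne_zero_of_mem_ball {ζ : ℂ} (hζ : ζ ∈ Metric.ball (0 : ℂ) 1) : 1 - ζ ≠ 0 :=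
  one_sub_ne_zero_of_norm_lt (mem_ball_zero_iff.1 hζ)

theorem cayley_sub_conj (p : ℍ) {ζ ω : ℂ} (hζ : ζ ∈ Metric.ball (0 : ℂ) 1)
    (hω : ω ∈ Metric.ball (0 : ℂ) 1) :
    cayley p ζ - conj (cayley p ω) =
      2 * p.im * Complex.I * (1 - ζ * conj ω) / ((1 - ζ) * (1 - conj ω)) := by
  have h1 := one_sub_ne_zero_of_mem_ball hζ
  have h2 : 1 - conj ω ≠ 0 := by
    have := (map_ne_zero (starRingEnd ℂ)).2 (one_sub_ne_zero_of_mem_ball hω)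
    simpa using this
  simp only [cayley, map_div₀, map_sub, map_mul, map_one, Complex.conj_conj]
  rw [div_sub_div _ _ h1 h2, ← sub_conj_self]
  congr 1; ring

theorem im_cayley (p : ℍ) {ζ : ℂ} (hζ : ζ ∈ Metric.ball (0 : ℂ) 1) :
    (cayley p ζ).im = p.im * (1 - ‖ζ‖ ^ 2) / ‖1 - ζ‖ ^ 2 := by
  have h := cayley_sub_conj p hζ hζ
  have e : (1 - ζ) * (1 - conj ζ) = ((‖1 - ζ‖ ^ 2 : ℝ) : ℂ) := by
    have := Complex.mul_conj' (1 - ζ)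
    rw [map_sub, map_one] at this
    rw [this]; push_cast; rfl
  rw [Complex.sub_conj, Complex.mul_conj', e] at h
  have h2 := congrArg Complex.im h
  have e2 : (2 * p.im * Complex.I * (1 - (‖ζ‖ : ℂ) ^ 2) / ((‖1 - ζ‖ ^ 2 : ℝ) : ℂ)) =
      ((2 * p.im * (1 - ‖ζ‖ ^ 2) / ‖1 - ζ‖ ^ 2 : ℝ) : ℂ) * Complex.I := by push_cast; ring
  rw [e2] at h2
  simp only [Complex.im_ofReal_mul, Complex.I_im, mul_one] at h2
  have e3 : 2 * p.im * (1 - ‖ζ‖ ^ 2) / ‖1 - ζ‖ ^ 2 =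
      2 * (p.im * (1 - ‖ζ‖ ^ 2) / ‖1 - ζ‖ ^ 2) := by ring
  linarith

theorem im_cayley_pos (p : ℍ) {ζ : ℂ} (hζ : ζ ∈ Metric.ball (0 : ℂ) 1) :
    0 < (cayley p ζ).im := by
  rw [im_cayley p hζ]
  have := norm_pos_iff.2 (one_sub_ne_zero_of_mem_ball hζ)
  have := one_sub_norm_sq_pos hζ
  have := p.im_pos
  positivity

theorem coe_discChart (p : ℍ) {ζ : ℂ} (hζ : ζ ∈ Metric.ball (0 : ℂ) 1) :
    (discChart p ζ : ℂ) = cayley p ζ := by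
  rw [discChart, ofComplex_apply_of_im_pos (im_cayley_pos p hζ)]

theorem im_discChart (p : ℍ) {ζ : ℂ} (hζ : ζ ∈ Metric.ball (0 : ℂ) 1) :
    (discChart p ζ).im = p.im * (1 - ‖ζ‖ ^ 2) / ‖1 - ζ‖ ^ 2 := by
  rw [← coe_im, coe_discChart p hζ, im_cayley p hζ]

theorem hasDerivAt_cayley (p : ℍ) {ζ : ℂ} (hζ : ζ ∈ Metric.ball (0 : ℂ) 1) :
    HasDerivAt (cayley p) (cayleyDeriv p ζ) ζ := by
  have h1 : HasDerivAt (fun ζ : ℂ ↦ (p : ℂ) - conj (p : ℂ) * ζ) (-conj (p : ℂ)) ζ := by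
    simpa using ((hasDerivAt_id ζ).const_mul (conj (p : ℂ))).const_sub (p : ℂ)
  have h2 : HasDerivAt (fun ζ : ℂ ↦ 1 - ζ) (-1) ζ := by
    simpa using (hasDerivAt_id ζ).const_sub (1 : ℂ)
  refine (h1.div h2 (one_sub_ne_zero_of_mem_ball hζ)).congr_deriv ?_
  rw [cayleyDeriv, ← sub_conj_self]
  congr 1; ring

theorem cayleyDeriv_ne_zero (p : ℍ) {ζ : ℂ} (hζ : ζ ∈ Metric.ball (0 : ℂ) 1) :
    cayleyDeriv p ζ ≠ 0 := by
  rw [cayleyDeriv, ← sub_conj_self]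
  exact div_ne_zero (sub_conj_ne_zero p p) (pow_ne_zero 2 (one_sub_ne_zero_of_mem_ball hζ))

theorem norm_cayleyDeriv_mul (p : ℍ) {ζ : ℂ} (hζ : ζ ∈ Metric.ball (0 : ℂ) 1) :
    ‖cayleyDeriv p ζ‖ * (1 - ‖ζ‖ ^ 2) = 2 * (discChart p ζ).im := by
  rw [im_discChart p hζ, cayleyDeriv, norm_div, norm_pow, ← sub_conj_self, norm_sub_conj_self]
  ring

theorem discChart_sub_conj_sq (p : ℍ) {ζ ω : ℂ} (hζ : ζ ∈ Metric.ball (0 : ℂ) 1)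
    (hω : ω ∈ Metric.ball (0 : ℂ) 1) :
    ((discChart p ζ : ℂ) - conj (discChart p ω : ℂ)) ^ 2 =
      -(cayleyDeriv p ζ * conj (cayleyDeriv p ω)) * (1 - ζ * conj ω) ^ 2 := by
  rw [coe_discChart p hζ, coe_discChart p hω, cayley_sub_conj p hζ hω]
  simp only [cayleyDeriv, map_div₀, map_mul, map_pow, map_sub, map_one, Complex.conj_ofReal,
    Complex.conj_I, Complex.conj_ofNat]
  have h1 := one_sub_ne_zero_of_mem_ball hζ
  have h2 : 1 - conj ω ≠ 0 := by
    have := (map_ne_zero (starRingEnd ℂ)).2 (one_sub_ne_zero_of_mem_ball hω)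
    simpa using this
  field_simp

theorem discChart_sub_center (p : ℍ) {ζ : ℂ} (hζ : ζ ∈ Metric.ball (0 : ℂ) 1) :
    (discChart p ζ : ℂ) - p = ((p : ℂ) - conj (p : ℂ)) * ζ / (1 - ζ) ∧
    (discChart p ζ : ℂ) - conj (p : ℂ) = ((p : ℂ) - conj (p : ℂ)) / (1 - ζ) := by
  have h1 := one_sub_ne_zero_of_mem_ball hζ
  rw [coe_discChart p hζ, cayley]
  constructor
  · field_simp; ring
  · field_simp; ring

theorem pointPair_discChart (p : ℍ) {ζ : ℂ} (hζ : ζ ∈ Metric.ball (0 : ℂ) 1) :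
    pointPair p (discChart p ζ) = ‖ζ‖ ^ 2 / (1 - ‖ζ‖ ^ 2) := by
  have h1 := norm_pos_iff.2 (one_sub_ne_zero_of_mem_ball hζ)
  have h2 := one_sub_norm_sq_pos hζ
  have h3 := p.im_pos
  rw [pointPair, norm_sub_rev, (discChart_sub_center p hζ).1, im_discChart p hζ, norm_div,
    norm_mul, norm_sub_conj_self]
  field_simp; ring

theorem norm_mobiusDeriv_of_fixes {γ : PSL(2, ℝ)} {p : ℍ} (h : γ • p = p) :
    ‖mobiusDeriv γ p‖ = 1 := by
  have h1 := im_psl_smul γ p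
  rw [h] at h1
  exact (mul_eq_left₀ p.im_ne_zero).1 h1.symm

theorem mul_mem_ball {ε ζ : ℂ} (hε : ‖ε‖ = 1) (hζ : ζ ∈ Metric.ball (0 : ℂ) 1) :
    ε * ζ ∈ Metric.ball (0 : ℂ) 1 := by
  rw [mem_ball_zero_iff, norm_mul, hε, one_mul]; exact mem_ball_zero_iff.1 hζ

theorem smul_discChart {γ : PSL(2, ℝ)} {p : ℍ} (h : γ • p = p) {ζ : ℂ}
    (hζ : ζ ∈ Metric.ball (0 : ℂ) 1) :
    γ • discChart p ζ = discChart p (mobiusDeriv γ p * ζ) := by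
  have hεζ := mul_mem_ball (norm_mobiusDeriv_of_fixes h) hζ
  have h1 := one_sub_ne_zero_of_mem_ball hζ
  have h2 := one_sub_ne_zero_of_mem_ball hεζ
  have h3 := smul_sub_fixed h (discChart p ζ)
  rw [(discChart_sub_center p hζ).1, (discChart_sub_center p hζ).2] at h3
  have hp := sub_conj_ne_zero p p
  ext
  rw [coe_discChart p hεζ, cayley, eq_div_iff h2]
  field_simp at h3
  linear_combination h3

theorem mobiusDeriv_discChart {γ : PSL(2, ℝ)} {p : ℍ} (h : γ • p = p) {ζ : ℂ}
    (hζ : ζ ∈ Metric.ball (0 : ℂ) 1) :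
    mobiusDeriv γ (discChart p ζ) * cayleyDeriv p ζ =
      mobiusDeriv γ p * cayleyDeriv p (mobiusDeriv γ p * ζ) := by
  have hε := norm_mobiusDeriv_of_fixes h
  have hεζ := mul_mem_ball hε hζ
  have h1 := one_sub_ne_zero_of_mem_ball hζ
  have h2 := one_sub_ne_zero_of_mem_ball hεζ
  have h3 := smul_sub_smul_conj_sq γ (discChart p ζ) p
  rw [h, smul_discChart h hζ, (discChart_sub_center p hζ).2, (discChart_sub_center p hεζ).2] at h3
  have h4 : mobiusDeriv γ p * conj (mobiusDeriv γ p) = 1 := by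
    rw [Complex.mul_conj', hε]; simp
  have hp := sub_conj_ne_zero p p
  have h5 : mobiusDeriv γ (discChart p ζ) * conj (mobiusDeriv γ p) / (1 - ζ) ^ 2 =
      1 / (1 - mobiusDeriv γ p * ζ) ^ 2 := by
    rw [div_pow, div_pow] at h3
    have hp2 := pow_ne_zero 2 hp
    apply mul_left_cancel₀ hp2
    rw [mul_one_div, h3]; ring
  simp only [cayleyDeriv]
  calc mobiusDeriv γ (discChart p ζ) * (2 * p.im * Complex.I / (1 - ζ) ^ 2)
      = (2 * p.im * Complex.I) * (mobiusDeriv γ p * conj (mobiusDeriv γ p)) *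
        (mobiusDeriv γ (discChart p ζ) / (1 - ζ) ^ 2) := by rw [h4]; ring
    _ = (2 * p.im * Complex.I) * mobiusDeriv γ p *
        (mobiusDeriv γ (discChart p ζ) * conj (mobiusDeriv γ p) / (1 - ζ) ^ 2) := by ring
    _ = _ := by rw [h5]; ring

theorem exists_discChart_eq (p z : ℍ) : ∃ ζ ∈ Metric.ball (0 : ℂ) 1, discChart p ζ = z := by
  have hz := sub_conj_ne_zero z p
  have hp := sub_conj_ne_zero p p
  set ζ : ℂ := ((z : ℂ) - p) / (z - conj (p : ℂ)) with hζ
  have hmem : ζ ∈ Metric.ball (0 : ℂ) 1 := by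
    rw [mem_ball_zero_iff, hζ, norm_div, div_lt_one (norm_pos_iff.2 hz)]
    have h1 : ‖(z : ℂ) - p‖ ^ 2 < ‖(z : ℂ) - conj (p : ℂ)‖ ^ 2 := by
      rw [← Complex.normSq_eq_norm_sq, ← Complex.normSq_eq_norm_sq, Complex.normSq_apply,
        Complex.normSq_apply]
      simp only [Complex.sub_re, Complex.sub_im, Complex.conj_re, Complex.conj_im, coe_re, coe_im]
      nlinarith [mul_pos z.im_pos p.im_pos]
    exact lt_of_pow_lt_pow_left₀ 2 (norm_nonneg _) h1
  refine ⟨ζ, hmem, ?_⟩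
  ext
  rw [coe_discChart p hmem, cayley, div_eq_iff (one_sub_ne_zero_of_mem_ball hmem), hζ]
  field_simp; ring

theorem cayley_injOn (p : ℍ) : Set.InjOn (cayley p) (Metric.ball (0 : ℂ) 1) := by
  intro ζ hζ ω hω h
  have h1 := one_sub_ne_zero_of_mem_ball hζ
  have h2 := one_sub_ne_zero_of_mem_ball hω
  have hp := sub_conj_ne_zero p p
  simp only [cayley] at h
  rw [div_eq_div_iff h1 h2] at h
  apply mul_left_cancel₀ hp
  linear_combination h

theorem measurable_ofComplex : Measurable (ofComplex : ℂ → ℍ) := by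
  rw [← measurableEmbedding_coe.measurable_comp_iff]
  have : (UpperHalfPlane.coe ∘ (ofComplex : ℂ → ℍ)) = fun w : ℂ ↦
      if 0 < w.im then w else ((Classical.choice inferInstance : ℍ) : ℂ) := by
    ext w
    simp only [Function.comp_apply, ofComplex_apply_eq_ite]
    split_ifs <;> rfl
  rw [this]
  exact Measurable.ite (measurableSet_lt measurable_const Complex.measurable_im) measurable_id
    measurable_const

theorem measurable_discChart (p : ℍ) : Measurable (discChart p) := by
  refine measurable_ofComplex.comp ?_
  unfold cayley; fun_prop

/-- The hyperbolic area of the unit disc. -/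
noncomputable def discArea : Measure ℂ :=
  discVolume.withDensity fun ζ ↦ ENNReal.ofReal (4 / (1 - ‖ζ‖ ^ 2) ^ 2)

theorem det_smul_one (c : ℂ) : (c • (1 : ℂ →L[ℝ] ℂ)).det = ‖c‖ ^ 2 := by
  have : (c • (1 : ℂ →L[ℝ] ℂ)).toLinearMap = LinearMap.mul ℝ ℂ c := by ext; simp
  rw [ContinuousLinearMap.det, this]
  have h := Algebra.norm_apply ℝ c
  rw [Algebra.norm_complex_apply, Complex.normSq_eq_norm_sq] at h
  exact h.symm

/-- The disc coordinate identifies the hyperbolic areas; the Jacobian is `|cayleyDeriv p ζ|²`. -/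
theorem measurePreserving_discChart (p : ℍ) :
    MeasurePreserving (discChart p) discArea volume := by
  refine ⟨measurable_discChart p, ?_⟩
  ext s hs
  have hpre := (measurable_discChart p) hs
  rw [Measure.map_apply (measurable_discChart p) hs, discArea, withDensity_apply _ hpre,
    discVolume, Measure.restrict_restrict hpre, volume_eq_lintegral]
  have himg : UpperHalfPlane.coe '' s = cayley p '' (discChart p ⁻¹' s ∩ Metric.ball 0 1) := by
    ext w
    constructor
    · rintro ⟨z, hz, rfl⟩
      obtain ⟨ζ, hζ, rfl⟩ := exists_discChart_eq p z
      exact ⟨ζ, ⟨hz, hζ⟩, (coe_discChart p hζ).symm⟩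
    · rintro ⟨ζ, ⟨h1, h2⟩, rfl⟩
      exact ⟨discChart p ζ, h1, coe_discChart p h2⟩
  rw [himg, lintegral_image_eq_lintegral_abs_det_fderiv_mul volume
    (hpre.inter measurableSet_ball) (fun ζ hζ ↦
      (hasDerivAt_cayley p hζ.2).complexToReal_fderiv.hasFDerivWithinAt)
    ((cayley_injOn p).mono Set.inter_subset_right)]
  refine setLIntegral_congr_fun (hpre.inter measurableSet_ball) fun ζ hζ ↦ ?_
  have h1 := norm_cayleyDeriv_mul p hζ.2
  have h2 := one_sub_norm_sq_pos hζ.2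
  have h3 := (discChart p ζ).im_pos
  have e : (((1 / ‖(cayley p ζ).im‖₊) ^ 2 : NNReal) : ENNReal) =
      ENNReal.ofReal ((1 / (discChart p ζ).im) ^ 2) := by
    rw [← coe_discChart p hζ.2, coe_im, ← ENNReal.ofReal_coe_nnreal]
    congr 1
    push_cast
    rw [Real.norm_of_nonneg h3.le]
  simp only [det_smul_one]
  rw [e, ← ENNReal.ofReal_mul (abs_nonneg _), abs_of_nonneg (sq_nonneg _)]
  congr 1
  have h4 : ‖cayleyDeriv p ζ‖ = 2 * (discChart p ζ).im / (1 - ‖ζ‖ ^ 2) := by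
    rw [eq_div_iff h2.ne', h1]
  rw [h4]; field_simp; norm_num

/-! ### A decaying point-pair invariant -/

/-- The function `(1 + u)^(-3/2)` of the point-pair invariant. It is integrable over the
upper half-plane because the exponent is less than `-1`. -/
noncomputable def decay (u : ℝ) : ℝ := 1 / ((1 + u) * √(1 + u))

theorem measurable_decay : Measurable decay := by unfold decay; fun_prop

theorem decay_nonneg {u : ℝ} (hu : 0 ≤ u) : 0 ≤ decay u := by unfold decay; positivity

theorem decay_pos {u : ℝ} (hu : 0 ≤ u) : 0 < decay u := by
  have : 0 < √(1 + u) := Real.sqrt_pos.2 (by linarith)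
  unfold decay; positivity

theorem continuous_pointPair : Continuous fun q : ℍ × ℍ ↦ pointPair q.1 q.2 := by
  unfold pointPair
  have h1 := continuous_coe
  have h2 := continuous_im
  refine Continuous.div (by fun_prop) (by fun_prop) fun q ↦ ?_
  have := q.1.im_pos
  have := q.2.im_pos
  positivity

theorem decay_le_of_le {A u v : ℝ} (hu : 0 ≤ u) (hv : 0 ≤ v) (hA : 0 < A)
    (h : 1 + v ≤ A * (1 + u)) : decay u ≤ A * √A * decay v := by
  have h1 : √(1 + v) ≤ √A * √(1 + u) := by
    rw [← Real.sqrt_mul hA.le]; exact Real.sqrt_le_sqrt h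
  have hv0 : 0 < √(1 + v) := Real.sqrt_pos.2 (by linarith)
  have hu0 : 0 < √(1 + u) := Real.sqrt_pos.2 (by linarith)
  have hv1 : 0 < 1 + v := by linarith
  have hu1 : 0 < 1 + u := by linarith
  rw [decay, decay, mul_one_div, div_le_div_iff₀ (by positivity) (by positivity), one_mul]
  calc (1 + v) * √(1 + v) ≤ (A * (1 + u)) * (√A * √(1 + u)) :=
        mul_le_mul h h1 hv0.le (by positivity)
    _ = _ := by ring

theorem one_add_pointPair (z w : ℍ) : 1 + pointPair z w = Real.cosh (dist z w / 2) ^ 2 := by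
  rw [Real.cosh_sq', sinh_half_dist, pointPair, div_pow, mul_pow, Real.sq_sqrt
    (mul_nonneg z.im_pos.le w.im_pos.le), Complex.dist_eq]
  ring

/-- A quasi-triangle inequality for `1 + u`. -/
theorem one_add_pointPair_le (x y z : ℍ) :
    1 + pointPair x z ≤ 4 * (1 + pointPair x y) * (1 + pointPair y z) := by
  simp only [one_add_pointPair]
  have h1 : Real.cosh (dist x z / 2) ≤ Real.cosh (dist x y / 2 + dist y z / 2) := by
    rw [Real.cosh_le_cosh, abs_of_nonneg (by positivity), abs_of_nonneg (by positivity)]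
    linarith [dist_triangle x y z]
  have h2 : Real.cosh (dist x y / 2 + dist y z / 2) ≤
      2 * (Real.cosh (dist x y / 2) * Real.cosh (dist y z / 2)) := by
    rw [Real.cosh_add]
    have h3 := Real.sinh_lt_cosh (x := dist x y / 2)
    have h4 := Real.sinh_lt_cosh (x := dist y z / 2)
    have h5 : 0 ≤ Real.sinh (dist x y / 2) := Real.sinh_nonneg_iff.2 (by positivity)
    have h6 : 0 ≤ Real.sinh (dist y z / 2) := Real.sinh_nonneg_iff.2 (by positivity)
    nlinarith [mul_le_mul h3.le h4.le h6 (h5.trans h3.le)]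
  have h0 := Real.cosh_pos (dist x z / 2)
  calc Real.cosh (dist x z / 2) ^ 2
      ≤ (2 * (Real.cosh (dist x y / 2) * Real.cosh (dist y z / 2))) ^ 2 :=
        pow_le_pow_left₀ h0.le (h1.trans h2) 2
    _ = _ := by ring

theorem decay_disc {ζ : ℂ} (hζ : ζ ∈ Metric.ball (0 : ℂ) 1) :
    decay (‖ζ‖ ^ 2 / (1 - ‖ζ‖ ^ 2)) = (1 - ‖ζ‖ ^ 2) * √(1 - ‖ζ‖ ^ 2) := by
  have h := one_sub_norm_sq_pos hζ
  have e : 1 + ‖ζ‖ ^ 2 / (1 - ‖ζ‖ ^ 2) = (1 - ‖ζ‖ ^ 2)⁻¹ := by field_simp; ring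
  rw [decay, e, Real.sqrt_inv, ← mul_inv, one_div, inv_inv]

theorem integrableOn_inv_sqrt :
    IntegrableOn (fun ζ : ℂ ↦ 4 / √(1 - ‖ζ‖ ^ 2)) (Metric.ball (0 : ℂ) 1) := by
  rw [integrableOn_fun_norm_addHaar volume (f := fun r ↦ 4 / √(1 - r ^ 2))]
  have hd : ∀ r ∈ Set.Ioo (0 : ℝ) 1,
      HasDerivAt (fun r : ℝ ↦ -4 * √(1 - r ^ 2)) (r * (4 / √(1 - r ^ 2))) r := by
    intro r hr
    have h0 := one_sub_sq_pos hr
    have h1 : HasDerivAt (fun r : ℝ ↦ 1 - r ^ 2) (-(2 * r)) r := by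
      simpa using (hasDerivAt_pow 2 r).const_sub 1
    refine ((h1.sqrt h0.ne').const_mul (-4)).congr_deriv ?_
    field_simp
  have h := intervalIntegral.integrableOn_deriv_of_nonneg (a := 0) (b := 1)
    (Continuous.continuousOn (by fun_prop)) hd (fun r hr ↦ by have := hr.1; positivity)
  refine (h.mono_set Set.Ioo_subset_Ioc_self).congr_fun (fun r _ ↦ ?_) measurableSet_Ioo
  simp

/-- The hyperbolic integral of `decay (u(p, z))` over `z`. -/
noncomputable def decayMass : ENNReal :=
  ∫⁻ ζ in Metric.ball (0 : ℂ) 1, ENNReal.ofReal (4 / √(1 - ‖ζ‖ ^ 2))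

theorem decayMass_lt_top : decayMass < ⊤ := integrableOn_inv_sqrt.lintegral_lt_top

theorem lintegral_decay (p : ℍ) :
    ∫⁻ z : ℍ, ENNReal.ofReal (decay (pointPair p z)) = decayMass := by
  have hm : Measurable fun z : ℍ ↦ ENNReal.ofReal (decay (pointPair p z)) :=
    (measurable_decay.comp (continuous_pointPair.comp (Continuous.prodMk_right p)).measurable
      ).ennreal_ofReal
  rw [← (measurePreserving_discChart p).lintegral_comp hm, discArea, decayMass]
  refine (lintegral_withDensity_eq_lintegral_mul discVolume (by fun_prop)
    (hm.comp (measurable_discChart p))).trans ?_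
  refine setLIntegral_congr_fun measurableSet_ball fun ζ hζ ↦ ?_
  have h := one_sub_norm_sq_pos hζ
  have hs := Real.sqrt_pos.2 h
  simp only [Pi.mul_apply, Function.comp_apply, pointPair_discChart p hζ, decay_disc hζ]
  rw [← ENNReal.ofReal_mul (by positivity)]
  congr 1
  have h2 := Real.mul_self_sqrt h.le
  field_simp
  linear_combination h2

/-! ### Orbit sums -/

theorem volume_pos_of_isOpen {U : Set ℍ} (hU : IsOpen U) (hne : U.Nonempty) :
    0 < (volume : Measure ℍ) U := by
  rw [pos_iff_ne_zero]
  intro h0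
  have hac : (volume : Measure ℂ).comap UpperHalfPlane.coe ≪ (volume : Measure ℍ) := by
    rw [volume_def]
    refine withDensity_absolutelyContinuous' ?_ (ae_of_all _ fun z ↦ ?_)
    · refine Measurable.aemeasurable ?_
      refine measurable_coe_nnreal_ennreal.comp (Continuous.measurable ?_)
      refine .pow (.div₀ continuous_const ?_ ?_) _
      · exact continuous_im.subtype_mk _
      · exact fun x ↦ NNReal.ne_iff.mp x.im_ne_zero
    · have : (NNReal.mk z.im z.im_pos.le) ≠ 0 := NNReal.ne_iff.mp z.im_ne_zero
      exact ENNReal.coe_ne_zero.2 (pow_ne_zero 2 (div_ne_zero one_ne_zero this))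
  have h1 := hac h0
  rw [measurableEmbedding_coe.comap_apply] at h1
  exact (isOpenEmbedding_coe.isOpenMap U hU).measure_ne_zero _ (hne.image _) h1

/-- The orbit sum of `decay` is bounded uniformly in the second point: compare it with an integral
over a neighbourhood of the orbit. Only proper discontinuity is used, so that cusps
need no separate treatment. -/
theorem exists_orbit_sum_bound (Γ : Subgroup PSL(2, ℝ)) [ProperlyDiscontinuousSMul Γ ℍ] (p : ℍ) :
    ∃ C : ENNReal, C ≠ ⊤ ∧
      ∀ z : ℍ, ∑' γ : Γ, ENNReal.ofReal (decay (pointPair (γ • p) z)) ≤ C := by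
  set K := Metric.closedBall p 1 with hK
  have hKc : IsCompact K := isCompact_closedBall p 1
  have hfin := ProperlyDiscontinuousSMul.finite_disjoint_inter_image (Γ := Γ) hKc hKc
  set S := hfin.toFinset with hS
  set A : ℝ := 4 * Real.cosh (1 / 2) ^ 2 with hA
  have hA0 : 0 < A := by have := Real.cosh_pos (1 / 2); positivity
  set B : ENNReal := ENNReal.ofReal (A * √A) with hB
  have hvol0 : (volume : Measure ℍ) K ≠ 0 := by
    refine (lt_of_lt_of_le (volume_pos_of_isOpen Metric.isOpen_ball ⟨p, Metric.mem_ball_self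
      one_pos⟩) (measure_mono Metric.ball_subset_closedBall)).ne'
  have hvolt : (volume : Measure ℍ) K ≠ ⊤ := hKc.measure_lt_top.ne
  refine ⟨B * (S.card * decayMass) / volume K,
    ENNReal.div_ne_top (ENNReal.mul_ne_top ENNReal.ofReal_ne_top
      (ENNReal.mul_ne_top (ENNReal.natCast_ne_top _) decayMass_lt_top.ne)) hvol0, fun z ↦ ?_⟩
  have hm : Measurable fun w : ℍ ↦ ENNReal.ofReal (decay (pointPair z w)) :=
    (measurable_decay.comp (continuous_pointPair.comp (Continuous.prodMk_right z)).measurable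
      ).ennreal_ofReal
  have hKγ : ∀ γ : Γ, MeasurableSet ((fun w : ℍ ↦ γ⁻¹ • w) ⁻¹' K) := fun γ ↦
    (measurable_const_smul γ⁻¹) hKc.measurableSet
  rw [ENNReal.tsum_eq_iSup_sum]
  refine iSup_le fun s ↦ ?_
  rw [ENNReal.le_div_iff_mul_le (Or.inl hvol0) (Or.inl hvolt), Finset.sum_mul]
  have h1 : ∀ γ ∈ s, ENNReal.ofReal (decay (pointPair (γ • p) z)) * volume K ≤
      ∫⁻ w, B * ((fun w : ℍ ↦ γ⁻¹ • w) ⁻¹' K).indicator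
        (fun w ↦ ENNReal.ofReal (decay (pointPair z w))) w := by
    intro γ _
    have hv : volume ((fun w : ℍ ↦ γ⁻¹ • w) ⁻¹' K) = volume K :=
      measure_preimage_smul (μ := (volume : Measure ℍ)) γ⁻¹ K
    rw [← hv, ← setLIntegral_const, ← lintegral_indicator (hKγ γ)]
    refine lintegral_mono fun w ↦ ?_
    by_cases hw : w ∈ (fun w : ℍ ↦ γ⁻¹ • w) ⁻¹' K
    · rw [Set.indicator_of_mem hw, Set.indicator_of_mem hw, hB,
        ← ENNReal.ofReal_mul (by positivity)]
      refine ENNReal.ofReal_le_ofReal ?_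
      have hu := pointPair_nonneg (γ • p) z
      refine decay_le_of_le hu (pointPair_nonneg z w) hA0 ?_
      have h2 := one_add_pointPair_le z (γ • p) w
      have h3 : pointPair (γ • p) w = pointPair p (γ⁻¹ • w) := by
        have := pointPair_smul (γ : PSL(2, ℝ)) p (γ⁻¹ • w)
        rw [← this]
        congr 1
        exact (smul_inv_smul γ w).symm
      have h4 : 1 + pointPair (γ • p) w ≤ Real.cosh (1 / 2) ^ 2 := by
        rw [h3, one_add_pointPair]
        refine pow_le_pow_left₀ (Real.cosh_pos _).le ?_ 2
        rw [Real.cosh_le_cosh, abs_of_nonneg (by positivity), abs_of_nonneg (by positivity)]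
        have : dist (γ⁻¹ • w) p ≤ 1 := hw
        rw [dist_comm]; linarith
      rw [pointPair_comm z (γ • p)] at h2
      refine h2.trans ?_
      rw [hA]
      have : (0 : ℝ) ≤ 4 * (1 + pointPair (γ • p) z) := by linarith
      nlinarith [mul_le_mul_of_nonneg_left h4 this]
    · rw [Set.indicator_of_notMem hw]; exact zero_le
  refine (Finset.sum_le_sum h1).trans ?_
  have hmi : ∀ γ : Γ, Measurable (((fun w : ℍ ↦ γ⁻¹ • w) ⁻¹' K).indicator
        (fun w ↦ ENNReal.ofReal (decay (pointPair z w)))) := fun γ ↦ hm.indicator (hKγ γ)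
  rw [← lintegral_finsetSum _ fun γ _ ↦ (hmi γ).const_mul B]
  simp only [← Finset.mul_sum]
  rw [lintegral_const_mul _ (Finset.measurable_sum _ fun γ _ ↦ hmi γ), ← lintegral_decay z,
    ← lintegral_const_mul _ hm]
  refine mul_le_mul_right (lintegral_mono fun w ↦ ?_) B
  classical
  -- at most `S.card` translates of `K` contain `w`
  have hcard : (s.filter fun γ : Γ ↦ γ⁻¹ • w ∈ K).card ≤ S.card := by
    rcases (s.filter fun γ : Γ ↦ γ⁻¹ • w ∈ K).eq_empty_or_nonempty with h | ⟨γ₀, hγ₀⟩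
    · rw [h]; simp
    · refine Finset.card_le_card_of_injOn (fun γ ↦ γ⁻¹ * γ₀) (fun γ hγ ↦ ?_)
        (fun a _ b _ hab ↦ by simpa using hab)
      rw [Finset.mem_filter] at hγ₀
      have hγ' := (Finset.mem_filter.1 hγ).2
      rw [hS, Finset.mem_coe, Set.Finite.mem_toFinset]
      exact ⟨γ⁻¹ • w, ⟨γ₀⁻¹ • w, hγ₀.2, by simp [mul_smul]⟩, hγ'⟩
  have hind : ∀ γ : Γ, ((fun w : ℍ ↦ γ⁻¹ • w) ⁻¹' K).indicator
      (fun w ↦ ENNReal.ofReal (decay (pointPair z w))) w =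
      if γ⁻¹ • w ∈ K then ENNReal.ofReal (decay (pointPair z w)) else 0 := fun γ ↦ by
    rw [Set.indicator_apply]; rfl
  simp only [hind]
  rw [← Finset.sum_filter, Finset.sum_const, nsmul_eq_mul]
  gcongr

theorem summable_decay (Γ : Subgroup PSL(2, ℝ)) [ProperlyDiscontinuousSMul Γ ℍ] (p z : ℍ) :
    Summable fun γ : Γ ↦ decay (pointPair (γ • p) z) := by
  obtain ⟨C, hC, h⟩ := exists_orbit_sum_bound Γ p
  have h1 := ENNReal.summable_toReal ((h z).trans_lt hC.lt_top).ne
  refine h1.congr fun γ ↦ ?_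
  rw [ENNReal.toReal_ofReal (decay_nonneg (pointPair_nonneg _ _))]

/-- A summable family of positive numbers has a countable index set. -/
theorem countable_of_properlyDiscontinuous (Γ : Subgroup PSL(2, ℝ))
    [ProperlyDiscontinuousSMul Γ ℍ] : Countable Γ := by
  have h := (summable_decay Γ I I).countable_support
  have : Function.support (fun γ : Γ ↦ decay (pointPair (γ • I) I)) = Set.univ :=
    Set.eq_univ_of_forall fun γ ↦ (decay_pos (pointPair_nonneg _ _)).ne'
  rw [this] at h
  exact Set.countable_univ_iff.1 h

theorem greenKernel_eq (z w : ℍ) : greenKernel z w = greenProfile (pointPair z w) := rfl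

/-- The series of the automorphic Green function converges. The terms at which the kernel is
singular or large are finitely many. -/
theorem summable_greenKernel (Γ : Subgroup PSL(2, ℝ)) [ProperlyDiscontinuousSMul Γ ℍ] (p z : ℍ) :
    Summable fun γ : Γ ↦ greenKernel (γ • p) z := by
  have hs := summable_decay Γ p z
  refine Summable.of_norm_bounded_eventually hs ?_
  have hev := hs.tendsto_cofinite_zero.eventually (gt_mem_nhds (decay_pos zero_le_one))
  filter_upwards [hev] with γ hγ
  set u := pointPair (γ • p) z with hu
  have hu0 : 0 ≤ u := pointPair_nonneg _ _
  have hu1 : 1 < u := by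
    by_contra! hle
    have h1 : decay 1 ≤ decay u := by
      have := decay_le_of_le (A := 1) zero_le_one hu0 one_pos (by linarith)
      simpa using this
    linarith
  rw [greenKernel_eq, Real.norm_of_nonneg (greenProfile_nonneg (by linarith))]
  refine (greenProfile_le (by linarith)).trans ?_
  rw [decay]
  have hsq : √(1 + u) ≤ 1 + u := Real.sqrt_le_iff.2 ⟨by linarith, by nlinarith⟩
  have hsq0 : 0 < √(1 + u) := Real.sqrt_pos.2 (by linarith)
  refine one_div_le_one_div_of_le (by positivity) ?_
  have h2 : (1 + u) * √(1 + u) ≤ (1 + u) * (1 + u) := mul_le_mul_of_nonneg_left hsq (by linarith)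
  nlinarith [Real.pi_gt_three, mul_pos (show 0 < u by linarith) (show 0 < u + 1 by linarith)]

/-! ### Unfolding over a Fuchsian group -/

/-- Unfolding: the integrals over a fundamental domain of the translates of an integrable function
converge absolutely and add up to its integral over the upper half-plane. -/
theorem hasSum_unfold {Γ : Subgroup PSL(2, ℝ)} [Countable Γ] {F : Set ℍ}
    (hF : IsFundamentalDomain Γ F volume) {h : ℍ → ℂ} (hh : Integrable h) :
    (Summable fun γ : Γ ↦ ∫ z in F, ‖h (γ⁻¹ • z)‖) ∧
      HasSum (fun γ : Γ ↦ ∫ z in F, h (γ⁻¹ • z)) (∫ z, h z) := by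
  have hi : ∀ γ : Γ, Integrable fun z ↦ h (γ⁻¹ • z) := fun γ ↦
    (measurePreserving_smul γ⁻¹ (volume : Measure ℍ)).integrable_comp_of_integrable hh
  have h1 : ∑' γ : Γ, ∫⁻ z in F, ‖h (γ⁻¹ • z)‖ₑ ≠ ⊤ := by
    rw [← hF.lintegral_eq_tsum' fun z ↦ ‖h z‖ₑ]
    exact hh.2.ne
  have h2 : Summable fun γ : Γ ↦ ∫ z in F, ‖h (γ⁻¹ • z)‖ := by
    refine (ENNReal.summable_toReal h1).congr fun γ ↦ ?_
    rw [integral_norm_eq_lintegral_enorm (hi γ).1.restrict]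
  refine ⟨h2, ?_⟩
  rw [hF.integral_eq_tsum' h hh]
  exact (Summable.of_norm_bounded h2 fun γ ↦ norm_integral_le_integral_norm _).hasSum

namespace IsHolomorphicQuadraticDifferential

variable {Γ : Subgroup PSL(2, ℝ)} {φ : ℍ → ℂ}

theorem continuous (hφ : IsHolomorphicQuadraticDifferential Γ φ) : Continuous φ := by
  have h : φ = (fun ζ : ℂ ↦ φ (ofComplex ζ)) ∘ UpperHalfPlane.coe := by
    ext z; simp
  rw [h]
  exact hφ.holomorphic.continuousOn.comp_continuous continuous_coe fun z ↦ z.coe_im_pos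

theorem norm_sq_smul (hφ : IsHolomorphicQuadraticDifferential Γ φ) {γ : PSL(2, ℝ)} (hγ : γ ∈ Γ)
    (z : ℍ) : ‖φ (γ • z)‖ ^ 2 * (γ • z).im ^ 4 = ‖φ z‖ ^ 2 * z.im ^ 4 := by
  rw [← hφ.automorphic γ hγ z, im_psl_smul, norm_mul, norm_pow]; ring

/-- The weight `(1 + u(p, z))^(-3/2)` makes the invariant density `|φ|² y⁴` integrable over the
whole upper half-plane: unfold and apply the uniform bound for its orbit sums. -/
theorem integrable_mul_decay [ProperlyDiscontinuousSMul Γ ℍ]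
    (hφ : IsHolomorphicQuadraticDifferential Γ φ) {F : Set ℍ}
    (hF : IsFundamentalDomain Γ F volume) (p : ℍ) :
    Integrable fun z : ℍ ↦ ‖φ z‖ ^ 2 * z.im ^ 4 * decay (pointPair p z) := by
  have := countable_of_properlyDiscontinuous Γ
  have hc := hφ.continuous
  have hd : Measurable fun z : ℍ ↦ decay (pointPair p z) :=
    measurable_decay.comp (continuous_pointPair.comp (Continuous.prodMk_right p)).measurable
  have hfc : Continuous fun z : ℍ ↦ ‖φ z‖ ^ 2 * z.im ^ 4 := by
    have := continuous_im; fun_prop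
  refine ⟨(hfc.measurable.mul hd).aestronglyMeasurable, ?_⟩
  obtain ⟨C, hC, hsum⟩ := exists_orbit_sum_bound Γ p
  have hnn : ∀ z : ℍ, 0 ≤ ‖φ z‖ ^ 2 * z.im ^ 4 := fun z ↦ by have := z.im_pos; positivity
  rw [hasFiniteIntegral_iff_ofReal (Filter.Eventually.of_forall fun z ↦
    mul_nonneg (hnn z) (decay_nonneg (pointPair_nonneg _ _)))]
  rw [hF.lintegral_eq_tsum' fun z ↦ ENNReal.ofReal (‖φ z‖ ^ 2 * z.im ^ 4 * decay (pointPair p z))]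
  have h1 : ∀ (γ : Γ) (z : ℍ), ENNReal.ofReal (‖φ (γ⁻¹ • z)‖ ^ 2 * (γ⁻¹ • z).im ^ 4 *
      decay (pointPair p (γ⁻¹ • z))) = ENNReal.ofReal (‖φ z‖ ^ 2 * z.im ^ 4) *
        ENNReal.ofReal (decay (pointPair (γ • p) z)) := by
    intro γ z
    rw [← ENNReal.ofReal_mul (hnn z)]
    have e1 : ‖φ (γ⁻¹ • z)‖ ^ 2 * (γ⁻¹ • z).im ^ 4 = ‖φ z‖ ^ 2 * z.im ^ 4 :=
      hφ.norm_sq_smul (γ⁻¹).2 z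
    have e2 : pointPair p (γ⁻¹ • z) = pointPair (γ • p) z := by
      rw [← pointPair_smul (γ : PSL(2, ℝ)) p (γ⁻¹ • z)]
      congr 1
      exact smul_inv_smul γ z
    rw [e1, e2]
  simp only [h1]
  have hm : ∀ γ : Γ, Measurable fun z : ℍ ↦ ENNReal.ofReal (‖φ z‖ ^ 2 * z.im ^ 4) *
      ENNReal.ofReal (decay (pointPair (γ • p) z)) := fun γ ↦
    (hfc.measurable.ennreal_ofReal).mul ((measurable_decay.comp
      (continuous_pointPair.comp (Continuous.prodMk_right (γ • p))).measurable).ennreal_ofReal)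
  rw [← lintegral_tsum fun γ ↦ (hm γ).aemeasurable]
  simp only [ENNReal.tsum_mul_left]
  refine lt_of_le_of_lt (lintegral_mono fun z ↦ mul_le_mul_right (hsum z) _) ?_
  rw [lintegral_mul_const _ hfc.measurable.ennreal_ofReal]
  exact ENNReal.mul_lt_top (hφ.square_integrable F hF).lintegral_lt_top hC.lt_top

end IsHolomorphicQuadraticDifferential

/-! ### Transfer of integrals to the disc -/

theorem integrable_withDensity_ofReal {α : Type*} [MeasurableSpace α] {μ : Measure α} {a : α → ℝ}
    (ha : Measurable a) (ha0 : ∀ x, 0 ≤ a x) {E : Type*} [NormedAddCommGroup E] [NormedSpace ℝ E]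
    {f : α → E} : Integrable f (μ.withDensity fun x ↦ ENNReal.ofReal (a x)) ↔
      Integrable (fun x ↦ a x • f x) μ := by
  rw [integrable_withDensity_iff_integrable_smul' ha.ennreal_ofReal
    (Filter.Eventually.of_forall fun _ ↦ ENNReal.ofReal_lt_top)]
  simp only [ENNReal.toReal_ofReal (ha0 _)]

theorem integral_withDensity_ofReal {α : Type*} [MeasurableSpace α] {μ : Measure α} {a : α → ℝ}
    (ha : Measurable a) (ha0 : ∀ x, 0 ≤ a x) {E : Type*} [NormedAddCommGroup E] [NormedSpace ℝ E]
    (f : α → E) : ∫ x, f x ∂(μ.withDensity fun x ↦ ENNReal.ofReal (a x)) = ∫ x, a x • f x ∂μ := by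
  rw [integral_withDensity_eq_integral_toReal_smul ha.ennreal_ofReal
    (Filter.Eventually.of_forall fun _ ↦ ENNReal.ofReal_lt_top)]
  simp only [ENNReal.toReal_ofReal (ha0 _)]

theorem integrable_prod_withDensity_ofReal {α β : Type*} [MeasurableSpace α] [MeasurableSpace β]
    {μ : Measure α} {ν : Measure β} [SFinite μ] [SFinite ν] {a : α → ℝ} {b : β → ℝ}
    (ha : Measurable a) (ha0 : ∀ x, 0 ≤ a x) (hb : Measurable b) (hb0 : ∀ x, 0 ≤ b x)
    {f : α × β → ℂ} :
    Integrable f ((μ.withDensity fun x ↦ ENNReal.ofReal (a x)).prod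
      (ν.withDensity fun x ↦ ENNReal.ofReal (b x))) ↔
      Integrable (fun q ↦ ((a q.1 * b q.2 : ℝ) : ℂ) * f q) (μ.prod ν) := by
  rw [prod_withDensity ha.ennreal_ofReal hb.ennreal_ofReal]
  simp only [← ENNReal.ofReal_mul (ha0 _)]
  rw [integrable_withDensity_ofReal (a := fun q : α × β ↦ a q.1 * b q.2) (by fun_prop)
    fun q ↦ mul_nonneg (ha0 _) (hb0 _)]
  simp only [Complex.real_smul]

/-- The density of the hyperbolic area of the disc with respect to Lebesgue measure. -/
noncomputable def discDensity (ζ : ℂ) : ℝ := 4 / (1 - ‖ζ‖ ^ 2) ^ 2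

theorem measurable_discDensity : Measurable discDensity := by unfold discDensity; fun_prop

theorem discDensity_nonneg (ζ : ℂ) : 0 ≤ discDensity ζ := by unfold discDensity; positivity

theorem discArea_eq : discArea = discVolume.withDensity fun ζ ↦ ENNReal.ofReal (discDensity ζ) :=
  rfl

instance : SFinite discArea := by rw [discArea_eq]; infer_instance

theorem integrable_iff_disc (p : ℍ) {f : ℍ → ℝ} (hf : Measurable f) :
    Integrable f ↔ IntegrableOn (fun ζ ↦ discDensity ζ * f (discChart p ζ)) (Metric.ball 0 1) := by
  rw [← (measurePreserving_discChart p).integrable_comp hf.aestronglyMeasurable, discArea_eq,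
    integrable_withDensity_ofReal measurable_discDensity discDensity_nonneg]
  rfl

theorem integrable_iff_disc_complex (p : ℍ) {f : ℍ → ℂ} (hf : Measurable f) :
    Integrable f ↔
      IntegrableOn (fun ζ ↦ (discDensity ζ : ℂ) * f (discChart p ζ)) (Metric.ball 0 1) := by
  rw [← (measurePreserving_discChart p).integrable_comp hf.aestronglyMeasurable, discArea_eq,
    integrable_withDensity_ofReal measurable_discDensity discDensity_nonneg]
  simp only [Complex.real_smul, Function.comp_apply]
  rfl

theorem integral_eq_disc (p : ℍ) {f : ℍ → ℂ} (hf : Measurable f) :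
    ∫ z, f z = ∫ ζ in Metric.ball (0 : ℂ) 1, (discDensity ζ : ℂ) * f (discChart p ζ) := by
  rw [← (measurePreserving_discChart p).map_eq, integral_map (measurable_discChart p).aemeasurable
    hf.aestronglyMeasurable, discArea_eq,
    integral_withDensity_ofReal measurable_discDensity discDensity_nonneg]
  simp only [Complex.real_smul]

theorem measurePreserving_discChart_prod (p : ℍ) :
    MeasurePreserving (Prod.map (discChart p) (discChart p)) (discArea.prod discArea)
      ((volume : Measure ℍ).prod volume) :=
  (measurePreserving_discChart p).prod (measurePreserving_discChart p)

theorem integrable_prod_iff_disc (p : ℍ) {f : ℍ × ℍ → ℂ} (hf : Measurable f) :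
    Integrable f ((volume : Measure ℍ).prod volume) ↔
      Integrable (fun q : ℂ × ℂ ↦ ((discDensity q.1 * discDensity q.2 : ℝ) : ℂ) *
        f (discChart p q.1, discChart p q.2)) (discVolume.prod discVolume) := by
  rw [← (measurePreserving_discChart_prod p).integrable_comp hf.aestronglyMeasurable, discArea_eq,
    integrable_prod_withDensity_ofReal measurable_discDensity discDensity_nonneg
      measurable_discDensity discDensity_nonneg]
  rfl

theorem integral_prod_eq_disc (p : ℍ) {f : ℍ × ℍ → ℂ} (hf : Measurable f)
    (hfi : Integrable f ((volume : Measure ℍ).prod volume)) :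
    ∫ z, ∫ w, f (z, w) = ∫ ζ in Metric.ball (0 : ℂ) 1, ∫ ω in Metric.ball (0 : ℂ) 1,
      (discDensity ζ * discDensity ω : ℂ) * f (discChart p ζ, discChart p ω) := by
  rw [← integral_prod _ hfi]
  have h1 := (integrable_prod_iff_disc p hf).1 hfi
  have h2 := ((measurePreserving_discChart_prod p).integrable_comp hf.aestronglyMeasurable).2 hfi
  rw [← (measurePreserving_discChart_prod p).map_eq, integral_map
    (measurePreserving_discChart_prod p).measurable.aemeasurable hf.aestronglyMeasurable]
  have h3 := integral_prod _ h2
  refine h3.trans ?_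
  rw [discArea_eq, integral_withDensity_ofReal measurable_discDensity discDensity_nonneg]
  refine integral_congr_ae (Filter.Eventually.of_forall fun ζ ↦ ?_)
  simp only
  rw [integral_withDensity_ofReal measurable_discDensity discDensity_nonneg,
    Complex.real_smul, ← integral_const_mul]
  refine integral_congr_ae (Filter.Eventually.of_forall fun ω ↦ ?_)
  simp only [Complex.real_smul, Function.comp_apply, Prod.map_apply]
  ring

/-! ### Quadratic differentials in the disc coordinate -/

/-- The quadratic differential `φ` in the disc coordinate centred at `p`. -/
noncomputable def discPullback (p : ℍ) (φ : ℍ → ℂ) (ζ : ℂ) : ℂ :=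
  φ (discChart p ζ) * cayleyDeriv p ζ ^ 2

namespace IsHolomorphicQuadraticDifferential

variable {Γ : Subgroup PSL(2, ℝ)} {φ : ℍ → ℂ}

theorem differentiableOn_discPullback (hφ : IsHolomorphicQuadraticDifferential Γ φ) (p : ℍ) :
    DifferentiableOn ℂ (discPullback p φ) (Metric.ball 0 1) := by
  unfold discPullback
  refine DifferentiableOn.mul ?_ (DifferentiableOn.pow ?_ 2)
  · exact hφ.holomorphic.comp (fun ζ hζ ↦
      (hasDerivAt_cayley p hζ).differentiableAt.differentiableWithinAt)
      fun ζ hζ ↦ im_cayley_pos p hζ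
  · unfold cayleyDeriv
    refine DifferentiableOn.div (differentiableOn_const _) (by fun_prop) fun ζ hζ ↦
      pow_ne_zero 2 (one_sub_ne_zero_of_mem_ball hζ)

/-- In the coordinate centred at a fixed point of `γ`, automorphy under `γ` is invariance under a
rotation. -/
theorem discPullback_rotation (hφ : IsHolomorphicQuadraticDifferential Γ φ) {γ : PSL(2, ℝ)}
    (hγ : γ ∈ Γ) {p : ℍ} (h : γ • p = p) {ζ : ℂ} (hζ : ζ ∈ Metric.ball (0 : ℂ) 1) :
    discPullback p φ (mobiusDeriv γ p * ζ) * mobiusDeriv γ p ^ 2 = discPullback p φ ζ := by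
  have h1 := hφ.automorphic γ hγ (discChart p ζ)
  have h2 := mobiusDeriv_discChart h hζ
  rw [smul_discChart h hζ] at h1
  simp only [discPullback]
  rw [← h1, mul_assoc, mul_assoc, ← mul_pow, ← mul_pow, h2, mul_comm (cayleyDeriv _ _)]

/-- The weight `decay` becomes `discWeight` in the disc coordinate. -/
theorem integrableOn_discPullback [ProperlyDiscontinuousSMul Γ ℍ]
    (hφ : IsHolomorphicQuadraticDifferential Γ φ) {F : Set ℍ}
    (hF : IsFundamentalDomain Γ F volume) (p : ℍ) :
    IntegrableOn (fun ζ ↦ discWeight ζ * ‖discPullback p φ ζ‖ ^ 2) (Metric.ball 0 1) := by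
  have hc := hφ.continuous
  have hm : Measurable fun z : ℍ ↦ ‖φ z‖ ^ 2 * z.im ^ 4 * decay (pointPair p z) := by
    have hfc : Continuous fun z : ℍ ↦ ‖φ z‖ ^ 2 * z.im ^ 4 := by
      have := continuous_im; fun_prop
    exact hfc.measurable.mul (measurable_decay.comp
      (continuous_pointPair.comp (Continuous.prodMk_right p)).measurable)
  have h := ((integrable_iff_disc p hm).1 (hφ.integrable_mul_decay hF p)).const_mul 4
  refine IntegrableOn.congr_fun h (fun ζ hζ ↦ ?_) measurableSet_ball
  have h0 := one_sub_norm_sq_pos hζ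
  have h1 := norm_cayleyDeriv_mul p hζ
  have h2 : (discChart p ζ).im = ‖cayleyDeriv p ζ‖ * (1 - ‖ζ‖ ^ 2) / 2 := by linarith
  simp only [discDensity, pointPair_discChart p hζ, decay_disc hζ, h2, discPullback, norm_mul,
    norm_pow, discWeight]
  field_simp
  norm_num
  ring

end IsHolomorphicQuadraticDifferential

/-! ### Invariance and local form of the two integrands -/

section Beltrami

variable {Γ : Subgroup PSL(2, ℝ)} {φ ψ μ ν : ℍ → ℂ}

theorem continuous_beltrami (hφ : IsHolomorphicQuadraticDifferential Γ φ)
    (hμ : ∀ z : ℍ, μ z = (z.im : ℂ) ^ 2 * conj (φ z)) : Continuous μ := by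
  rw [funext hμ]
  exact ((Complex.continuous_ofReal.comp continuous_im).pow 2).mul
    (Complex.continuous_conj.comp hφ.continuous)

theorem im_smul_sq (γ : PSL(2, ℝ)) (z : ℍ) :
    ((γ • z).im : ℂ) ^ 2 = (z.im : ℂ) ^ 2 * (mobiusDeriv γ z * conj (mobiusDeriv γ z)) := by
  rw [im_psl_smul, Complex.mul_conj']
  push_cast; ring

/-- The transformation law `μ(γ z) conj (γ'(z)) = μ(z) γ'(z)` of a Beltrami differential. -/
theorem beltrami_smul (hφ : IsHolomorphicQuadraticDifferential Γ φ)
    (hμ : ∀ z : ℍ, μ z = (z.im : ℂ) ^ 2 * conj (φ z)) {γ : PSL(2, ℝ)} (hγ : γ ∈ Γ) (z : ℍ) :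
    μ (γ • z) * conj (mobiusDeriv γ z) = μ z * mobiusDeriv γ z := by
  rw [hμ, hμ, im_smul_sq, ← hφ.automorphic γ hγ z, map_mul, map_pow]
  ring

theorem beltrami_mul_conj_smul (hφ : IsHolomorphicQuadraticDifferential Γ φ)
    (hμ : ∀ z : ℍ, μ z = (z.im : ℂ) ^ 2 * conj (φ z))
    (hψ : IsHolomorphicQuadraticDifferential Γ ψ)
    (hν : ∀ z : ℍ, ν z = (z.im : ℂ) ^ 2 * conj (ψ z)) {γ : PSL(2, ℝ)} (hγ : γ ∈ Γ) (z : ℍ) :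
    μ (γ • z) * conj (ν (γ • z)) = μ z * conj (ν z) := by
  have h0 := mobiusDeriv_ne_zero γ z
  have h0' : conj (mobiusDeriv γ z) ≠ 0 := (map_ne_zero _).2 h0
  have h1 := beltrami_smul hφ hμ hγ z
  have h2 := congrArg conj (beltrami_smul hψ hν hγ z)
  simp only [map_mul, Complex.conj_conj] at h2
  refine mul_right_cancel₀ (mul_ne_zero h0' h0) ?_
  linear_combination (conj (ν (γ • z)) * mobiusDeriv γ z) * h1 + (μ z * mobiusDeriv γ z) * h2

/-- The density of `ellipticIntegrand μ ν γ z w d²w d²z` with respect to the hyperbolic area in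
both variables. -/
noncomputable def hyperbolicIntegrand (μ ν : ℍ → ℂ) (γ : PSL(2, ℝ)) (z w : ℍ) : ℂ :=
  ((z.im ^ 2 * w.im ^ 2 : ℝ) : ℂ) * ellipticIntegrand μ ν γ z w

theorem measurable_hyperbolicIntegrand (hμ : Continuous μ) (hν : Continuous ν) (γ : PSL(2, ℝ)) :
    Measurable fun q : ℍ × ℍ ↦ hyperbolicIntegrand μ ν γ q.1 q.2 := by
  refine Continuous.measurable ?_
  unfold hyperbolicIntegrand ellipticIntegrand
  have h1 := continuous_mobiusDeriv γ
  have h2 : Continuous fun z : ℍ ↦ γ • z := continuous_const_smul γ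
  have h3 := continuous_coe
  have h4 := continuous_im
  have h5 := Complex.continuous_conj
  refine Continuous.mul (by fun_prop) (Continuous.mul (Continuous.div ?_ ?_ ?_) (by fun_prop))
  · fun_prop
  · fun_prop
  · exact fun q ↦ mul_ne_zero (pow_ne_zero 2 (sub_conj_ne_zero _ _))
      (pow_ne_zero 2 (sub_conj_ne_zero _ _))

/-- Conjugating `γ` by an element of `Γ` amounts to translating both variables. -/
theorem hyperbolicIntegrand_conj (hφ : IsHolomorphicQuadraticDifferential Γ φ)
    (hμ : ∀ z : ℍ, μ z = (z.im : ℂ) ^ 2 * conj (φ z))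
    (hψ : IsHolomorphicQuadraticDifferential Γ ψ)
    (hν : ∀ z : ℍ, ν z = (z.im : ℂ) ^ 2 * conj (ψ z)) {α : PSL(2, ℝ)} (hα : α ∈ Γ)
    (γ : PSL(2, ℝ)) (z w : ℍ) :
    hyperbolicIntegrand μ ν (α * γ * α⁻¹) (α • z) (α • w) = hyperbolicIntegrand μ ν γ z w := by
  have hz := mobiusDeriv_ne_zero α z
  have hw := mobiusDeriv_ne_zero α w
  have hz' : conj (mobiusDeriv α z) ≠ 0 := (map_ne_zero _).2 hz
  have hw' : conj (mobiusDeriv α w) ≠ 0 := (map_ne_zero _).2 hw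
  have hc := mobiusDeriv_ne_zero α (γ • z)
  have h1 : μ (α • z) = μ z * mobiusDeriv α z / conj (mobiusDeriv α z) :=
    eq_div_of_mul_eq hz' (beltrami_smul hφ hμ hα z)
  have h2 : conj (ν (α • w)) = conj (ν w) * conj (mobiusDeriv α w) / mobiusDeriv α w := by
    have := congrArg conj (beltrami_smul hψ hν hα w)
    simp only [map_mul, Complex.conj_conj] at this
    exact eq_div_of_mul_eq hw this
  have h3 : (α * γ * α⁻¹) • α • z = α • γ • z := by simp [mul_smul]
  have h4 : mobiusDeriv (α * γ * α⁻¹) (α • z) =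
      mobiusDeriv α (γ • z) * mobiusDeriv γ z / mobiusDeriv α z := by
    refine eq_div_of_mul_eq hz ?_
    rw [← mobiusDeriv_mul, ← mobiusDeriv_mul]
    simp
  have e1 := sub_conj_ne_zero z w
  have e2 := sub_conj_ne_zero (γ • z) w
  simp only [hyperbolicIntegrand, ellipticIntegrand, Complex.ofReal_mul, Complex.ofReal_pow,
    im_smul_sq, h3, h4, smul_sub_smul_conj_sq, h1, h2]
  field_simp

theorem discChart_im_sq (p : ℍ) {ζ : ℂ} (hζ : ζ ∈ Metric.ball (0 : ℂ) 1) :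
    ((discChart p ζ).im : ℂ) ^ 2 =
      cayleyDeriv p ζ * conj (cayleyDeriv p ζ) * (1 - (‖ζ‖ : ℂ) ^ 2) ^ 2 / 4 := by
  have h := congrArg (fun x : ℝ ↦ (x : ℂ)) (norm_cayleyDeriv_mul p hζ)
  push_cast at h
  rw [Complex.mul_conj']
  linear_combination -(‖cayleyDeriv p ζ‖ * (1 - (‖ζ‖ : ℂ) ^ 2) + 2 * (discChart p ζ).im) / 4 * h

/-- In the disc coordinate at a fixed point of `γ` the integrand is the product of the quadratic
differentials with a Bergman kernel and its rotation by the multiplier of `γ`. -/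
theorem hyperbolicIntegrand_disc (hμ : ∀ z : ℍ, μ z = (z.im : ℂ) ^ 2 * conj (φ z))
    (hν : ∀ z : ℍ, ν z = (z.im : ℂ) ^ 2 * conj (ψ z)) {γ : PSL(2, ℝ)} {p : ℍ} (h : γ • p = p)
    {ζ ω : ℂ} (hζ : ζ ∈ Metric.ball (0 : ℂ) 1) (hω : ω ∈ Metric.ball (0 : ℂ) 1) :
    (discDensity ζ * discDensity ω : ℂ) *
        hyperbolicIntegrand μ ν γ (discChart p ζ) (discChart p ω) =
      discIntegrand (discPullback p φ) (discPullback p ψ) (mobiusDeriv γ p) ζ ω := by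
  have hεζ := mul_mem_ball (norm_mobiusDeriv_of_fixes h) hζ
  have hρ : (1 - (‖ζ‖ : ℂ) ^ 2) ≠ 0 := by exact_mod_cast (one_sub_norm_sq_pos hζ).ne'
  have hσ : (1 - (‖ω‖ : ℂ) ^ 2) ≠ 0 := by exact_mod_cast (one_sub_norm_sq_pos hω).ne'
  have ht := cayleyDeriv_ne_zero p hζ
  have hs := cayleyDeriv_ne_zero p hω
  have hs' : conj (cayleyDeriv p ω) ≠ 0 := (map_ne_zero _).2 hs
  have htt := cayleyDeriv_ne_zero p hεζ
  have h1 : mobiusDeriv γ (discChart p ζ) =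
      mobiusDeriv γ p * cayleyDeriv p (mobiusDeriv γ p * ζ) / cayleyDeriv p ζ :=
    eq_div_of_mul_eq ht (mobiusDeriv_discChart h hζ)
  have k1 : 1 - ζ * conj ω ≠ 0 := one_sub_ne_zero_of_norm_lt (norm_mul_conj_lt hζ hω)
  have k2 : 1 - mobiusDeriv γ p * ζ * conj ω ≠ 0 :=
    one_sub_ne_zero_of_norm_lt (norm_mul_conj_lt hεζ hω)
  simp only [hyperbolicIntegrand, ellipticIntegrand, discIntegrand, discPullback, twistFactor,
    smul_discChart h hζ, h1, discChart_sub_conj_sq p hζ hω, discChart_sub_conj_sq p hεζ hω,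
    hμ, hν, map_mul, map_pow, Complex.conj_conj, Complex.conj_ofReal, discDensity]
  push_cast
  simp only [discChart_im_sq p hζ, discChart_im_sq p hω]
  clear h1
  generalize cayleyDeriv p (mobiusDeriv γ p * ζ) = t at *
  generalize 1 - mobiusDeriv γ p * ζ * conj ω = d at *
  field_simp
  norm_num
  ring

end Beltrami

/-! ### The metric as an integral over the disc -/

section Metric

variable {Γ : Subgroup PSL(2, ℝ)} {F : Set ℍ} {φ ψ μ ν : ℍ → ℂ}

/-- The pairing of the two quadratic differentials against the Green weight on the disc; up to a
constant, both sides of the formula are equal to it. -/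
noncomputable def discPairing (p : ℍ) (φ ψ : ℍ → ℂ) : ℂ :=
  ∫ ζ in Metric.ball (0 : ℂ) 1,
    (greenWeight ‖ζ‖ : ℂ) * (conj (discPullback p φ ζ) * discPullback p ψ ζ)

theorem measurable_greenIntegrand (hμ : Continuous μ) (hν : Continuous ν) (p : ℍ) :
    Measurable fun z : ℍ ↦ (greenKernel p z : ℂ) * (μ z * conj (ν z)) := by
  simp only [greenKernel_eq]
  refine (Complex.measurable_ofReal.comp (measurable_greenProfile.comp
    (continuous_pointPair.comp (Continuous.prodMk_right p)).measurable)).mul ?_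
  exact (hμ.mul (Complex.continuous_conj.comp hν)).measurable

theorem greenIntegrand_disc (hμ : ∀ z : ℍ, μ z = (z.im : ℂ) ^ 2 * conj (φ z))
    (hν : ∀ z : ℍ, ν z = (z.im : ℂ) ^ 2 * conj (ψ z)) (p : ℍ)
    {ζ : ℂ} (hζ : ζ ∈ Metric.ball (0 : ℂ) 1) :
    (discDensity ζ : ℂ) * ((greenKernel p (discChart p ζ) : ℂ) *
        (μ (discChart p ζ) * conj (ν (discChart p ζ)))) =
      1 / 4 * ((greenWeight ‖ζ‖ : ℂ) * (conj (discPullback p φ ζ) * discPullback p ψ ζ)) := by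
  have hρ : (1 - (‖ζ‖ : ℂ) ^ 2) ≠ 0 := by exact_mod_cast (one_sub_norm_sq_pos hζ).ne'
  simp only [greenKernel_eq, pointPair_discChart p hζ, greenWeight, discDensity, discPullback,
    hμ, hν, map_mul, map_pow, Complex.conj_conj, Complex.conj_ofReal]
  push_cast
  simp only [discChart_im_sq p hζ]
  field_simp

theorem integrable_greenIntegrand [ProperlyDiscontinuousSMul Γ ℍ]
    (hF : IsFundamentalDomain Γ F volume) (hφ : IsHolomorphicQuadraticDifferential Γ φ)
    (hμ : ∀ z : ℍ, μ z = (z.im : ℂ) ^ 2 * conj (φ z))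
    (hψ : IsHolomorphicQuadraticDifferential Γ ψ)
    (hν : ∀ z : ℍ, ν z = (z.im : ℂ) ^ 2 * conj (ψ z)) (p : ℍ) :
    Integrable fun z : ℍ ↦ (greenKernel p z : ℂ) * (μ z * conj (ν z)) := by
  rw [integrable_iff_disc_complex p (measurable_greenIntegrand (continuous_beltrami hφ hμ)
    (continuous_beltrami hψ hν) p)]
  have h := integrableOn_greenWeight_mul (hφ.differentiableOn_discPullback p).continuousOn
    (hψ.differentiableOn_discPullback p).continuousOn (hφ.integrableOn_discPullback hF p)
    (hψ.integrableOn_discPullback hF p)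
  exact IntegrableOn.congr_fun (h.const_mul (1 / 4))
    (fun ζ hζ ↦ (greenIntegrand_disc hμ hν p hζ).symm) measurableSet_ball

theorem integral_greenIntegrand (hφ : IsHolomorphicQuadraticDifferential Γ φ)
    (hμ : ∀ z : ℍ, μ z = (z.im : ℂ) ^ 2 * conj (φ z))
    (hψ : IsHolomorphicQuadraticDifferential Γ ψ)
    (hν : ∀ z : ℍ, ν z = (z.im : ℂ) ^ 2 * conj (ψ z)) (p : ℍ) :
    ∫ z : ℍ, (greenKernel p z : ℂ) * (μ z * conj (ν z)) = 1 / 4 * discPairing p φ ψ := by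
  rw [integral_eq_disc p (measurable_greenIntegrand (continuous_beltrami hφ hμ)
    (continuous_beltrami hψ hν) p), discPairing, ← integral_const_mul]
  exact setIntegral_congr_fun measurableSet_ball fun ζ hζ ↦ greenIntegrand_disc hμ hν p hζ

theorem integrable_tsum_of_summable_integral_norm {α ι : Type*} [MeasurableSpace α] [Countable ι]
    {m : Measure α} {f : ι → α → ℂ} (hf : ∀ i, Integrable (f i) m)
    (hsum : Summable fun i ↦ ∫ a, ‖f i a‖ ∂m) (hpt : ∀ a, Summable fun i ↦ f i a) :
    Integrable (fun a ↦ ∑' i, f i a) m := by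
  refine ⟨aestronglyMeasurable_of_tendsto_ae (u := Filter.atTop)
    (f := fun s : Finset ι ↦ fun a ↦ ∑ i ∈ s, f i a) ?_ ?_, ?_⟩
  · intro s
    exact Finset.aestronglyMeasurable_fun_sum s fun i _ ↦ (hf i).1
  · exact Filter.Eventually.of_forall fun a ↦ (hpt a).hasSum
  · refine lt_of_le_of_lt (lintegral_mono fun a ↦ enorm_tsum_le_tsum_enorm) ?_
    rw [lintegral_tsum fun i ↦ (hf i).1.enorm]
    simp only [← ofReal_integral_norm_eq_lintegral_enorm (hf _)]
    exact hsum.tsum_ofReal_lt_top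

/-- The integrand of the metric is the sum of the translates of the integrand with the free
kernel. -/
theorem automorphicGreen_mul_eq_tsum (hφ : IsHolomorphicQuadraticDifferential Γ φ)
    (hμ : ∀ z : ℍ, μ z = (z.im : ℂ) ^ 2 * conj (φ z))
    (hψ : IsHolomorphicQuadraticDifferential Γ ψ)
    (hν : ∀ z : ℍ, ν z = (z.im : ℂ) ^ 2 * conj (ψ z)) (p z : ℍ) :
    (∀ γ : Γ, (greenKernel p (γ⁻¹ • z) : ℂ) * (μ (γ⁻¹ • z) * conj (ν (γ⁻¹ • z))) =
      (greenKernel (γ • p) z : ℂ) * (μ z * conj (ν z))) ∧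
    (automorphicGreen Γ p z : ℂ) * μ z * conj (ν z) =
      ∑' γ : Γ, (greenKernel p (γ⁻¹ • z) : ℂ) * (μ (γ⁻¹ • z) * conj (ν (γ⁻¹ • z))) := by
  have h : ∀ γ : Γ, (greenKernel p (γ⁻¹ • z) : ℂ) * (μ (γ⁻¹ • z) * conj (ν (γ⁻¹ • z))) =
      (greenKernel (γ • p) z : ℂ) * (μ z * conj (ν z)) := by
    intro γ
    have e1 : μ (γ⁻¹ • z) * conj (ν (γ⁻¹ • z)) = μ z * conj (ν z) :=
      beltrami_mul_conj_smul hφ hμ hψ hν (γ⁻¹).2 z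
    have e2 : pointPair p (γ⁻¹ • z) = pointPair (γ • p) z := by
      rw [← pointPair_smul (γ : PSL(2, ℝ)) p (γ⁻¹ • z)]
      congr 1
      exact smul_inv_smul γ z
    rw [e1, greenKernel_eq, greenKernel_eq, e2]
  refine ⟨h, ?_⟩
  simp only [h, tsum_mul_right, automorphicGreen, Complex.ofReal_tsum, mul_assoc]

/-- The metric unfolds to an integral over the upper half-plane with the free kernel. -/
theorem integrableOn_and_ellipticTZ_eq [ProperlyDiscontinuousSMul Γ ℍ]
    (hF : IsFundamentalDomain Γ F volume) (hφ : IsHolomorphicQuadraticDifferential Γ φ)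
    (hμ : ∀ z : ℍ, μ z = (z.im : ℂ) ^ 2 * conj (φ z))
    (hψ : IsHolomorphicQuadraticDifferential Γ ψ)
    (hν : ∀ z : ℍ, ν z = (z.im : ℂ) ^ 2 * conj (ψ z)) (p : ℍ) :
    IntegrableOn (fun z : ℍ ↦ (automorphicGreen Γ p z : ℂ) * μ z * conj (ν z)) F ∧
      ellipticTZ Γ F p μ ν = 1 / 2 * discPairing p φ ψ := by
  have := countable_of_properlyDiscontinuous Γ
  have hg := integrable_greenIntegrand hF hφ hμ hψ hν p
  obtain ⟨h1, h2⟩ := hasSum_unfold hF hg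
  have hi : ∀ γ : Γ, IntegrableOn (fun z ↦ (greenKernel p (γ⁻¹ • z) : ℂ) *
      (μ (γ⁻¹ • z) * conj (ν (γ⁻¹ • z)))) F := fun γ ↦
    ((measurePreserving_smul γ⁻¹ (volume : Measure ℍ)).integrable_comp_of_integrable hg).integrableOn
  have h3 := hasSum_integral_of_summable_integral_norm hi h1
  rw [ellipticTZ]
  simp only [fun z ↦ (automorphicGreen_mul_eq_tsum hφ hμ hψ hν p z).2]
  constructor
  · refine integrable_tsum_of_summable_integral_norm hi h1 fun z ↦ ?_
    simp only [fun γ ↦ (automorphicGreen_mul_eq_tsum hφ hμ hψ hν p z).1 γ]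
    exact (Complex.hasSum_ofReal.2 (summable_greenKernel Γ p z).hasSum).summable.mul_right _
  · rw [h3.unique h2, integral_greenIntegrand hφ hμ hψ hν p]
    ring

end Metric

/-! ### Passage from Lebesgue measure to hyperbolic area -/

section Lebesgue

variable {F : Set ℍ} {μ ν : ℍ → ℂ}

theorem lebesgueUHP_eq_withDensity :
    lebesgueUHP = (volume : Measure ℍ).withDensity fun z ↦ ENNReal.ofReal (z.im ^ 2) := by
  have hm : Measurable fun z : ℍ ↦
      (((1 / NNReal.mk z.im z.im_pos.le) ^ 2 : NNReal) : ENNReal) := by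
    have : Measurable fun z : ℍ ↦ NNReal.mk z.im z.im_pos.le := continuous_im.measurable.subtype_mk
    fun_prop
  have hne : ∀ z : ℍ, (1 / NNReal.mk z.im z.im_pos.le) ^ 2 ≠ 0 := fun z ↦
    pow_ne_zero 2 (div_ne_zero one_ne_zero fun h ↦ z.im_ne_zero (congrArg NNReal.toReal h))
  have h := withDensity_inv_same (μ := lebesgueUHP) hm
    (Filter.Eventually.of_forall fun z ↦
      ENNReal.coe_ne_zero.2 (hne z)) (Filter.Eventually.of_forall fun z ↦ ENNReal.coe_ne_top)
  rw [volume_def, ← h]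
  unfold lebesgueUHP at *
  rw [h]
  refine h.symm.trans ?_
  congr 1
  ext z
  rw [← ENNReal.coe_inv (hne z), ENNReal.ofReal, ENNReal.coe_inj]
  ext
  rw [Real.coe_toNNReal _ (sq_nonneg _)]
  simp

/-- No measurability of `F` is needed: a fundamental domain is only null-measurable. -/
theorem lebesgueUHP_restrict_eq_withDensity (F : Set ℍ) :
    lebesgueUHP.restrict F =
      ((volume : Measure ℍ).restrict F).withDensity fun z ↦ ENNReal.ofReal (z.im ^ 2) := by
  rw [lebesgueUHP_eq_withDensity, restrict_withDensity']

theorem measurable_im_sq : Measurable fun z : ℍ ↦ z.im ^ 2 := continuous_im.measurable.pow_const 2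

theorem integrable_ellipticIntegrand {γ : PSL(2, ℝ)}
    (h : Integrable (fun q : ℍ × ℍ ↦ hyperbolicIntegrand μ ν γ q.1 q.2)
      ((volume : Measure ℍ).prod volume)) (F : Set ℍ) :
    Integrable (fun q : ℍ × ℍ ↦ ellipticIntegrand μ ν γ q.1 q.2)
      ((lebesgueUHP.restrict F).prod lebesgueUHP) := by
  rw [lebesgueUHP_restrict_eq_withDensity, lebesgueUHP_eq_withDensity,
    integrable_prod_withDensity_ofReal measurable_im_sq (fun z ↦ sq_nonneg _)
      measurable_im_sq (fun z ↦ sq_nonneg _)]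
  have h1 := Measure.prod_restrict (μ := (volume : Measure ℍ)) (ν := (volume : Measure ℍ))
    F Set.univ
  rw [Measure.restrict_univ] at h1
  rw [h1]
  exact h.restrict

theorem integral_ellipticIntegrand (μ ν : ℍ → ℂ) (γ : PSL(2, ℝ)) (F : Set ℍ) :
    ∫ z in F, ∫ w, ellipticIntegrand μ ν γ z w ∂lebesgueUHP ∂lebesgueUHP =
      ∫ z in F, ∫ w, hyperbolicIntegrand μ ν γ z w := by
  rw [lebesgueUHP_restrict_eq_withDensity,
    integral_withDensity_ofReal measurable_im_sq (fun z ↦ sq_nonneg _)]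
  congr 1
  ext z
  rw [lebesgueUHP_eq_withDensity,
    integral_withDensity_ofReal measurable_im_sq (fun z ↦ sq_nonneg _), ← integral_smul]
  congr 1
  ext w
  rw [hyperbolicIntegrand, smul_smul, Complex.real_smul]

end Lebesgue

/-! ### Unfolding the sum over the conjugates -/

section Conjugates

variable {Γ : Subgroup PSL(2, ℝ)} {F : Set ℍ} {φ ψ μ ν : ℍ → ℂ}

theorem integrable_hyperbolicIntegrand_of_fixes [ProperlyDiscontinuousSMul Γ ℍ]
    (hF : IsFundamentalDomain Γ F volume) (hφ : IsHolomorphicQuadraticDifferential Γ φ)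
    (hμ : ∀ z : ℍ, μ z = (z.im : ℂ) ^ 2 * conj (φ z))
    (hψ : IsHolomorphicQuadraticDifferential Γ ψ)
    (hν : ∀ z : ℍ, ν z = (z.im : ℂ) ^ 2 * conj (ψ z)) {γ : PSL(2, ℝ)} {p : ℍ} (h : γ • p = p)
    (h1 : mobiusDeriv γ p ≠ 1) :
    Integrable (fun q : ℍ × ℍ ↦ hyperbolicIntegrand μ ν γ q.1 q.2)
      ((volume : Measure ℍ).prod volume) := by
  rw [integrable_prod_iff_disc p (measurable_hyperbolicIntegrand (continuous_beltrami hφ hμ)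
    (continuous_beltrami hψ hν) γ)]
  have hi := integrable_discIntegrand (norm_mobiusDeriv_of_fixes h) h1
    (hφ.differentiableOn_discPullback p).continuousOn
    (hψ.differentiableOn_discPullback p).continuousOn (hφ.integrableOn_discPullback hF p)
    (hψ.integrableOn_discPullback hF p)
  refine hi.congr ?_
  rw [Measure.prod_restrict]
  refine (ae_restrict_iff' (measurableSet_ball.prod measurableSet_ball)).2
    (Filter.Eventually.of_forall fun q hq ↦ ?_)
  simp only [← hyperbolicIntegrand_disc hμ hν h hq.1 hq.2]
  push_cast; rfl

theorem integral_hyperbolicIntegrand_of_fixes [ProperlyDiscontinuousSMul Γ ℍ]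
    (hF : IsFundamentalDomain Γ F volume) (hφ : IsHolomorphicQuadraticDifferential Γ φ)
    (hμ : ∀ z : ℍ, μ z = (z.im : ℂ) ^ 2 * conj (φ z))
    (hψ : IsHolomorphicQuadraticDifferential Γ ψ)
    (hν : ∀ z : ℍ, ν z = (z.im : ℂ) ^ 2 * conj (ψ z)) {γ : PSL(2, ℝ)} {p : ℍ} (h : γ • p = p)
    (h1 : mobiusDeriv γ p ≠ 1) :
    ∫ z, ∫ w, hyperbolicIntegrand μ ν γ z w =
      ∫ ζ in Metric.ball (0 : ℂ) 1, ∫ ω in Metric.ball (0 : ℂ) 1,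
        discIntegrand (discPullback p φ) (discPullback p ψ) (mobiusDeriv γ p) ζ ω := by
  have := integral_prod_eq_disc p (measurable_hyperbolicIntegrand (continuous_beltrami hφ hμ)
    (continuous_beltrami hψ hν) γ)
    (integrable_hyperbolicIntegrand_of_fixes hF hφ hμ hψ hν h h1)
  refine this.trans ?_
  refine setIntegral_congr_fun measurableSet_ball fun ζ hζ ↦ ?_
  exact setIntegral_congr_fun measurableSet_ball fun ω hω ↦ hyperbolicIntegrand_disc hμ hν h hζ hω

theorem integrable_hyperbolicIntegrand_conj (hφ : IsHolomorphicQuadraticDifferential Γ φ)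
    (hμ : ∀ z : ℍ, μ z = (z.im : ℂ) ^ 2 * conj (φ z))
    (hψ : IsHolomorphicQuadraticDifferential Γ ψ)
    (hν : ∀ z : ℍ, ν z = (z.im : ℂ) ^ 2 * conj (ψ z)) {α : PSL(2, ℝ)} (hα : α ∈ Γ)
    {γ : PSL(2, ℝ)} (hi : Integrable (fun q : ℍ × ℍ ↦ hyperbolicIntegrand μ ν γ q.1 q.2)
      ((volume : Measure ℍ).prod volume)) :
    Integrable (fun q : ℍ × ℍ ↦ hyperbolicIntegrand μ ν (α * γ * α⁻¹) q.1 q.2)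
      ((volume : Measure ℍ).prod volume) := by
  have h := ((measurePreserving_smul α⁻¹ (volume : Measure ℍ)).prod
    (measurePreserving_smul α⁻¹ (volume : Measure ℍ))).integrable_comp_of_integrable hi
  refine h.congr (Filter.Eventually.of_forall fun q ↦ ?_)
  simp only [Function.comp_apply, Prod.map_fst, Prod.map_snd]
  rw [← hyperbolicIntegrand_conj hφ hμ hψ hν hα, smul_inv_smul, smul_inv_smul]

theorem integral_hyperbolicIntegrand_conj (hφ : IsHolomorphicQuadraticDifferential Γ φ)
    (hμ : ∀ z : ℍ, μ z = (z.im : ℂ) ^ 2 * conj (φ z))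
    (hψ : IsHolomorphicQuadraticDifferential Γ ψ)
    (hν : ∀ z : ℍ, ν z = (z.im : ℂ) ^ 2 * conj (ψ z)) {α : PSL(2, ℝ)} (hα : α ∈ Γ)
    (γ : PSL(2, ℝ)) (z : ℍ) :
    ∫ w, hyperbolicIntegrand μ ν (α * γ * α⁻¹) z w =
      ∫ w, hyperbolicIntegrand μ ν γ (α⁻¹ • z) w := by
  rw [← integral_smul_eq_self (fun w ↦ hyperbolicIntegrand μ ν (α * γ * α⁻¹) z w) (g := α)]
  congr 1
  ext w
  rw [← hyperbolicIntegrand_conj hφ hμ hψ hν hα γ (α⁻¹ • z) w, smul_inv_smul]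

/-- For fixed `γ`, the integrals attached to the conjugates `α γ α⁻¹` unfold to a single integral
over two copies of the upper half-plane. -/
theorem hasSum_integral_conj [Countable Γ] (hF : IsFundamentalDomain Γ F volume)
    (hφ : IsHolomorphicQuadraticDifferential Γ φ)
    (hμ : ∀ z : ℍ, μ z = (z.im : ℂ) ^ 2 * conj (φ z))
    (hψ : IsHolomorphicQuadraticDifferential Γ ψ)
    (hν : ∀ z : ℍ, ν z = (z.im : ℂ) ^ 2 * conj (ψ z)) {γ : PSL(2, ℝ)}
    (hi : Integrable (fun q : ℍ × ℍ ↦ hyperbolicIntegrand μ ν γ q.1 q.2)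
      ((volume : Measure ℍ).prod volume)) :
    HasSum (fun α : Γ ↦ ∫ z in F, ∫ w,
        ellipticIntegrand μ ν ((α : PSL(2, ℝ)) * γ * (α : PSL(2, ℝ))⁻¹) z w ∂lebesgueUHP ∂lebesgueUHP)
      (∫ z, ∫ w, hyperbolicIntegrand μ ν γ z w) := by
  refine (hasSum_unfold hF hi.integral_prod_left).2.congr_fun ?_
  intro α
  rw [integral_ellipticIntegrand]
  simp only [integral_hyperbolicIntegrand_conj hφ hμ hψ hν α.2]
  rfl

end Conjugates

/-! ### Counting the representations of a conjugate -/

/-- A nontrivial rotation has a single fixed point in the upper half-plane. -/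
theorem eq_of_fixes_of_fixes {γ : PSL(2, ℝ)} {p q : ℍ} (hp : γ • p = p) (hq : γ • q = q)
    (h1 : mobiusDeriv γ p ≠ 1) : q = p := by
  have h := smul_sub_fixed hp q
  rw [hq] at h
  have h2 : (1 - mobiusDeriv γ p) * ((q : ℂ) - p) * ((q : ℂ) - conj (p : ℂ)) = 0 := by
    linear_combination h
  rcases mul_eq_zero.1 h2 with h3 | h3
  · rcases mul_eq_zero.1 h3 with h4 | h4
    · exact absurd (sub_eq_zero.1 h4).symm h1
    · exact UpperHalfPlane.ext (sub_eq_zero.1 h4)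
  · exact absurd h3 (sub_conj_ne_zero q p)

/-- The parametrization `(l, α) ↦ α τ^l α⁻¹` of the conjugates of the nontrivial powers. -/
def conjPow (Γ : Subgroup PSL(2, ℝ)) (τ : PSL(2, ℝ)) (m : ℕ)
    (x : (_ : Finset.Icc 1 (m - 1)) × Γ) : conjugatePowers Γ τ m :=
  ⟨x.2 * τ ^ (x.1 : ℕ) * (x.2 : PSL(2, ℝ))⁻¹, x.2, x.2.2, x.1, (Finset.mem_Icc.1 x.1.2).1,
    (Finset.mem_Icc.1 x.1.2).2, rfl⟩

namespace IsEllipticGenerator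

variable {Γ : Subgroup PSL(2, ℝ)} {τ : PSL(2, ℝ)} {p : ℍ} {m : ℕ}

/-- The multiplier of an elliptic generator of order `m` is a primitive `m`-th root of unity. -/
theorem isPrimitiveRoot (hτ : IsEllipticGenerator Γ τ p m) :
    IsPrimitiveRoot (mobiusDeriv τ p) m := by
  have h := mobiusDeriv_pow_of_fixes hτ.fixes
  refine ⟨?_, fun l hl ↦ ?_⟩
  · rw [← (h m).2, ← hτ.order_eq, pow_orderOf_eq_one, mobiusDeriv_one]
  · rw [← hτ.order_eq]
    exact orderOf_dvd_of_pow_eq_one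
      (eq_one_of_fixes_of_mobiusDeriv_eq_one (h l).1 ((h l).2.trans hl))

theorem mobiusDeriv_pow_ne_one (hτ : IsEllipticGenerator Γ τ p m) {l : ℕ}
    (hl : l ∈ Finset.Icc 1 (m - 1)) : mobiusDeriv (τ ^ l) p ≠ 1 := by
  have := hτ.two_le
  rw [Finset.mem_Icc] at hl
  rw [(mobiusDeriv_pow_of_fixes hτ.fixes l).2]
  exact hτ.isPrimitiveRoot.pow_ne_one_of_pos_of_lt (by omega) (by omega)

/-- Every conjugate has `m` representations: the exponent is determined, and `α` is determined up
to the stabilizer of the fixed point. -/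
theorem card_fiber_conjPow (hτ : IsEllipticGenerator Γ τ p m) (γ : conjugatePowers Γ τ m) :
    Nat.card {x // conjPow Γ τ m x = γ} = m := by
  obtain ⟨γ, α, hα, l, hl1, hl2, rfl⟩ := γ
  have hm := hτ.two_le
  have hl : l ∈ Finset.Icc 1 (m - 1) := Finset.mem_Icc.2 ⟨hl1, hl2⟩
  have hle : Subgroup.zpowers τ ≤ Γ := by simpa using hτ.mem
  have hcomm : ∀ t : Subgroup.zpowers τ, ∀ k : ℕ, (t : PSL(2, ℝ)) * τ ^ k * (t : PSL(2, ℝ))⁻¹ =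
      τ ^ k := by
    rintro ⟨t, n, rfl⟩ k
    simp only
    rw [((Commute.refl τ).zpow_left n).pow_right k |>.eq, mul_inv_cancel_right]
  let f : Subgroup.zpowers τ → {x // conjPow Γ τ m x =
      ⟨α * τ ^ l * α⁻¹, α, hα, l, hl1, hl2, rfl⟩} := fun t ↦
    ⟨⟨⟨l, hl⟩, ⟨α * t, Γ.mul_mem hα (hle t.2)⟩⟩, by
      refine Subtype.ext ?_
      change α * t * τ ^ l * (α * t : PSL(2, ℝ))⁻¹ = α * τ ^ l * α⁻¹
      nth_rewrite 2 [← hcomm t l]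
      group⟩
  have hf : Function.Bijective f := by
    constructor
    · intro s t h
      have h1 := congrArg (fun x ↦ ((x.1.2 : Γ) : PSL(2, ℝ))) h
      exact Subtype.ext (mul_left_cancel h1)
    · rintro ⟨⟨⟨k, hk⟩, ⟨β, hβ⟩⟩, hx⟩
      have h0 : β * τ ^ k * β⁻¹ = α * τ ^ l * α⁻¹ := congrArg Subtype.val hx
      have h1 : τ ^ l * (α⁻¹ * β) = α⁻¹ * β * τ ^ k := by
        calc τ ^ l * (α⁻¹ * β) = α⁻¹ * (α * τ ^ l * α⁻¹) * β := by group
          _ = α⁻¹ * (β * τ ^ k * β⁻¹) * β := by rw [h0]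
          _ = α⁻¹ * β * τ ^ k := by group
      have h2 : τ ^ l • (α⁻¹ * β) • p = (α⁻¹ * β) • p := by
        rw [← mul_smul, h1, mul_smul, (mobiusDeriv_pow_of_fixes hτ.fixes k).1]
      have h3 := eq_of_fixes_of_fixes (mobiusDeriv_pow_of_fixes hτ.fixes l).1 h2
        (hτ.mobiusDeriv_pow_ne_one hl)
      have h4 := hτ.stabilizer _ (Γ.mul_mem (Γ.inv_mem hα) hβ) h3
      have h5 : τ ^ k = τ ^ l := by
        have h6 := hcomm ⟨_, h4⟩ k
        rw [← h6]
        simp only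
        rw [← h1, mul_inv_cancel_right]
      rw [Finset.mem_Icc] at hk
      have h6 : k = l := pow_injOn_Iio_orderOf
        (by rw [hτ.order_eq, Set.mem_Iio]; omega) (by rw [hτ.order_eq, Set.mem_Iio]; omega) h5
      subst h6
      refine ⟨⟨_, h4⟩, Subtype.ext ?_⟩
      simp [f]
  rw [← Nat.card_congr (Equiv.ofBijective f hf), Nat.card_zpowers, hτ.order_eq]

end IsEllipticGenerator

theorem hasSum_of_card_fiber {ι κ : Type*} {f : ι → κ} {m : ℕ} (hm : m ≠ 0)
    (hf : ∀ k, Nat.card {i // f i = k} = m) {g : κ → ℂ} {a : ℂ} (h : HasSum (fun i ↦ g (f i)) a) :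
    HasSum (fun k ↦ (m : ℂ) * g k) a := by
  have h1 := ((Equiv.sigmaFiberEquiv f).hasSum_iff (f := fun i ↦ g (f i))).2 h
  refine h1.sigma fun k ↦ ?_
  have : Finite {i // f i = k} := Nat.finite_of_card_ne_zero (by rw [hf k]; exact hm)
  have := Fintype.ofFinite {i // f i = k}
  have h2 := hasSum_fintype fun i : {i // f i = k} ↦ g (f i)
  have h3 : ∑ i : {i // f i = k}, g (f i) = m * g k := by
    rw [Finset.sum_congr rfl fun i _ ↦ by rw [i.2], Finset.sum_const, Finset.card_univ,
      ← Nat.card_eq_fintype_card, hf k, nsmul_eq_mul]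
  rw [h3] at h2
  exact h2

theorem hasSum_sigma_of_finite {ι κ : Type*} [Fintype ι] {g : (_ : ι) × κ → ℂ} {a : ι → ℂ}
    (h : ∀ i, HasSum (fun k ↦ g ⟨i, k⟩) (a i)) : HasSum g (∑ i, a i) := by
  have hs : Summable g := by
    refine Summable.of_norm ((summable_sigma_of_nonneg fun x ↦ norm_nonneg _).2
      ⟨fun i ↦ (h i).summable.norm, (hasSum_fintype _).summable⟩)
  exact HasSum.sigma_of_hasSum (hasSum_fintype a) h hs

/-! ### The integral formula -/

section Formula

variable {Γ : Subgroup PSL(2, ℝ)} {F : Set ℍ} {φ ψ μ ν : ℍ → ℂ} {τ : PSL(2, ℝ)} {p : ℍ} {m : ℕ}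

/-- The factor `m` is the number of pairs `(l, α)` that represent a given conjugate. -/
theorem hasSum_conjugatePowers [ProperlyDiscontinuousSMul Γ ℍ]
    (hF : IsFundamentalDomain Γ F volume) (hτ : IsEllipticGenerator Γ τ p m)
    (hφ : IsHolomorphicQuadraticDifferential Γ φ)
    (hμ : ∀ z : ℍ, μ z = (z.im : ℂ) ^ 2 * conj (φ z))
    (hψ : IsHolomorphicQuadraticDifferential Γ ψ)
    (hν : ∀ z : ℍ, ν z = (z.im : ℂ) ^ 2 * conj (ψ z)) :
    HasSum (fun γ : conjugatePowers Γ τ m ↦ (m : ℂ) *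
        ∫ z in F, ∫ w, ellipticIntegrand μ ν γ z w ∂lebesgueUHP ∂lebesgueUHP)
      (-(((m : ℂ) ^ 2 - 1) * (Real.pi : ℂ) ^ 2 / 48) * discPairing p φ ψ) := by
  have := countable_of_properlyDiscontinuous Γ
  have hfix := mobiusDeriv_pow_of_fixes hτ.fixes
  have h1 := disc_identity hτ.two_le hτ.isPrimitiveRoot (hφ.differentiableOn_discPullback p)
    (hψ.differentiableOn_discPullback p) (hφ.integrableOn_discPullback hF p)
    (hψ.integrableOn_discPullback hF p)
    fun ζ hζ ↦ hψ.discPullback_rotation hτ.mem hτ.fixes hζ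
  have h2 : ∀ l : Finset.Icc 1 (m - 1), HasSum (fun α : Γ ↦ ∫ z in F, ∫ w,
      ellipticIntegrand μ ν ((α : PSL(2, ℝ)) * τ ^ (l : ℕ) * (α : PSL(2, ℝ))⁻¹) z w
        ∂lebesgueUHP ∂lebesgueUHP)
      (∫ ζ in Metric.ball (0 : ℂ) 1, ∫ ω in Metric.ball (0 : ℂ) 1,
        discIntegrand (discPullback p φ) (discPullback p ψ) (mobiusDeriv τ p ^ (l : ℕ)) ζ ω) := by
    intro l
    have hl := hτ.mobiusDeriv_pow_ne_one l.2
    rw [← (hfix l).2, ← integral_hyperbolicIntegrand_of_fixes hF hφ hμ hψ hν (hfix l).1 hl]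
    exact hasSum_integral_conj hF hφ hμ hψ hν
      (integrable_hyperbolicIntegrand_of_fixes hF hφ hμ hψ hν (hfix l).1 hl)
  rw [discPairing, ← h1, ← Finset.sum_coe_sort]
  exact hasSum_of_card_fiber (f := conjPow Γ τ m)
    (g := fun γ ↦ ∫ z in F, ∫ w, ellipticIntegrand μ ν γ z w ∂lebesgueUHP ∂lebesgueUHP)
    (by have := hτ.two_le; omega) hτ.card_fiber_conjPow (hasSum_sigma_of_finite h2)

end Formula

theorem mainTheorem10 (Γ : Subgroup PSL(2, ℝ)) (hΓ : IsCofiniteFuchsian Γ)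
    (F : Set ℍ) (hF : IsFundamentalDomain Γ F volume)
    (τ : PSL(2, ℝ)) (p : ℍ) (m : ℕ) (hτ : IsEllipticGenerator Γ τ p m)
    (μ ν : ℍ → ℂ) (hμ : IsHarmonicBeltrami Γ μ) (hν : IsHarmonicBeltrami Γ ν) :
    -- the series and the integral that define the elliptic TZ metric converge
    (∀ z : ℍ, Summable fun γ : Γ ↦ greenKernel (γ • p) z) ∧
    IntegrableOn (fun z : ℍ ↦ (automorphicGreen Γ p z : ℂ) * μ z * conj (ν z)) F volume ∧
    -- the double integrals and their sum converge absolutely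
    (∀ γ ∈ conjugatePowers Γ τ m,
      Integrable (fun q : ℍ × ℍ ↦ ellipticIntegrand μ ν γ q.1 q.2)
        ((lebesgueUHP.restrict F).prod lebesgueUHP)) ∧
    (Summable fun γ : conjugatePowers Γ τ m ↦
      ∫ z in F, ∫ w, ellipticIntegrand μ ν γ z w ∂lebesgueUHP ∂lebesgueUHP) ∧
    -- the integral formula
    ellipticTZ Γ F p μ ν =
      -(24 * (m : ℂ) / ((m : ℂ) ^ 2 - 1)) * (1 / (Real.pi : ℂ) ^ 2) *
        ∑' γ : conjugatePowers Γ τ m,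
          ∫ z in F, ∫ w, ellipticIntegrand μ ν γ z w ∂lebesgueUHP ∂lebesgueUHP := by
  have := hΓ.discontinuous
  obtain ⟨φ, hφ, hμ⟩ := hμ
  obtain ⟨ψ, hψ, hν⟩ := hν
  obtain ⟨h1, h2⟩ := integrableOn_and_ellipticTZ_eq hF hφ hμ hψ hν p
  have h3 := hasSum_conjugatePowers hF hτ hφ hμ hψ hν
  have hm := hτ.two_le
  have hm0 : (m : ℂ) ≠ 0 := by exact_mod_cast (by omega : m ≠ 0)
  have hm1 : (m : ℂ) ^ 2 - 1 ≠ 0 := by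
    have h4 : m ^ 2 ≠ 1 := by nlinarith
    exact sub_ne_zero.2 (by exact_mod_cast h4)
  have hπ : (Real.pi : ℂ) ≠ 0 := by exact_mod_cast Real.pi_ne_zero
  refine ⟨summable_greenKernel Γ p, h1, ?_, (summable_mul_left_iff hm0).1 h3.summable, ?_⟩
  · rintro _ ⟨α, hα, l, hl1, hl2, rfl⟩
    exact integrable_ellipticIntegrand (integrable_hyperbolicIntegrand_conj hφ hμ hψ hν hα
      (integrable_hyperbolicIntegrand_of_fixes hF hφ hμ hψ hν
        (mobiusDeriv_pow_of_fixes hτ.fixes l).1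
        (hτ.mobiusDeriv_pow_ne_one (Finset.mem_Icc.2 ⟨hl1, hl2⟩)))) F
  · have h4 := h3.tsum_eq
    rw [tsum_mul_left] at h4
    rw [h2, eq_div_of_mul_eq hm0 ((mul_comm _ _).trans h4)]
    field_simp
    ring
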